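/- Let $r_0>0$, $E>0$, $n\ge 3$ an integer, and let $\varepsilon_\omega,\varepsilon_{2\omega},\chi_\perp,\chi_\parallel\in\mathbb C$ with $\varepsilon_\omega\neq-1$, $\varepsilon_{2\omega}\neq-1$. Put $f(\theta)=r_0\cos(n\theta)$, $\Omega=\{|x|<r_0\}\subset\mathbb R^2$, $H(x)=-Ex_1$, and for small $\epsilon>0$ let $\Omega_\epsilon$ be the domain bounded by $r=r_0(1+\epsilon\cos n\theta)$. **Governing equations.** For a bounded domain $D$ with outward unit normal $\nu$ and counterclockwise unit tangent $T$, consider (complex-valued) potentials $u,v$ (fundamental and second-harmonic), harmonic in $D$ and in $\mathbb R^2\setminus\overline D$ and $C^2$ up to $\partial D$ from each side (limits denoted $|_-$ from inside, $|_+$ from outside), such that on $\partial D$ $$u|_+=u|_-,\quad \partial_\nu u|_+=\varepsilon_\omega\partial_\nu u|_-,\quad v|_+-v|_-=4\pi P_\perp,\quad \partial_\nu v|_+-\varepsilon_{2\omega}\partial_\nu v|_-=-4\pi\sigma,$$ where $P_\perp=\chi_\perp(\varepsilon_\omega\partial_\nu u|_-)^2$, $P_\parallel=2\chi_\parallel\varepsilon_\omega\,\partial_\nu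 u|_-\,\partial_Tu|_-$ and $\sigma=-\partial_TP_\parallel$; and $u=H+O(|x|^{-1})$, $v=o(1)$ as $|x|\to\infty$. **Leading- and first-order systems on the disk.** $(u_\omega^{(0)},u_{2\omega}^{(0)})$ solves the governing equations for $D=\Omega$, with $u_{2\omega}^{(0)}=O(|x|^{-2})$; write $P^{(0)}_\parallel$ for its $P_\parallel$. The pair $(u_\omega^{(1)},u_{2\omega}^{(1)})$ is harmonic off $\partial\Omega$ and $C^2$ up to $\partial\Omega$ from each side, with $u_\omega^{(1)}=O(|x|^{-1})$, $u_{2\omega}^{(1)}=o(1)$, and satisfies on $\partial\Omega$ $$u_\omega^{(1)}|_+-u_\omega^{(1)}|_-=J[u_\omega^{(0)}],\qquad \partial_\nu u_\omega^{(1)}|_+-\varepsilon_\omega\partial_\nu u_\omega^{(1)}|_-=F_{\varepsilon_\omega}[u_\omega^{(0)}],$$ $$u_{2\omega}^{(1)}|_+-u_{2\omega}^{(1)}|_-=J[u_{2\omega}^{(0)}]+4\pi P_\perp^{(1)},\qquad \partial_\nu u_{2\omega}^{(1)}|_+-\varepsilon_{2\omega}\partial_\nu u_{2\omega}^{(1)}|_-=F_{\varepsilon_{2\omega}}[u_{2\omega}^{(0)}]-4\pi\sigma^{(1)}.$$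 Here, with $f'=\partial_Tf=r_0^{-1}\,df/d\theta$, $$J[w]=f(\partial_\nu w|_--\partial_\nu w|_+),\qquad F_e[w]=f(e\,\partial_\nu^2w|_--\partial_\nu^2w|_+)+f'(\partial_Tw|_+-e\,\partial_Tw|_-),$$ and, all values of $u_\omega^{(0)},u_\omega^{(1)}$ being taken from inside, $$N=\partial_\nu u_\omega^{(1)}+f\partial_\nu^2u_\omega^{(0)}-f'\partial_Tu_\omega^{(0)},\qquad S=\partial_Tu_\omega^{(1)}+f\partial_\nu\partial_Tu_\omega^{(0)}+f'\partial_\nu u_\omega^{(0)},$$ $$P^{(1)}_\perp=2\chi_\perp\varepsilon_\omega^2\,\partial_\nu u_\omega^{(0)}N,\qquad P_\parallel^{(1)}=2\chi_\parallel\varepsilon_\omega(\partial_\nu u_\omega^{(0)}S+\partial_Tu_\omega^{(0)}N),$$ $$\sigma^{(1)}=\frac{f}{r_0}\cdot\frac1{r_0}\frac{dP^{(0)}_\parallel}{d\theta}-\frac1{r_0}\frac{dP_\parallel^{(1)}}{d\theta}.$$ **Theorem.** 1. The leading- and first-order systems have a solution. 2. Let $(u^\epsilon_\omega,u^\epsilon_{2\omega})$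 solve the governing equations for $D=\Omega_\epsilon$ for all small $\epsilon>0$, and suppose that they have field expansions $u^\epsilon=u^{(0)}+\epsilon u^{(1)}+O(\epsilon^2)$ as $\epsilon\to0^+$, with $u_\omega^{(0)}=H+O(|x|^{-1})$, $u_\omega^{(1)}=O(|x|^{-1})$, $u_{2\omega}^{(0)},u_{2\omega}^{(1)}=o(1)$ at infinity. This means: for some $\delta\in(0,r_0)$ the inner branches of $u^\epsilon$, $u^{(0)}$, $u^{(1)}$ extend harmonically to $|x|<r_0+\delta$, the outer ones to $|x|>r_0-\delta$, and the remainder is bounded by $C\epsilon^2$ uniformly on $|x|<r_0+\delta$ for the inner and on $r_0-\delta<|x|<r_0+\delta$ for the outer branches. Then the coefficients solve the leading- and first-order systems. 3. For every solution of these systems, for $r>r_0$, $$u_{2\omega}^{(1)}=M_{n-2}\frac{\cos((n-2)\theta)}{r^{n-2}}+M_n\frac{\cos(n\theta)}{r^n}+M_{n+2}\frac{\cos((n+2)\theta)}{r^{n+2}},$$ where, with $K=\dfrac{8\pi E^2}{(1+\varepsilon_{2\omega})(1+\varepsilon_\omega)^2}$, $$M_{n-2}=K\Big(\tfrac{\varepsilon_{2\omega}-3}{1+\varepsilon_{2\omega}}\chi_\perp\varepsilon_\omega^2\varepsilon_{2\omega}+\tfrac{(n-2)\varepsilon_\omega-(3n-2)}{1+\varepsilon_\omega}\chi_\perp\varepsilon_\omega^2\varepsilon_{2\omega}+2\tfrac{(n-1)+(n+3)\varepsilon_{2\omega}}{1+\varepsilon_{2\omega}}\chi_\parallel\varepsilon_\omega\Big)r_0^{n-2},$$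 $$M_n=2K\,\tfrac{\varepsilon_\omega-1}{1+\varepsilon_\omega}(n-1)\big(\chi_\perp\varepsilon_\omega^2\varepsilon_{2\omega}+2\chi_\parallel\varepsilon_\omega\big)r_0^n,\qquad M_{n+2}=K(n+1)\big(\chi_\perp\varepsilon_\omega^2\varepsilon_{2\omega}+2\chi_\parallel\varepsilon_\omega\big)r_0^{n+2}.$$ Call a field that is harmonic outside some circle $2^k$-multipole radiation if it is $O(|x|^{-k})$ as $|x|\to\infty$, and dipole radiation if $k=1$. Then $u_{2\omega}^{(1)}$ is $2^{n-2}$-multipole radiation, and it is even $2^{n-1}$-multipole radiation if and only if $M_{n-2}=0$. If $n=3$, then for every $\epsilon>0$ the field $u_{2\omega}^{(0)}+\epsilon u_{2\omega}^{(1)}$ is dipole radiation, and it is $O(|x|^{-2})$ if and only if $M_1=0$. 4. For $0<\epsilon<1$ the curve $r=r_0(1+\epsilon\cos n\theta)$ has symmetry degree $2n$ (the number of rotations about the origin and reflections across lines through the origin that map it onto itself). Moreover $n=3$ if and only if this curve is not invariant under $x\mapsto-x$ and its symmetry degree is at most that of every curve $r=r_0(1+\epsilon\cos k\theta)$, $k\ge3$,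 that is not invariant under $x\mapsto-x$. -/

import Mathlib

open Set Filter Topology Asymptotics Bornology InnerProductSpace

noncomputable section

/-! The plane `ℝ²` is identified with `ℂ` (`x₁ = re z`, `x₂ = im z`, `z = r e^{iθ}`).  Potentials are
complex valued, so that lossy (complex) permittivities are included; `fderiv ℝ` is the real
derivative and harmonicity is with respect to the real Laplacian. -/

/-- The permittivities `ε_ω`, `ε_{2ω}` of the medium at the two frequencies and the surface
susceptibilities `χ_⊥ = χ_{⊥⊥⊥}`, `χ_∥ = χ_{∥⊥∥}`. -/
structure Medium where
  epsOne : ℂ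
  epsTwo : ℂ
  chiPerp : ℂ
  chiPar : ℂ

/-- A potential that may jump across an interface.  `inside` is its branch in the bounded component
and `outside` its branch in the unbounded one.  A one-sided limit at the interface is the value
of the branch; values of a branch on the other side of the interface only represent an
extension of that branch. -/
structure Potential where
  inside : ℂ → ℂ
  outside : ℂ → ℂ

/-- `w` is piecewise harmonic off the boundary of `D`, and each branch is `C²` up to
the boundary. -/
structure IsPiecewiseHarmonic (D : Set ℂ) (w : Potential) : Prop where
  inside_harmonic : HarmonicOnNhd w.inside D
  inside_regular : ∀ z ∈ closure D, ContDiffAt ℝ 2 w.inside z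
  outside_harmonic : HarmonicOnNhd w.outside (closure D)ᶜ
  outside_regular : ∀ z, z ∉ interior D → ContDiffAt ℝ 2 w.outside z

/-! ### The coupled system for a closed curve `γ`, parametrized counterclockwise -/

/-- Unit tangent vector. -/
def unitTangent (γ : ℝ → ℂ) (t : ℝ) : ℂ := deriv γ t / (‖deriv γ t‖ : ℂ)

/-- Outward unit normal vector. -/
def unitNormal (γ : ℝ → ℂ) (t : ℝ) : ℂ := -Complex.I * unitTangent γ t

/-- Normal derivative of a branch `w` at `γ t`. -/
def dNormal (γ : ℝ → ℂ) (w : ℂ → ℂ) (t : ℝ) : ℂ := fderiv ℝ w (γ t) (unitNormal γ t)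

/-- Tangential derivative of a branch `w` at `γ t`. -/
def dTangent (γ : ℝ → ℂ) (w : ℂ → ℂ) (t : ℝ) : ℂ := fderiv ℝ w (γ t) (unitTangent γ t)

/-- `P_⊥ = χ_⊥ (ε_ω ∂u/∂ν|₋)²`. -/
def polPerp (m : Medium) (γ : ℝ → ℂ) (u : Potential) (t : ℝ) : ℂ :=
  m.chiPerp * (m.epsOne * dNormal γ u.inside t) ^ 2

/-- `P_∥ = 2 χ_∥ (ε_ω ∂u/∂ν|₋) (∂u/∂T|₋)`. -/
def polPar (m : Medium) (γ : ℝ → ℂ) (u : Potential) (t : ℝ) : ℂ :=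
  2 * m.chiPar * (m.epsOne * dNormal γ u.inside t) * dTangent γ u.inside t

/-- `σ = - ∇_∥ · (P_∥ T)`: minus the arclength derivative of `P_∥`. -/
def surfaceCharge (m : Medium) (γ : ℝ → ℂ) (u : Potential) (t : ℝ) : ℂ :=
  -(1 / (‖deriv γ t‖ : ℂ)) * deriv (polPar m γ u) t

/-- The governing equations for the fundamental potential `u` and the second-harmonic potential `v`,
for the domain `D` with boundary curve `γ` and the background potential `H`. -/
structure IsGoverningSolution (m : Medium) (H : ℂ → ℂ) (D : Set ℂ) (γ : ℝ → ℂ)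
    (u v : Potential) : Prop where
  u_harmonic : IsPiecewiseHarmonic D u
  u_jump : ∀ t, u.outside (γ t) = u.inside (γ t)
  u_flux : ∀ t, dNormal γ u.outside t = m.epsOne * dNormal γ u.inside t
  u_infinity : (fun z => u.outside z - H z) =O[cobounded ℂ] fun z => ‖z‖⁻¹
  v_harmonic : IsPiecewiseHarmonic D v
  v_jump : ∀ t, v.outside (γ t) - v.inside (γ t) = 4 * Real.pi * polPerp m γ u t
  v_flux : ∀ t, dNormal γ v.outside t - m.epsTwo * dNormal γ v.inside t
    = -4 * Real.pi * surfaceCharge m γ u t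
  v_infinity : Tendsto v.outside (cobounded ℂ) (𝓝 0)

/-! ### The disk and its perturbation -/

/-- The circle of radius `r₀`. -/
def circleCurve (r₀ : ℝ) (θ : ℝ) : ℂ := r₀ * Complex.exp (θ * Complex.I)

/-- The perturbed circle `x + ε f(x) ν(x)`, `|x| = r₀`, with `f(θ)` as the profile. -/
def perturbedCurve (r₀ : ℝ) (f : ℝ → ℝ) (ε : ℝ) (θ : ℝ) : ℂ :=
  circleCurve r₀ θ + ε * f θ * Complex.exp (θ * Complex.I)

/-- The domain enclosed by the perturbed circle. -/
def perturbedDisk (r₀ : ℝ) (f : ℝ → ℝ) (ε : ℝ) : Set ℂ :=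
  {z | ∃ s θ : ℝ, 0 ≤ s ∧ s < 1 ∧ z = s * perturbedCurve r₀ f ε θ}

/-- The profile `f(θ) = r₀ cos(nθ)`. -/
def cosProfile (r₀ : ℝ) (n : ℕ) (θ : ℝ) : ℝ := r₀ * Real.cos (n * θ)

/-- The uniform background potential `H(x) = -E x₁`. -/
def uniformBackground (E : ℝ) (z : ℂ) : ℂ := -(E : ℂ) * z.re

/-- Second derivative `∂²w/∂ν²` at the point of angle `θ` on the circle. -/
def dNormalNormal (r₀ : ℝ) (w : ℂ → ℂ) (θ : ℝ) : ℂ :=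
  fderiv ℝ (fderiv ℝ w) (circleCurve r₀ θ) (unitNormal (circleCurve r₀) θ)
    (unitNormal (circleCurve r₀) θ)

/-- Mixed derivative `∂/∂ν (∂w/∂T)` at the point of angle `θ` on the circle. -/
def dNormalTangent (r₀ : ℝ) (w : ℂ → ℂ) (θ : ℝ) : ℂ :=
  fderiv ℝ (fderiv ℝ w) (circleCurve r₀ θ) (unitNormal (circleCurve r₀) θ)
    (unitTangent (circleCurve r₀) θ)

/-- Tangential derivative `f' = ∂f/∂T` of a profile on the circle. -/
def profileDeriv (r₀ : ℝ) (f : ℝ → ℝ) (θ : ℝ) : ℝ := deriv f θ / r₀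

/-- The leading-order coupled system on the disk. -/
structure IsLeadingSolution (m : Medium) (H : ℂ → ℂ) (r₀ : ℝ) (u₀ v₀ : Potential) : Prop where
  governing : IsGoverningSolution m H (Metric.ball 0 r₀) (circleCurve r₀) u₀ v₀
  v_decay : v₀.outside =O[cobounded ℂ] fun z => (‖z‖ ^ 2)⁻¹

/-- First-order variation of `∂u/∂ν|₋` on the moving boundary. -/
def normalVariation (r₀ : ℝ) (f : ℝ → ℝ) (u₀ u₁ : Potential) (θ : ℝ) : ℂ :=
  dNormal (circleCurve r₀) u₁.inside θ + f θ * dNormalNormal r₀ u₀.inside θ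
    - profileDeriv r₀ f θ * dTangent (circleCurve r₀) u₀.inside θ

/-- First-order variation of `∂u/∂T|₋` on the moving boundary. -/
def tangentVariation (r₀ : ℝ) (f : ℝ → ℝ) (u₀ u₁ : Potential) (θ : ℝ) : ℂ :=
  dTangent (circleCurve r₀) u₁.inside θ + f θ * dNormalTangent r₀ u₀.inside θ
    + profileDeriv r₀ f θ * dNormal (circleCurve r₀) u₀.inside θ

/-- First-order coefficient of `P_⊥`. -/
def polPerpOne (m : Medium) (r₀ : ℝ) (f : ℝ → ℝ) (u₀ u₁ : Potential) (θ : ℝ) : ℂ :=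
  2 * m.chiPerp * m.epsOne ^ 2 * dNormal (circleCurve r₀) u₀.inside θ
    * normalVariation r₀ f u₀ u₁ θ

/-- First-order coefficient of `P_∥`. -/
def polParOne (m : Medium) (r₀ : ℝ) (f : ℝ → ℝ) (u₀ u₁ : Potential) (θ : ℝ) : ℂ :=
  2 * m.chiPar * m.epsOne * dNormal (circleCurve r₀) u₀.inside θ * tangentVariation r₀ f u₀ u₁ θ
    + 2 * m.chiPar * m.epsOne * dTangent (circleCurve r₀) u₀.inside θ
      * normalVariation r₀ f u₀ u₁ θ

/-- First-order coefficient of `σ`: the length element is `h = r₀ (1 + ε κ f) + O(ε²)` with the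
curvature `κ = 1 / r₀`. -/
def surfaceChargeOne (m : Medium) (r₀ : ℝ) (f : ℝ → ℝ) (u₀ u₁ : Potential) (θ : ℝ) : ℂ :=
  (1 / r₀ : ℂ) * f θ / r₀ * deriv (polPar m (circleCurve r₀) u₀) θ
    - (1 / r₀ : ℂ) * deriv (polParOne m r₀ f u₀ u₁) θ

/-- Right-hand side of the first-order jump condition on the value coming from the displacement
of the boundary: `f (∂w₀/∂ν|₋ - ∂w₀/∂ν|₊)`. -/
def jumpShift (r₀ : ℝ) (f : ℝ → ℝ) (w₀ : Potential) (θ : ℝ) : ℂ :=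
  f θ * (dNormal (circleCurve r₀) w₀.inside θ - dNormal (circleCurve r₀) w₀.outside θ)

/-- Right-hand side of the first-order flux condition coming from the displacement of the boundary:
`f (e ∂²w₀/∂ν²|₋ - ∂²w₀/∂ν²|₊) + f' (∂w₀/∂T|₊ - e ∂w₀/∂T|₋)`. -/
def fluxShift (e : ℂ) (r₀ : ℝ) (f : ℝ → ℝ) (w₀ : Potential) (θ : ℝ) : ℂ :=
  f θ * (e * dNormalNormal r₀ w₀.inside θ - dNormalNormal r₀ w₀.outside θ)
    + profileDeriv r₀ f θ * (dTangent (circleCurve r₀) w₀.outside θ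
      - e * dTangent (circleCurve r₀) w₀.inside θ)

/-- The first-order coupled system on the disk for `(u₁, v₁)`, given the leading-order
fields `(u₀, v₀)`. -/
structure IsFirstOrderSolution (m : Medium) (r₀ : ℝ) (f : ℝ → ℝ)
    (u₀ v₀ u₁ v₁ : Potential) : Prop where
  u_harmonic : IsPiecewiseHarmonic (Metric.ball 0 r₀) u₁
  u_jump : ∀ θ, u₁.outside (circleCurve r₀ θ) - u₁.inside (circleCurve r₀ θ)
    = jumpShift r₀ f u₀ θ
  u_flux : ∀ θ, dNormal (circleCurve r₀) u₁.outside θ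
    - m.epsOne * dNormal (circleCurve r₀) u₁.inside θ = fluxShift m.epsOne r₀ f u₀ θ
  u_infinity : u₁.outside =O[cobounded ℂ] fun z => ‖z‖⁻¹
  v_harmonic : IsPiecewiseHarmonic (Metric.ball 0 r₀) v₁
  v_jump : ∀ θ, v₁.outside (circleCurve r₀ θ) - v₁.inside (circleCurve r₀ θ)
    = jumpShift r₀ f v₀ θ + 4 * Real.pi * polPerpOne m r₀ f u₀ u₁ θ
  v_flux : ∀ θ, dNormal (circleCurve r₀) v₁.outside θ
    - m.epsTwo * dNormal (circleCurve r₀) v₁.inside θ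
      = fluxShift m.epsTwo r₀ f v₀ θ - 4 * Real.pi * surfaceChargeOne m r₀ f u₀ u₁ θ
  v_infinity : Tendsto v₁.outside (cobounded ℂ) (𝓝 0)

/-! ### Field expansions in `ε` -/

/-- The branches of `w` are harmonic across the circle, up to a distance `δ`. -/
def HarmonicAcross (r₀ δ : ℝ) (w : Potential) : Prop :=
  HarmonicOnNhd w.inside (Metric.ball 0 (r₀ + δ)) ∧ HarmonicOnNhd w.outside {z | r₀ - δ < ‖z‖}

/-- `w^ε = w₀ + ε w₁ + O(ε²)` as `ε → 0⁺`, for each of the two branches, continued harmonically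
across the circle to a fixed neighbourhood of it and uniformly there. -/
def HasFieldExpansion (r₀ : ℝ) (w : ℝ → Potential) (w₀ w₁ : Potential) : Prop :=
  ∃ δ ε₀ C : ℝ, 0 < δ ∧ δ < r₀ ∧ 0 < ε₀ ∧
    HarmonicAcross r₀ δ w₀ ∧ HarmonicAcross r₀ δ w₁ ∧
    ∀ ε ∈ Ioo 0 ε₀, HarmonicAcross r₀ δ (w ε) ∧
      (∀ z : ℂ, ‖z‖ < r₀ + δ →
        ‖(w ε).inside z - (w₀.inside z + ε * w₁.inside z)‖ ≤ C * ε ^ 2) ∧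
      (∀ z : ℂ, r₀ - δ < ‖z‖ → ‖z‖ < r₀ + δ →
        ‖(w ε).outside z - (w₀.outside z + ε * w₁.outside z)‖ ≤ C * ε ^ 2)

/-- The solutions `(u^ε, v^ε)` of the governing equations on the perturbed disks admit field
expansions with leading-order coefficients `(u₀, v₀)` and first-order
coefficients `(u₁, v₁)`. -/
structure IsFirstOrderExpansion (m : Medium) (H : ℂ → ℂ) (r₀ : ℝ) (f : ℝ → ℝ)
    (u v : ℝ → Potential) (u₀ v₀ u₁ v₁ : Potential) : Prop where
  governing : ∀ᶠ ε in 𝓝[>] (0 : ℝ), IsGoverningSolution m H (perturbedDisk r₀ f ε)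
    (perturbedCurve r₀ f ε) (u ε) (v ε)
  u_expansion : HasFieldExpansion r₀ u u₀ u₁
  v_expansion : HasFieldExpansion r₀ v v₀ v₁
  u_zero_infinity : (fun z => u₀.outside z - H z) =O[cobounded ℂ] fun z => ‖z‖⁻¹
  u_one_infinity : u₁.outside =O[cobounded ℂ] fun z => ‖z‖⁻¹
  v_zero_infinity : Tendsto v₀.outside (cobounded ℂ) (𝓝 0)
  v_one_infinity : Tendsto v₁.outside (cobounded ℂ) (𝓝 0)

/-! ### Multipole radiation and symmetry -/

/-- A field that is harmonic outside some circle is `2^k`-multipole radiation if it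
is `O(|x|^{-k})`. -/
def IsMultipoleRadiation (k : ℕ) (w : ℂ → ℂ) : Prop :=
  (∃ R : ℝ, HarmonicOnNhd w {z | R < ‖z‖}) ∧ w =O[cobounded ℂ] fun z => (‖z‖ ^ k)⁻¹

/-- Dipole radiation: `k = 1`. -/
def IsDipoleRadiation (w : ℂ → ℂ) : Prop := IsMultipoleRadiation 1 w

/-- Invariance under `x ↦ -x`. -/
def HasInversionSymmetry (Γ : Set ℂ) : Prop := ∀ z ∈ Γ, -z ∈ Γ

/-- The number of rotations about the origin and reflections across lines through the origin that map
`Γ` onto itself. -/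
def symmetryDegree (Γ : Set ℂ) : ℕ∞ := {g : ℂ ≃ₗᵢ[ℝ] ℂ | g '' Γ = Γ}.encard

/-- The boundary curve `r = r₀ (1 + ε cos nθ)` as a set. -/
def cosBoundary (r₀ : ℝ) (n : ℕ) (ε : ℝ) : Set ℂ := range (perturbedCurve r₀ (cosProfile r₀ n) ε)

/-! ### The coefficients -/

/-- The coefficient `M_{n-2}`. -/
def coeffLow (m : Medium) (E r₀ : ℝ) (n : ℕ) : ℂ :=
  8 * Real.pi * E ^ 2 / ((1 + m.epsTwo) * (1 + m.epsOne) ^ 2)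
    * ((m.epsTwo - 3) / (1 + m.epsTwo) * m.chiPerp * m.epsOne ^ 2 * m.epsTwo
      + ((n - 2) * m.epsOne - (3 * n - 2)) / (1 + m.epsOne) * m.chiPerp * m.epsOne ^ 2 * m.epsTwo
      + 2 * (((n - 1) + (n + 3) * m.epsTwo) / (1 + m.epsTwo)) * m.chiPar * m.epsOne)
    * r₀ ^ (n - 2)

/-- The coefficient `M_n`. -/
def coeffMid (m : Medium) (E r₀ : ℝ) (n : ℕ) : ℂ :=
  16 * Real.pi * E ^ 2 / ((1 + m.epsTwo) * (1 + m.epsOne) ^ 2)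
    * ((m.epsOne - 1) / (1 + m.epsOne) * (n - 1)
      * (m.chiPerp * m.epsOne ^ 2 * m.epsTwo + 2 * m.chiPar * m.epsOne))
    * r₀ ^ n

/-- The coefficient `M_{n+2}`. -/
def coeffHigh (m : Medium) (E r₀ : ℝ) (n : ℕ) : ℂ :=
  8 * Real.pi * E ^ 2 / ((1 + m.epsTwo) * (1 + m.epsOne) ^ 2) * (n + 1)
    * (m.chiPerp * m.epsOne ^ 2 * m.epsTwo + 2 * m.chiPar * m.epsOne)
    * r₀ ^ (n + 2)

end

/-!
The background has the single angular mode `cos θ`, so the leading second-harmonic sources have the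
modes `0` and `2`, and multiplication by the profile `cos nθ` turns the first-order sources into
combinations of `cos (n - 2)θ`, `cos nθ` and `cos (n + 2)θ`.  Both systems on the disk are
therefore solved by finite sums of `Re zᵏ` and `Re z⁻ᵏ`, and the coefficients `M_{n-2}`, `M_n`,
`M_{n+2}` come out of a linear system of two equations for each mode
(`isLeadingSolution_leading`, `isFirstOrderSolution_first`, `firstTwo_outerAmp`).

*Uniqueness* (`transmission_unique`).  Let `w` satisfy the homogeneous transmission conditions
`w₊ = w₋`, `∂_ν w₊ = e ∂_ν w₋` on the circle with `e ≠ -1`.  The permittivity is complex, so no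
energy argument is available; instead the exterior branch is compared with the Kelvin reflection of
the interior one.  Reflection keeps boundary values and reverses the sign of the normal
derivative, so the maximum principle identifies `w₊` with the reflected `w₋`, and the flux condition
becomes `(1 + e) ∂_ν w₋ = 0`.  The harmonic function `x · ∇w₋` therefore vanishes on the circle and
in the disk, `w₋` is constant, and the decay of its reflection at infinity makes the constant zero.
Hence any solution agrees with the explicit one (`eq_leadingOne`, `eq_leadingTwo`, `eq_firstTwo`),
and the radiation order of the first-order field can be read off from its multipoles
(`isBigO_succ_iff_coeff_eq_zero`).

*Expansions* (`IsFirstOrderExpansion.coefficients`).  The gradient estimate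
`norm_fderiv_le_of_harmonic` turns the bound `O(ε²)` on the remainder of a field into the same
bound for its derivatives on a smaller annulus.  All quantities in the governing equations on the
perturbed circle then have expansions `a + ε b + O(ε²)` that are uniform in the angle
(`HasUniformExpansion`), these can be multiplied, and their coefficients are unique.  The surface
charge contains a further tangential derivative; it is treated by reading the flux condition as a
formula for the `θ`-derivative of `P_∥`, which has a uniform expansion as well, so that the one of
`P_∥` can be differentiated term by term (`HasUniformExpansion.hasDerivAt`).

*Symmetry* (`symmetryDegree_cosBoundary`).  Every linear isometry of the plane is a rotation, or the
conjugation followed by a rotation.  The radius of the curve is largest exactly in the directions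
`a` with `aⁿ = 1`, so in both cases exactly the rotations by `n`-th roots of unity preserve it.
-/

/-! ### Harmonic functions in the plane -/

theorem InnerProductSpace.HarmonicAt.exists_analyticAt_re_eq {h : ℂ → ℝ} {x : ℂ}
    (hh : HarmonicAt h x) :
    ∃ F : ℂ → ℂ, AnalyticAt ℂ F x ∧ ∀ᶠ y in 𝓝 x, (F y).re = h y := by
  obtain ⟨ρ, hρ, hball⟩ := Metric.eventually_nhds_iff_ball.1 hh.eventually
  obtain ⟨F, hF, hFh⟩ := HarmonicOnNhd.exists_analyticOnNhd_ball_re_eq (f := h) (z := x) (R := ρ)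
    (fun y hy => hball y hy)
  exact ⟨F, hF x (Metric.mem_ball_self hρ),
    Filter.eventually_of_mem (Metric.ball_mem_nhds x hρ) fun y hy => hFh hy⟩

/-- A complex-valued function is harmonic as soon as its real and imaginary parts are. -/
theorem harmonicAt_of_re_im {w : ℂ → ℂ} {x : ℂ} (hr : HarmonicAt (fun z => (w z).re) x)
    (hi : HarmonicAt (fun z => (w z).im) x) : HarmonicAt w x := by
  have h1 := hr.comp_CLM (G := ℂ) Complex.ofRealCLM
  have h2 := hi.comp_CLM (G := ℂ)
    ((ContinuousLinearMap.mul ℝ ℂ Complex.I).comp Complex.ofRealCLM)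
  convert! h1.add h2 using 1
  funext z
  simp [mul_comm Complex.I, Complex.re_add_im]

theorem InnerProductSpace.HarmonicAt.re {w : ℂ → ℂ} {x : ℂ} (h : HarmonicAt w x) :
    HarmonicAt (fun z => (w z).re) x := h.comp_CLM Complex.reCLM

theorem InnerProductSpace.HarmonicAt.im {w : ℂ → ℂ} {x : ℂ} (h : HarmonicAt w x) :
    HarmonicAt (fun z => (w z).im) x := h.comp_CLM Complex.imCLM

theorem InnerProductSpace.HarmonicAt.const_mul {w : ℂ → ℂ} {x : ℂ} (c : ℂ) (h : HarmonicAt w x) :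
    HarmonicAt (fun z => c * w z) x := h.comp_CLM (ContinuousLinearMap.mul ℝ ℂ c)

/-- Planar harmonic functions are smooth: locally they are real parts of holomorphic functions. -/
theorem InnerProductSpace.HarmonicAt.contDiffAt_three {w : ℂ → ℂ} {x : ℂ} (h : HarmonicAt w x) :
    ContDiffAt ℝ 3 w x := by
  have h1 : ContDiffAt ℝ 3 (fun z => (w z).re) x := (HarmonicAt.analyticAt h.re).contDiffAt
  have h2 : ContDiffAt ℝ 3 (fun z => (w z).im) x := (HarmonicAt.analyticAt h.im).contDiffAt
  have h3 := (Complex.ofRealCLM.contDiff.contDiffAt.comp x h1).add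
    (((Complex.ofRealCLM.contDiff.contDiffAt.comp x h2)).mul
      (contDiffAt_const (c := Complex.I)))
  convert! h3 using 1
  funext z
  simp [Complex.re_add_im]

theorem InnerProductSpace.HarmonicAt.comp_analyticAt {h : ℂ → ℝ} {g : ℂ → ℂ} {x : ℂ}
    (hh : HarmonicAt h (g x)) (hg : AnalyticAt ℂ g x) : HarmonicAt (fun z => h (g z)) x := by
  obtain ⟨F, hF, hFh⟩ := hh.exists_analyticAt_re_eq
  refine (harmonicAt_congr_nhds ?_).1 (AnalyticAt.harmonicAt_re (f := fun z => F (g z)) (hF.comp hg))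
  exact hg.continuousAt.eventually hFh

theorem InnerProductSpace.HarmonicAt.comp_conj {h : ℂ → ℝ} {x : ℂ}
    (hh : HarmonicAt h (starRingEnd ℂ x)) :
    HarmonicAt (fun z => h (starRingEnd ℂ z)) x := by
  obtain ⟨F, hF, hFh⟩ := hh.exists_analyticAt_re_eq
  have hG : AnalyticAt ℂ (starRingEnd ℂ ∘ F ∘ starRingEnd ℂ) x := by
    rw [Complex.analyticAt_iff_eventually_differentiableAt] at hF ⊢
    filter_upwards [Complex.continuous_conj.continuousAt.eventually hF] with z hz
    simpa using DifferentiableAt.conj_conj hz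
  refine (harmonicAt_congr_nhds ?_).1 (AnalyticAt.harmonicAt_re hG)
  filter_upwards [Complex.continuous_conj.continuousAt.eventually hFh] with z hz
  simpa using hz

/-- The Euler derivative `x · ∇h` of a harmonic function is harmonic. -/
theorem InnerProductSpace.HarmonicAt.euler {w : ℂ → ℂ} {x : ℂ} (hw : HarmonicAt w x) :
    HarmonicAt (fun z => fderiv ℝ w z z) x := by
  have key : ∀ h : ℂ → ℝ, HarmonicAt h x → HarmonicAt (fun z => fderiv ℝ h z z) x := by
    intro h hh
    obtain ⟨F, hF, hFh⟩ := hh.exists_analyticAt_re_eq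
    refine (harmonicAt_congr_nhds ?_).1
      (AnalyticAt.harmonicAt_re (f := fun z => deriv F z * z) (hF.deriv.mul analyticAt_id))
    filter_upwards [hFh.eventually_nhds, hF.eventually_analyticAt] with z hz hFz
    have h1 : HasFDerivAt (fun y => (F y).re) _ z :=
      Complex.reCLM.hasFDerivAt.comp z (hFz.differentiableAt.hasDerivAt.hasFDerivAt.restrictScalars ℝ)
    have h2 : fderiv ℝ h z = fderiv ℝ (fun y => (F y).re) z := (Filter.EventuallyEq.fderiv_eq
      (show (fun y => (F y).re) =ᶠ[𝓝 z] h from hz)).symm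
    rw [h2, h1.fderiv]
    simp [mul_comm]
  have hd : ∀ᶠ z in 𝓝 x, DifferentiableAt ℝ w z := by
    filter_upwards [hw.eventually] with z hz using hz.1.differentiableAt (by norm_num)
  refine harmonicAt_of_re_im ?_ ?_
  · refine (harmonicAt_congr_nhds ?_).1 (key _ (HarmonicAt.re hw))
    filter_upwards [hd] with z hz
    have h1 : HasFDerivAt (fun y => (w y).re) _ z := Complex.reCLM.hasFDerivAt.comp z hz.hasFDerivAt
    rw [h1.fderiv]; simp
  · refine (harmonicAt_congr_nhds ?_).1 (key _ (HarmonicAt.im hw))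
    filter_upwards [hd] with z hz
    have h1 : HasFDerivAt (fun y => (w y).im) _ z := Complex.imCLM.hasFDerivAt.comp z hz.hasFDerivAt
    rw [h1.fderiv]; simp

/-- Gradient estimate on the disk of radius `ρ`.  If `|h| ≤ M` and `h = Re F`, then `e^{F/M}` has
modulus between `e⁻¹` and `e`, so Cauchy's estimate for it, on half the disk, bounds `F' / M`. -/
theorem norm_fderiv_le_of_harmonic_real {h : ℂ → ℝ} {x : ℂ} {ρ M : ℝ} (hρ : 0 < ρ) (hM : 0 < M)
    (hh : HarmonicOnNhd h (Metric.ball x ρ)) (hb : ∀ z ∈ Metric.ball x ρ, |h z| ≤ M) :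
    ‖fderiv ℝ h x‖ ≤ 2 * Real.exp 2 * M / ρ := by
  obtain ⟨F, hF, hFh⟩ := HarmonicOnNhd.exists_analyticOnNhd_ball_re_eq hh
  have hx := Metric.mem_ball_self (x := x) hρ
  have hMc : (M : ℂ) ≠ 0 := by exact_mod_cast hM.ne'
  have hsub : Metric.closedBall x (ρ / 2) ⊆ Metric.ball x ρ :=
    Metric.closedBall_subset_ball (by linarith)
  have hd : DiffContOnCl ℂ (fun z => Complex.exp (F z / M)) (Metric.ball x (ρ / 2)) := by
    apply DifferentiableOn.diffContOnCl
    rw [closure_ball x (by positivity)]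
    intro z hz
    exact ((hF z (hsub hz)).differentiableAt.div_const _).cexp.differentiableWithinAt
  have hC : ∀ z ∈ Metric.sphere x (ρ / 2), ‖Complex.exp (F z / M)‖ ≤ Real.exp 1 := by
    intro z hz
    have hz' := hsub (Metric.sphere_subset_closedBall hz)
    rw [Complex.norm_exp, Complex.div_ofReal_re]
    have h1 : (F z).re = h z := hFh hz'
    rw [h1]
    apply Real.exp_le_exp.2
    rw [div_le_one hM]
    exact (le_abs_self _).trans (hb z hz')
  have hcauchy := Complex.norm_deriv_le_of_forall_mem_sphere_norm_le (by positivity) hd hC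
  have hFx := (hF x hx).differentiableAt.hasDerivAt
  have hder : deriv (fun z => Complex.exp (F z / M)) x = Complex.exp (F x / M) * (deriv F x / M) :=
    (hFx.div_const (M : ℂ)).cexp.deriv
  have hlow : Real.exp (-1) ≤ ‖Complex.exp (F x / M)‖ := by
    have h1 : (F x).re = h x := hFh hx
    rw [Complex.norm_exp, Complex.div_ofReal_re, h1]
    apply Real.exp_le_exp.2
    rw [le_div_iff₀ hM]
    have := (abs_le.1 (hb x hx)).1
    linarith
  have hdF : ‖deriv F x‖ ≤ 2 * Real.exp 2 * M / ρ := by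
    rw [hder, norm_mul, norm_div, Complex.norm_real, Real.norm_of_nonneg hM.le] at hcauchy
    have h2 : Real.exp (-1) * (‖deriv F x‖ / M) ≤ Real.exp 1 / (ρ / 2) :=
      (mul_le_mul_of_nonneg_right hlow (by positivity)).trans hcauchy
    have h3 : Real.exp 1 * (Real.exp (-1) * (‖deriv F x‖ / M))
        ≤ Real.exp 1 * (Real.exp 1 / (ρ / 2)) :=
      mul_le_mul_of_nonneg_left h2 (Real.exp_pos _).le
    have h4 : Real.exp 1 * Real.exp (-1) = 1 := by rw [← Real.exp_add]; norm_num
    have h5 : Real.exp 1 * Real.exp 1 = Real.exp 2 := by rw [← Real.exp_add]; norm_num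
    rw [← mul_assoc, h4, one_mul, ← mul_div_assoc, h5, div_le_iff₀ hM] at h3
    calc _ ≤ _ := h3
      _ = _ := by field_simp
  have h1 : HasFDerivAt (fun y => (F y).re) _ x :=
    Complex.reCLM.hasFDerivAt.comp x (hFx.hasFDerivAt.restrictScalars ℝ)
  have h2 : fderiv ℝ h x = fderiv ℝ (fun y => (F y).re) x := (Filter.EventuallyEq.fderiv_eq
      (Filter.eventually_of_mem (Metric.ball_mem_nhds x hρ) fun y hy => hFh hy)).symm
  rw [h2, h1.fderiv]
  refine ContinuousLinearMap.opNorm_le_bound _ (by positivity) fun v => ?_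
  have h3 : |(v * deriv F x).re| ≤ ‖deriv F x‖ * ‖v‖ := by
    rw [mul_comm ‖deriv F x‖, ← norm_mul]; exact Complex.abs_re_le_norm _
  simpa using h3.trans (mul_le_mul_of_nonneg_right hdF (norm_nonneg v))

/-- Gradient estimate for complex-valued harmonic functions, from that for the real and
imaginary parts. -/
theorem norm_fderiv_le_of_harmonic {w : ℂ → ℂ} {x : ℂ} {ρ M : ℝ} (hρ : 0 < ρ) (hM : 0 < M)
    (hw : HarmonicOnNhd w (Metric.ball x ρ)) (hb : ∀ z ∈ Metric.ball x ρ, ‖w z‖ ≤ M) :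
    ‖fderiv ℝ w x‖ ≤ 4 * Real.exp 2 * M / ρ := by
  have hd : DifferentiableAt ℝ w x :=
    (hw x (Metric.mem_ball_self hρ)).1.differentiableAt (by norm_num)
  have hre := norm_fderiv_le_of_harmonic_real hρ hM (fun z hz => HarmonicAt.re (hw z hz))
    fun z hz => (Complex.abs_re_le_norm _).trans (hb z hz)
  have him := norm_fderiv_le_of_harmonic_real hρ hM (fun z hz => HarmonicAt.im (hw z hz))
    fun z hz => (Complex.abs_im_le_norm _).trans (hb z hz)
  have h1 : HasFDerivAt (fun y => (w y).re) _ x := Complex.reCLM.hasFDerivAt.comp x hd.hasFDerivAt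
  have h2 : HasFDerivAt (fun y => (w y).im) _ x := Complex.imCLM.hasFDerivAt.comp x hd.hasFDerivAt
  rw [h1.fderiv] at hre
  rw [h2.fderiv] at him
  refine ContinuousLinearMap.opNorm_le_bound _ (by positivity) fun v => ?_
  refine (Complex.norm_le_abs_re_add_abs_im _).trans ?_
  have h3 := ContinuousLinearMap.le_of_opNorm_le _ hre v
  have h4 := ContinuousLinearMap.le_of_opNorm_le _ him v
  simp only [ContinuousLinearMap.comp_apply, Complex.reCLM_apply, Complex.imCLM_apply,
    Real.norm_eq_abs] at h3 h4
  calc _ ≤ _ := add_le_add h3 h4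
    _ = _ := by ring

/-- Maximum principle.  Among the points where a positive maximum is attained, the one with the
largest real part has a neighbourhood in which the maximum modulus principle for `e^F`, `h = Re F`,
makes `h` constant; this neighbourhood has points further to the right. -/
theorem harmonic_nonpos_of_frontier_nonpos {U : Set ℂ} (hU : IsOpen U) (hbU : IsBounded U)
    {h : ℂ → ℝ} (hc : ContinuousOn h (closure U)) (hh : HarmonicOnNhd h U)
    (hf : ∀ z ∈ frontier U, h z ≤ 0) : ∀ z ∈ closure U, h z ≤ 0 := by
  intro z₀ hz₀
  by_contra! hpos
  have hK : IsCompact (closure U) := hbU.isCompact_closure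
  obtain ⟨zm, hzm, hmax⟩ := hK.exists_isMaxOn ⟨z₀, hz₀⟩ hc
  have hmpos : 0 < h zm := hpos.trans_le (hmax hz₀)
  have hS : IsCompact (closure U ∩ h ⁻¹' {h zm}) :=
    hK.of_isClosed_subset (hc.preimage_isClosed_of_isClosed isClosed_closure isClosed_singleton)
      inter_subset_left
  obtain ⟨z₁, hz₁, hre⟩ := hS.exists_isMaxOn ⟨zm, hzm, rfl⟩ Complex.continuous_re.continuousOn
  have hz₁m : h z₁ = h zm := hz₁.2
  have hz₁U : z₁ ∈ U := by
    by_contra hn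
    have : z₁ ∈ frontier U := by rw [hU.frontier_eq]; exact ⟨hz₁.1, hn⟩
    linarith [hf z₁ this]
  obtain ⟨F, hF, hFh⟩ := (hh z₁ hz₁U).exists_analyticAt_re_eq
  have hloc : IsLocalMax (norm ∘ fun z => Complex.exp (F z)) z₁ := by
    filter_upwards [hFh, hU.mem_nhds hz₁U] with y hy hyU
    simp only [Function.comp_apply, Complex.norm_exp, hy, hFh.self_of_nhds, hz₁m]
    exact Real.exp_le_exp.2 (hmax (subset_closure hyU))
  have hconst := Complex.norm_eventually_eq_of_isLocalMax
    (hF.eventually_analyticAt.mono fun z hz => hz.differentiableAt.cexp) hloc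
  have hev : ∀ᶠ y in 𝓝 z₁, y ∈ U ∧ h y = h zm := by
    filter_upwards [hconst, hFh, hU.mem_nhds hz₁U] with y h1 h2 h3
    refine ⟨h3, ?_⟩
    rw [Complex.norm_exp, Complex.norm_exp, Real.exp_eq_exp, h2, hFh.self_of_nhds, hz₁m] at h1
    exact h1
  have ht : Tendsto (fun t : ℝ => z₁ + (t : ℂ)) (𝓝[>] 0) (𝓝 z₁) := by
    have : Continuous fun t : ℝ => z₁ + (t : ℂ) := by fun_prop
    simpa using (this.tendsto 0).mono_left nhdsWithin_le_nhds
  obtain ⟨t, ht1, ht2⟩ := ((ht.eventually hev).and self_mem_nhdsWithin).exists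
  have h5 : (z₁ + (t : ℂ)).re ≤ z₁.re := hre ⟨subset_closure ht1.1, ht1.2⟩
  simp at h5
  exact absurd ht2 (by simpa using h5)

/-- Uniqueness for the Dirichlet problem on a disk. -/
theorem harmonic_eq_zero_of_sphere {w : ℂ → ℂ} {R : ℝ} (hR : 0 < R)
    (hw : HarmonicOnNhd w (Metric.ball 0 R)) (hc : ContinuousOn w (Metric.closedBall 0 R))
    (h0 : ∀ z, ‖z‖ = R → w z = 0) : ∀ z, ‖z‖ ≤ R → w z = 0 := by
  have key : ∀ L : ℂ →L[ℝ] ℝ, ∀ z, ‖z‖ ≤ R → L (w z) ≤ 0 := by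
    intro L z hz
    have hcl : closure (Metric.ball (0 : ℂ) R) = Metric.closedBall 0 R := closure_ball 0 hR.ne'
    refine harmonic_nonpos_of_frontier_nonpos (U := Metric.ball 0 R) (h := L ∘ w) Metric.isOpen_ball
      Metric.isBounded_ball ?_ (hw.comp_CLM L) ?_ z ?_
    · rw [hcl]; exact L.continuous.comp_continuousOn hc
    · intro y hy
      rw [frontier_ball _ hR.ne', mem_sphere_zero_iff_norm] at hy
      simp [h0 y hy]
    · rw [hcl]; simpa using hz
  intro z hz
  apply Complex.ext
  · exact le_antisymm (key Complex.reCLM z hz) (by simpa using key (-Complex.reCLM) z hz)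
  · exact le_antisymm (key Complex.imCLM z hz) (by simpa using key (-Complex.imCLM) z hz)

/-- Uniqueness for the exterior Dirichlet problem among functions bounded at infinity, by
comparison with the multiples of `log (|z| / R)`. -/
theorem harmonic_eq_zero_of_sphere_exterior {w : ℂ → ℂ} {R M : ℝ} (hR : 0 < R)
    (hw : HarmonicOnNhd w {z | R < ‖z‖}) (hc : ContinuousOn w {z | R ≤ ‖z‖})
    (h0 : ∀ z, ‖z‖ = R → w z = 0) (hb : ∀ᶠ z in cobounded ℂ, ‖w z‖ ≤ M) :
    ∀ z, R ≤ ‖z‖ → w z = 0 := by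
  have hM : ∃ ρ : ℝ, ∀ z : ℂ, ρ ≤ ‖z‖ → ‖w z‖ ≤ M := by
    rw [← comap_norm_atTop, eventually_comap] at hb
    obtain ⟨ρ, hρ⟩ := eventually_atTop.1 hb
    exact ⟨ρ, fun z hz => hρ _ hz z rfl⟩
  obtain ⟨ρ, hρ⟩ := hM
  have key : ∀ L : ℂ →L[ℝ] ℝ, ‖L‖ ≤ 1 → ∀ η : ℝ, 0 < η → ∀ z, R ≤ ‖z‖ →
      L (w z) - η * Real.log (‖z‖ / R) ≤ 0 := by
    intro L hL η hη z hz
    -- on the outer circle `|z| = S` the logarithm dominates the bound on `w`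
    obtain ⟨S, hS1, hS2⟩ : ∃ S : ℝ, (‖z‖ < S ∧ R < S ∧ ρ ≤ S) ∧ M ≤ η * Real.log (S / R) := by
      have ht : Tendsto (fun S : ℝ => η * Real.log (S / R)) atTop atTop :=
        (Real.tendsto_log_atTop.comp (tendsto_id.atTop_div_const hR)).const_mul_atTop hη
      exact (((eventually_gt_atTop ‖z‖).and ((eventually_gt_atTop R).and
        (eventually_ge_atTop ρ))).and (ht.eventually_ge_atTop M)).exists
    set U : Set ℂ := {y | R < ‖y‖ ∧ ‖y‖ < S} with hUdef
    have hUo : IsOpen U :=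
      (isOpen_lt continuous_const continuous_norm).inter (isOpen_lt continuous_norm continuous_const)
    have hcl' : IsClosed {y : ℂ | R ≤ ‖y‖ ∧ ‖y‖ ≤ S} :=
      (isClosed_le continuous_const continuous_norm).inter
        (isClosed_le continuous_norm continuous_const)
    have hcl : closure U ⊆ {y | R ≤ ‖y‖ ∧ ‖y‖ ≤ S} :=
      closure_minimal (fun y hy => ⟨hy.1.le, hy.2.le⟩) hcl'
    have hbd : IsBounded U :=
      (Metric.isBounded_ball (x := (0 : ℂ)) (r := S)).subset fun y hy => by simpa using hy.2
    have hne : ∀ y : ℂ, R ≤ ‖y‖ → ‖y‖ ≠ 0 := fun y hy => (hR.trans_le hy).ne'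
    -- points of the circle `|z| = R` need no argument
    rcases hz.eq_or_lt with hzR | hzR
    · rw [← hzR, h0 z hzR.symm, div_self hR.ne']; simp
    refine harmonic_nonpos_of_frontier_nonpos (U := U)
      (h := fun y => L (w y) - η * Real.log (‖y‖ / R)) hUo hbd ?_ ?_ ?_ z
      (subset_closure ⟨hzR, hS1.1⟩)
    · refine (L.continuous.comp_continuousOn (hc.mono fun y hy => (hcl hy).1)).sub
        (continuousOn_const.mul (ContinuousOn.log ?_ ?_))
      · fun_prop
      · intro y hy
        exact div_ne_zero (hne y (hcl hy).1) hR.ne'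
    · intro y hy
      have hyne : y / R ≠ 0 := div_ne_zero (norm_ne_zero_iff.1 (hne y hy.1.le))
        (by exact_mod_cast hR.ne')
      have hlog : HarmonicAt (fun y : ℂ => Real.log ‖y / (R : ℂ)‖) y :=
        AnalyticAt.harmonicAt_log_norm (f := fun y : ℂ => y / R) (analyticAt_id.div_const) hyne
      have := ((hw y hy.1).comp_CLM L).sub (hlog.const_smul (c := η))
      convert! this using 1
      funext u
      simp [abs_of_pos hR]
    · intro y hy
      have hy1 := hcl (frontier_subset_closure hy)
      have hy2 : y ∉ U := by rw [hUo.frontier_eq] at hy; exact hy.2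
      rcases hy1.1.eq_or_lt with h1 | h1
      · rw [← h1, h0 y h1.symm, div_self hR.ne']; simp
      · have h2 : ‖y‖ = S := le_antisymm hy1.2 (not_lt.1 fun h => hy2 ⟨h1, h⟩)
        have h3 : L (w y) ≤ M := calc
          L (w y) ≤ ‖L (w y)‖ := le_abs_self _
          _ ≤ ‖L‖ * ‖w y‖ := L.le_opNorm _
          _ ≤ 1 * ‖w y‖ := by gcongr
          _ ≤ M := by rw [one_mul]; exact hρ y (by rw [h2]; exact hS1.2.2)
        rw [h2]; linarith
  have key2 : ∀ L : ℂ →L[ℝ] ℝ, ‖L‖ ≤ 1 → ∀ z, R ≤ ‖z‖ → L (w z) ≤ 0 := by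
    intro L hL z hz
    have ht : Tendsto (fun η : ℝ => L (w z) - η * Real.log (‖z‖ / R)) (𝓝[>] 0) (𝓝 (L (w z))) := by
      have : Continuous fun η : ℝ => L (w z) - η * Real.log (‖z‖ / R) := by fun_prop
      simpa using (this.tendsto 0).mono_left nhdsWithin_le_nhds
    exact le_of_tendsto ht (eventually_mem_nhdsWithin.mono fun η hη => key L hL η hη z hz)
  intro z hz
  have n1 : ‖Complex.reCLM‖ ≤ 1 := Complex.reCLM_norm.le
  have n2 : ‖Complex.imCLM‖ ≤ 1 := Complex.imCLM_norm.le
  apply Complex.ext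
  · exact le_antisymm (key2 Complex.reCLM n1 z hz)
      (by simpa using key2 (-Complex.reCLM) (by rwa [norm_neg]) z hz)
  · exact le_antisymm (key2 Complex.imCLM n2 z hz)
      (by simpa using key2 (-Complex.imCLM) (by rwa [norm_neg]) z hz)

/-! ### The circle and its frame -/

theorem norm_exp_mul_I (θ : ℝ) : ‖Complex.exp (θ * Complex.I)‖ = 1 :=
  Complex.norm_exp_ofReal_mul_I θ

theorem norm_circleCurve {r₀ : ℝ} (hr₀ : 0 < r₀) (θ : ℝ) : ‖circleCurve r₀ θ‖ = r₀ := by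
  simp [circleCurve, Complex.norm_exp_ofReal_mul_I, abs_of_pos hr₀]

theorem exists_circleCurve_eq {r₀ : ℝ} {z : ℂ} (hz : ‖z‖ = r₀) : ∃ θ, circleCurve r₀ θ = z :=
  ⟨z.arg, by rw [circleCurve, ← hz]; exact Complex.norm_mul_exp_arg_mul_I z⟩

theorem hasDerivAt_exp_mul_I (θ : ℝ) :
    HasDerivAt (fun t : ℝ => Complex.exp (t * Complex.I))
      (Complex.I * Complex.exp (θ * Complex.I)) θ := by
  have h := ((Complex.ofRealCLM.hasDerivAt (x := θ)).mul_const Complex.I).cexp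
  simpa [mul_comm] using h

theorem unitTangent_circleCurve {r₀ : ℝ} (hr₀ : 0 < r₀) (θ : ℝ) :
    unitTangent (circleCurve r₀) θ = Complex.I * Complex.exp (θ * Complex.I) := by
  have hd : deriv (circleCurve r₀) θ = r₀ * (Complex.I * Complex.exp (θ * Complex.I)) :=
    ((hasDerivAt_exp_mul_I θ).const_mul (r₀ : ℂ)).deriv
  have hr : (r₀ : ℂ) ≠ 0 := by exact_mod_cast hr₀.ne'
  rw [unitTangent, hd]
  simp only [norm_mul, Complex.norm_I, norm_exp_mul_I, Complex.norm_real, mul_one,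
    Real.norm_of_nonneg hr₀.le]
  field_simp

theorem norm_deriv_circleCurve {r₀ : ℝ} (hr₀ : 0 < r₀) (θ : ℝ) :
    ‖deriv (circleCurve r₀) θ‖ = r₀ := by
  have hd : deriv (circleCurve r₀) θ = r₀ * (Complex.I * Complex.exp (θ * Complex.I)) :=
    ((hasDerivAt_exp_mul_I θ).const_mul (r₀ : ℂ)).deriv
  rw [hd]
  simp [Complex.norm_exp_ofReal_mul_I, abs_of_pos hr₀]

theorem unitNormal_circleCurve {r₀ : ℝ} (hr₀ : 0 < r₀) (θ : ℝ) :
    unitNormal (circleCurve r₀) θ = Complex.exp (θ * Complex.I) := by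
  rw [unitNormal, unitTangent_circleCurve hr₀, ← mul_assoc]
  simp

theorem closure_norm_gt {r₀ : ℝ} (hr₀ : 0 < r₀) : closure {z : ℂ | r₀ < ‖z‖} = {z | r₀ ≤ ‖z‖} := by
  have h1 : {z : ℂ | r₀ < ‖z‖} = (Metric.closedBall 0 r₀)ᶜ := by ext z; simp
  rw [h1, closure_compl, interior_closedBall _ hr₀.ne']
  ext z; simp

/-! ### Uniqueness for the transmission problem on the disk -/

/-- Two functions that are `C²` at a boundary point of an open set and agree in the set have the
same derivatives of first and second order at that point. -/
theorem fderiv_eq_of_eqOn_of_mem_closure {U : Set ℂ} (hU : IsOpen U) {f g : ℂ → ℂ}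
    (heq : EqOn f g U) {z : ℂ} (hz : z ∈ closure U) (hf : ContDiffAt ℝ 2 f z)
    (hg : ContDiffAt ℝ 2 g z) : fderiv ℝ f z = fderiv ℝ g z ∧
      fderiv ℝ (fderiv ℝ f) z = fderiv ℝ (fderiv ℝ g) z := by
  have hne : (𝓝[U] z).NeBot := mem_closure_iff_nhdsWithin_neBot.1 hz
  have hev : ∀ y ∈ U, f =ᶠ[𝓝 y] g := fun y hy => Filter.eventually_of_mem (hU.mem_nhds hy) heq
  have h1 : EqOn (fderiv ℝ f) (fderiv ℝ g) U := fun y hy => (hev y hy).fderiv_eq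
  have h2 : EqOn (fderiv ℝ (fderiv ℝ f)) (fderiv ℝ (fderiv ℝ g)) U :=
    fun y hy => Filter.EventuallyEq.fderiv_eq (Filter.eventually_of_mem (hU.mem_nhds hy) h1)
  have hf1 : ContDiffAt ℝ 1 (fderiv ℝ f) z := hf.fderiv_right (by norm_num)
  have hg1 : ContDiffAt ℝ 1 (fderiv ℝ g) z := hg.fderiv_right (by norm_num)
  have hf2 : ContDiffAt ℝ 0 (fderiv ℝ (fderiv ℝ f)) z := hf1.fderiv_right (by norm_num)
  have hg2 : ContDiffAt ℝ 0 (fderiv ℝ (fderiv ℝ g)) z := hg1.fderiv_right (by norm_num)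
  constructor
  · exact tendsto_nhds_unique_of_eventuallyEq
      (hf1.continuousAt.tendsto.mono_left nhdsWithin_le_nhds)
      (hg1.continuousAt.tendsto.mono_left nhdsWithin_le_nhds)
      (Filter.eventually_of_mem self_mem_nhdsWithin h1)
  · exact tendsto_nhds_unique_of_eventuallyEq
      (hf2.continuousAt.tendsto.mono_left nhdsWithin_le_nhds)
      (hg2.continuousAt.tendsto.mono_left nhdsWithin_le_nhds)
      (Filter.eventually_of_mem self_mem_nhdsWithin h2)

/-- Kelvin reflection: `z ↦ w (R² / z̄)` is harmonic outside the circle of radius `R` if `w` is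
harmonic inside. -/
theorem harmonicAt_kelvin {w : ℂ → ℂ} {R : ℝ} (hR : 0 < R)
    (hw : HarmonicOnNhd w (Metric.ball 0 R)) {z : ℂ} (hz : R < ‖z‖) :
    HarmonicAt (fun y => w ((R : ℂ) ^ 2 / starRingEnd ℂ y)) z := by
  have hz0 : starRingEnd ℂ z ≠ 0 := by
    rw [map_ne_zero]; exact norm_ne_zero_iff.1 (hR.trans hz).ne'
  have hmem : (R : ℂ) ^ 2 / starRingEnd ℂ z ∈ Metric.ball (0 : ℂ) R := by
    rw [mem_ball_zero_iff, norm_div, norm_pow, Complex.norm_real, Real.norm_of_nonneg hR.le,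
      RCLike.norm_conj, div_lt_iff₀ (hR.trans hz)]
    nlinarith
  have han : AnalyticAt ℂ (fun y : ℂ => (R : ℂ) ^ 2 / y) (starRingEnd ℂ z) :=
    analyticAt_const.div analyticAt_id hz0
  exact harmonicAt_of_re_im
    (HarmonicAt.comp_conj (h := fun y => (w ((R : ℂ) ^ 2 / y)).re)
      (HarmonicAt.comp_analyticAt (h := fun y => (w y).re) (hw _ hmem).re han))
    (HarmonicAt.comp_conj (h := fun y => (w ((R : ℂ) ^ 2 / y)).im)
      (HarmonicAt.comp_analyticAt (h := fun y => (w y).im) (hw _ hmem).im han))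

/-- Uniqueness for the homogeneous transmission problem.  By the exterior Dirichlet problem the
outer branch is the Kelvin reflection of the inner one, so their normal derivatives are opposite;
as `e ≠ -1`, both vanish.  The Euler derivative of the inner branch then vanishes on the circle and,
being harmonic, in the disk. -/
theorem transmission_eq_zero {r₀ : ℝ} (hr₀ : 0 < r₀) {e : ℂ} (he : e ≠ -1) {w : Potential}
    (hw : IsPiecewiseHarmonic (Metric.ball 0 r₀) w)
    (hjump : ∀ t, w.outside (circleCurve r₀ t) = w.inside (circleCurve r₀ t))
    (hflux : ∀ t, dNormal (circleCurve r₀) w.outside t = e * dNormal (circleCurve r₀) w.inside t)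
    (hinf : Tendsto w.outside (cobounded ℂ) (𝓝 0)) :
    (∀ z, ‖z‖ ≤ r₀ → w.inside z = 0) ∧ ∀ z, r₀ ≤ ‖z‖ → w.outside z = 0 := by
  have hclb : closure (Metric.ball (0 : ℂ) r₀) = Metric.closedBall 0 r₀ := closure_ball 0 hr₀.ne'
  have hinC : ∀ z : ℂ, ‖z‖ ≤ r₀ → ContDiffAt ℝ 2 w.inside z := fun z hz =>
    hw.inside_regular z (by rw [hclb]; simpa using hz)
  have houtC : ∀ z : ℂ, r₀ ≤ ‖z‖ → ContDiffAt ℝ 2 w.outside z := fun z hz =>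
    hw.outside_regular z (by rw [Metric.isOpen_ball.interior_eq]; simpa using hz)
  have hnorm : ∀ z : ℂ, ‖(r₀ : ℂ) ^ 2 / starRingEnd ℂ z‖ = r₀ ^ 2 / ‖z‖ := fun z => by
    rw [norm_div, norm_pow, Complex.norm_real, Real.norm_of_nonneg hr₀.le, RCLike.norm_conj]
  have hnormle : ∀ z : ℂ, r₀ ≤ ‖z‖ → ‖(r₀ : ℂ) ^ 2 / starRingEnd ℂ z‖ ≤ r₀ := fun z hz => by
    rw [hnorm, div_le_iff₀ (hr₀.trans_le hz)]; nlinarith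
  have hinv0 : Tendsto (fun z : ℂ => (r₀ : ℂ) ^ 2 / starRingEnd ℂ z) (cobounded ℂ) (𝓝 0) := by
    rw [tendsto_zero_iff_norm_tendsto_zero]
    simp only [hnorm]
    exact tendsto_norm_cobounded_atTop.const_div_atTop _
  have hdlim : Tendsto (fun z => w.outside z - w.inside ((r₀ : ℂ) ^ 2 / starRingEnd ℂ z))
      (cobounded ℂ) (𝓝 (0 - w.inside 0)) :=
    hinf.sub ((hinC 0 (by simpa using hr₀.le)).continuousAt.tendsto.comp hinv0)
  have hrefl : ∀ z, r₀ ≤ ‖z‖ →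
      w.outside z - w.inside ((r₀ : ℂ) ^ 2 / starRingEnd ℂ z) = 0 := by
    refine harmonic_eq_zero_of_sphere_exterior (M := ‖w.inside 0‖ + 1) hr₀ ?_ ?_ ?_ ?_
    · intro z hz
      exact (hw.outside_harmonic z (by rw [hclb]; simpa using hz)).sub
        (harmonicAt_kelvin hr₀ hw.inside_harmonic hz)
    · intro z hz
      have hz0 : starRingEnd ℂ z ≠ 0 := by
        rw [map_ne_zero]; exact norm_ne_zero_iff.1 (hr₀.trans_le hz).ne'
      have hc : ContinuousAt (fun y : ℂ => (r₀ : ℂ) ^ 2 / starRingEnd ℂ y) z :=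
        continuousAt_const.div Complex.continuous_conj.continuousAt hz0
      exact ((houtC z hz).continuousAt.sub (ContinuousAt.comp (g := w.inside)
        (hinC _ (hnormle z hz)).continuousAt hc)).continuousWithinAt
    · intro z hz
      have hz0 : starRingEnd ℂ z ≠ 0 := by
        rw [map_ne_zero]; exact norm_ne_zero_iff.1 (by rw [hz]; exact hr₀.ne')
      have h1 : (r₀ : ℂ) ^ 2 / starRingEnd ℂ z = z := by
        rw [div_eq_iff hz0, Complex.mul_conj, Complex.normSq_eq_norm_sq, hz]; norm_cast
      obtain ⟨t, rfl⟩ := exists_circleCurve_eq hz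
      rw [h1, hjump t, sub_self]
    · have h2 := hdlim.norm
      rw [zero_sub, norm_neg] at h2
      exact (h2.eventually_lt_const (lt_add_one _)).mono fun z hz => hz.le
  -- infinity is reflected to the centre
  have hin0 : w.inside 0 = 0 := by
    have h1 : Tendsto (fun z => w.outside z - w.inside ((r₀ : ℂ) ^ 2 / starRingEnd ℂ z))
        (cobounded ℂ) (𝓝 0) := by
      refine tendsto_const_nhds.congr' ?_
      filter_upwards [tendsto_norm_cobounded_atTop.eventually_ge_atTop r₀] with z hz
      exact (hrefl z hz).symm
    simpa using tendsto_nhds_unique hdlim h1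
  have hnormal : ∀ t, dNormal (circleCurve r₀) w.inside t = 0 := by
    intro t
    set ν := Complex.exp (t * Complex.I) with hν
    have hνn : ‖ν‖ = 1 := norm_exp_mul_I t
    have hν0 : ν ≠ 0 := Complex.exp_ne_zero _
    have hcirc : circleCurve r₀ t = (r₀ : ℝ) * ν := rfl
    have hr0 : ‖(r₀ : ℂ) * ν‖ = r₀ := by rw [← hcirc]; exact norm_circleCurve hr₀ t
    have hr : (r₀ : ℂ) ≠ 0 := by exact_mod_cast hr₀.ne'
    have hνconj : ν * starRingEnd ℂ ν = 1 := by
      rw [Complex.mul_conj, Complex.normSq_eq_norm_sq, hνn]; norm_num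
    have hout : HasDerivAt (fun s : ℝ => w.outside (s * ν)) (dNormal (circleCurve r₀) w.outside t)
        r₀ := by
      have h1 : HasDerivAt (fun s : ℝ => (s : ℂ) * ν) ν r₀ := by
        simpa using (Complex.ofRealCLM.hasDerivAt (x := r₀)).mul_const ν
      have h2 := ((houtC _ hr0.ge).differentiableAt (by norm_num)).hasFDerivAt.comp_hasDerivAt r₀ h1
      rwa [dNormal, unitNormal_circleCurve hr₀, hcirc]
    have hinn : HasDerivAt (fun s : ℝ => w.inside ((r₀ : ℂ) ^ 2 / s * ν))
        (-dNormal (circleCurve r₀) w.inside t) r₀ := by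
      have h1 : HasDerivAt (fun s : ℝ => (r₀ : ℂ) ^ 2 / (s : ℂ) * ν) (-ν) r₀ := by
        have h3 := (((Complex.ofRealCLM.hasDerivAt (x := r₀)).fun_inv
          (by simpa using hr₀.ne')).const_mul ((r₀ : ℂ) ^ 2)).mul_const ν
        convert! h3 using 1
        simp only [Complex.ofRealCLM_apply, Complex.ofReal_one]
        field_simp
      have h4 : (r₀ : ℂ) ^ 2 / r₀ * ν = r₀ * ν := by field_simp
      have h2 := (((hinC _ hr0.le).differentiableAt (by norm_num)).hasFDerivAt :
        HasFDerivAt w.inside _ ((r₀ : ℂ) * ν))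
      rw [← h4] at h2
      have h5 := h2.comp_hasDerivAt r₀ h1
      rw [h4, map_neg] at h5
      rwa [dNormal, unitNormal_circleCurve hr₀, hcirc]
    -- along a ray the reflection is the inversion `s ↦ r₀² / s`, with derivative `-1` at `r₀`
    have heq : EqOn (fun s : ℝ => w.inside ((r₀ : ℂ) ^ 2 / s * ν)) (fun s : ℝ => w.outside (s * ν))
        (Ici r₀) := by
      intro s hs
      have hs0 : (0 : ℝ) < s := hr₀.trans_le hs
      have hsc : (s : ℂ) ≠ 0 := by exact_mod_cast hs0.ne'
      have h1 := hrefl (s * ν) (by simpa [hνn, abs_of_pos hs0] using hs)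
      have h2 : (r₀ : ℂ) ^ 2 / starRingEnd ℂ (s * ν) = (r₀ : ℂ) ^ 2 / s * ν := by
        rw [map_mul, Complex.conj_ofReal, ← one_div_mul_eq_div, ← one_div_mul_eq_div]
        have hc0 : starRingEnd ℂ ν ≠ 0 := by rwa [map_ne_zero]
        field_simp
        linear_combination -hνconj
      rw [h2] at h1
      exact (sub_eq_zero.1 h1).symm
    have huniq := (uniqueDiffOn_Ici r₀ r₀ self_mem_Ici).eq_deriv (Ici r₀) hinn.hasDerivWithinAt
      (hout.hasDerivWithinAt.congr heq (heq self_mem_Ici))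
    rw [hflux t] at huniq
    have h6 : (1 + e) * dNormal (circleCurve r₀) w.inside t = 0 := by linear_combination -huniq
    rcases mul_eq_zero.1 h6 with h7 | h7
    · exact absurd (by linear_combination h7) he
    · exact h7
  have heuler : ∀ z, ‖z‖ ≤ r₀ → fderiv ℝ w.inside z z = 0 := by
    refine harmonic_eq_zero_of_sphere hr₀ (fun z hz => (hw.inside_harmonic z hz).euler) ?_ ?_
    · intro z hz
      have h1 : ContDiffAt ℝ 1 (fderiv ℝ w.inside) z :=
        (hinC z (by simpa using hz)).fderiv_right (by norm_num)
      exact (h1.continuousAt.clm_apply continuousAt_id).continuousWithinAt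
    · intro z hz
      obtain ⟨t, rfl⟩ := exists_circleCurve_eq hz
      have h1 := hnormal t
      rw [dNormal, unitNormal_circleCurve hr₀] at h1
      have h2 : circleCurve r₀ t = r₀ • Complex.exp (t * Complex.I) := by
        rw [Complex.real_smul]; rfl
      conv_lhs => rw [h2, map_smul, ← h2, h1, smul_zero]
  -- the Euler derivative controls `w` along rays from the centre, except at the centre itself,
  -- where the radial derivative vanishes by continuity
  have hin : ∀ z, ‖z‖ ≤ r₀ → w.inside z = 0 := by
    intro z hz
    have hle : ∀ s : ℝ, s ∈ Icc (0 : ℝ) 1 → ‖s • z‖ ≤ r₀ := fun s hs => by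
      rw [norm_smul, Real.norm_of_nonneg hs.1]
      exact (mul_le_of_le_one_left (norm_nonneg z) hs.2).trans hz
    have hd : ∀ s ∈ Icc (0 : ℝ) 1, HasDerivAt (fun s : ℝ => w.inside (s • z))
        (fderiv ℝ w.inside (s • z) z) s := fun s hs => by
      have h1 : HasDerivAt (fun s : ℝ => s • z) z s := by simpa using (hasDerivAt_id s).smul_const z
      exact ((hinC _ (hle s hs)).differentiableAt (by norm_num)).hasFDerivAt.comp_hasDerivAt s h1
    have hpos : ∀ s ∈ Ioc (0 : ℝ) 1, fderiv ℝ w.inside (s • z) z = 0 := fun s hs => by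
      have h1 := heuler (s • z) (hle s ⟨hs.1.le, hs.2⟩)
      rw [map_smul] at h1
      exact (smul_eq_zero.1 h1).resolve_left hs.1.ne'
    have hzero : fderiv ℝ w.inside ((0 : ℝ) • z) z = 0 := by
      have h1 : ContDiffAt ℝ 1 (fderiv ℝ w.inside) ((0 : ℝ) • z) :=
        (hinC _ (hle 0 (by simp))).fderiv_right (by norm_num)
      have h2 : ContinuousAt (fun s : ℝ => fderiv ℝ w.inside (s • z) z) 0 :=
        ((ContinuousAt.comp (f := fun s : ℝ => s • z) (g := fderiv ℝ w.inside) h1.continuousAt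
          (by fun_prop))).clm_apply continuousAt_const
      refine tendsto_nhds_unique (h2.tendsto.mono_left nhdsWithin_le_nhds)
        (tendsto_const_nhds.congr' ?_ : Tendsto _ (𝓝[>] (0 : ℝ)) _)
      filter_upwards [Ioc_mem_nhdsGT (zero_lt_one (α := ℝ))] with s hs
      exact (hpos s hs).symm
    have hconst := constant_of_has_deriv_right_zero (f := fun s : ℝ => w.inside (s • z)) (a := 0)
      (b := 1) (fun s hs => (hd s hs).continuousAt.continuousWithinAt) (fun s hs => by
        have h1 := hd s ⟨hs.1, hs.2.le⟩
        have h2 : fderiv ℝ w.inside (s • z) z = 0 := by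
          rcases hs.1.eq_or_lt with h | h
          · rw [← h]; exact hzero
          · exact hpos s ⟨h, hs.2.le⟩
        rw [h2] at h1
        exact h1.hasDerivWithinAt) 1 (by simp)
    simpa [hin0] using hconst
  refine ⟨hin, fun z hz => ?_⟩
  have h1 := hrefl z hz
  rwa [hin _ (hnormle z hz), sub_zero] at h1

theorem IsPiecewiseHarmonic.contDiffAt_inside {r₀ : ℝ} (hr₀ : 0 < r₀) {w : Potential}
    (hw : IsPiecewiseHarmonic (Metric.ball 0 r₀) w) {z : ℂ} (hz : ‖z‖ ≤ r₀) :
    ContDiffAt ℝ 2 w.inside z :=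
  hw.inside_regular z (by rw [closure_ball 0 hr₀.ne']; simpa using hz)

theorem IsPiecewiseHarmonic.contDiffAt_outside {r₀ : ℝ} {w : Potential}
    (hw : IsPiecewiseHarmonic (Metric.ball 0 r₀) w) {z : ℂ} (hz : r₀ ≤ ‖z‖) :
    ContDiffAt ℝ 2 w.outside z :=
  hw.outside_regular z (by rw [Metric.isOpen_ball.interior_eq]; simpa using hz)

theorem dNormal_sub {γ : ℝ → ℂ} {f g : ℂ → ℂ} {t : ℝ} (hf : DifferentiableAt ℝ f (γ t))
    (hg : DifferentiableAt ℝ g (γ t)) :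
    dNormal γ (fun z => f z - g z) t = dNormal γ f t - dNormal γ g t := by
  simp only [dNormal]
  rw [fderiv_fun_sub hf hg, sub_apply]

/-- Potentials on the disk are determined by their jump, their flux jump and their behaviour
at infinity. -/
theorem transmission_unique {r₀ : ℝ} (hr₀ : 0 < r₀) {e : ℂ} (he : e ≠ -1) {w w' : Potential}
    (hw : IsPiecewiseHarmonic (Metric.ball 0 r₀) w)
    (hw' : IsPiecewiseHarmonic (Metric.ball 0 r₀) w')
    (hjump : ∀ t, w.outside (circleCurve r₀ t) - w.inside (circleCurve r₀ t)
      = w'.outside (circleCurve r₀ t) - w'.inside (circleCurve r₀ t))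
    (hflux : ∀ t, dNormal (circleCurve r₀) w.outside t - e * dNormal (circleCurve r₀) w.inside t
      = dNormal (circleCurve r₀) w'.outside t - e * dNormal (circleCurve r₀) w'.inside t)
    (hinf : Tendsto (fun z => w.outside z - w'.outside z) (cobounded ℂ) (𝓝 0)) :
    (∀ z, ‖z‖ ≤ r₀ → w.inside z = w'.inside z) ∧ ∀ z, r₀ ≤ ‖z‖ → w.outside z = w'.outside z := by
  have hdi : ∀ {v : Potential}, IsPiecewiseHarmonic (Metric.ball 0 r₀) v → ∀ t,
      DifferentiableAt ℝ v.inside (circleCurve r₀ t) := fun hv t =>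
    (hv.contDiffAt_inside hr₀ (norm_circleCurve hr₀ t).le).differentiableAt (by norm_num)
  have hdo : ∀ {v : Potential}, IsPiecewiseHarmonic (Metric.ball 0 r₀) v → ∀ t,
      DifferentiableAt ℝ v.outside (circleCurve r₀ t) := fun hv t =>
    (hv.contDiffAt_outside (norm_circleCurve hr₀ t).ge).differentiableAt (by norm_num)
  have h := transmission_eq_zero (w := ⟨fun z => w.inside z - w'.inside z,
    fun z => w.outside z - w'.outside z⟩) hr₀ he
    ⟨fun z hz => (hw.inside_harmonic z hz).sub (hw'.inside_harmonic z hz),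
      fun z hz => (hw.inside_regular z hz).sub (hw'.inside_regular z hz),
      fun z hz => (hw.outside_harmonic z hz).sub (hw'.outside_harmonic z hz),
      fun z hz => (hw.outside_regular z hz).sub (hw'.outside_regular z hz)⟩
    (fun t => by linear_combination hjump t)
    (fun t => by
      simp only
      rw [dNormal_sub (hdo hw t) (hdo hw' t), dNormal_sub (hdi hw t) (hdi hw' t)]
      linear_combination hflux t)
    hinf
  exact ⟨fun z hz => sub_eq_zero.1 (h.1 z hz), fun z hz => sub_eq_zero.1 (h.2 z hz)⟩

/-- Potentials that agree off the circle have the same first and second derivatives on it. -/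
theorem fderiv_inside_eq {r₀ : ℝ} (hr₀ : 0 < r₀) {w w' : Potential}
    (hw : IsPiecewiseHarmonic (Metric.ball 0 r₀) w)
    (hw' : IsPiecewiseHarmonic (Metric.ball 0 r₀) w')
    (h : ∀ z, ‖z‖ ≤ r₀ → w.inside z = w'.inside z) (θ : ℝ) :
    fderiv ℝ w.inside (circleCurve r₀ θ) = fderiv ℝ w'.inside (circleCurve r₀ θ) ∧
      fderiv ℝ (fderiv ℝ w.inside) (circleCurve r₀ θ)
        = fderiv ℝ (fderiv ℝ w'.inside) (circleCurve r₀ θ) :=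
  have hz := norm_circleCurve hr₀ θ
  fderiv_eq_of_eqOn_of_mem_closure Metric.isOpen_ball
    (fun z hz => h z (mem_ball_zero_iff.1 hz).le)
    (by rw [closure_ball 0 hr₀.ne', mem_closedBall_zero_iff]; exact hz.le)
    (hw.contDiffAt_inside hr₀ hz.le) (hw'.contDiffAt_inside hr₀ hz.le)

theorem fderiv_outside_eq {r₀ : ℝ} (hr₀ : 0 < r₀) {w w' : Potential}
    (hw : IsPiecewiseHarmonic (Metric.ball 0 r₀) w)
    (hw' : IsPiecewiseHarmonic (Metric.ball 0 r₀) w')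
    (h : ∀ z, r₀ ≤ ‖z‖ → w.outside z = w'.outside z) (θ : ℝ) :
    fderiv ℝ w.outside (circleCurve r₀ θ) = fderiv ℝ w'.outside (circleCurve r₀ θ) ∧
      fderiv ℝ (fderiv ℝ w.outside) (circleCurve r₀ θ)
        = fderiv ℝ (fderiv ℝ w'.outside) (circleCurve r₀ θ) :=
  have hz := norm_circleCurve hr₀ θ
  fderiv_eq_of_eqOn_of_mem_closure (isOpen_lt continuous_const continuous_norm)
    (fun z hz => h z (le_of_lt hz)) (by rw [closure_norm_gt hr₀]; exact hz.ge)
    (hw.contDiffAt_outside hz.ge) (hw'.contDiffAt_outside hz.ge)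

/-! ### Multipole fields -/

noncomputable section

/-- The field `Re z ^ k = r ^ k cos (k θ)`, for a positive or negative order `k`. -/
def cosMode (k : ℤ) (z : ℂ) : ℂ := ((z ^ k).re : ℂ)

/-- A finite superposition of the fields `Re z ^ k`. -/
def modeSum {ι : Type*} [Fintype ι] (a : ι → ℂ) (k : ι → ℤ) (z : ℂ) : ℂ :=
  ∑ i, a i * cosMode (k i) z

/-- The real-linear map `v ↦ Re (c v)`, as a real-linear function of `c`. -/
def reMul : ℂ →L[ℝ] ℂ →L[ℝ] ℂ :=
  (ContinuousLinearMap.compL ℝ ℂ ℂ ℂ (Complex.ofRealCLM.comp Complex.reCLM)).comp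
    (ContinuousLinearMap.mul ℝ ℂ)

end

@[simp] theorem reMul_apply (c v : ℂ) : reMul c v = ((c * v).re : ℂ) := rfl

theorem hasFDerivAt_cosMode (k : ℤ) {z : ℂ} (hz : z ≠ 0) :
    HasFDerivAt (cosMode k) (reMul (k * z ^ (k - 1))) z := by
  have h := (Complex.ofRealCLM.comp Complex.reCLM).hasFDerivAt.comp z
    ((hasDerivAt_zpow k z (Or.inl hz)).hasFDerivAt.restrictScalars ℝ)
  convert! h using 1
  ext v
  simp [mul_comm v]

theorem fderiv_modeSum {ι : Type*} [Fintype ι] (a : ι → ℂ) (k : ι → ℤ) {z : ℂ} (hz : z ≠ 0) :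
    fderiv ℝ (modeSum a k) z = ∑ i, a i • reMul (k i * z ^ (k i - 1)) := by
  have h : HasFDerivAt (modeSum a k) (∑ i, a i • reMul (k i * z ^ (k i - 1))) z :=
    HasFDerivAt.fun_sum fun i _ => (hasFDerivAt_cosMode (k i) hz).const_mul (a i)
  exact h.fderiv

theorem fderiv_fderiv_modeSum {ι : Type*} [Fintype ι] (a : ι → ℂ) (k : ι → ℤ) {z : ℂ} (hz : z ≠ 0)
    (v : ℂ) : fderiv ℝ (fderiv ℝ (modeSum a k)) z v
      = ∑ i, a i • reMul (k i * ((k i - 1) * z ^ (k i - 2)) * v) := by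
  have hev : fderiv ℝ (modeSum a k) =ᶠ[𝓝 z] fun y => ∑ i, a i • reMul (k i * y ^ (k i - 1)) := by
    filter_upwards [isOpen_ne.mem_nhds hz] with y hy using fderiv_modeSum a k hy
  have h : HasFDerivAt (fun y => ∑ i, a i • reMul (k i * y ^ (k i - 1))) _ z :=
    HasFDerivAt.fun_sum fun i _ => (reMul.hasFDerivAt.comp z
      (((hasDerivAt_zpow (k i - 1) z (Or.inl hz)).const_mul (k i : ℂ)).hasFDerivAt.restrictScalars
        ℝ)).const_smul (a i)
  rw [hev.fderiv_eq, h.fderiv]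
  simp only [sum_apply, smul_apply,
    ContinuousLinearMap.comp_apply]
  refine Finset.sum_congr rfl fun i _ => ?_
  congr 2
  simp [mul_comm v, sub_sub]

theorem exp_mul_I_zpow_re (θ : ℝ) (k : ℤ) :
    ((Complex.exp (θ * Complex.I)) ^ k).re = Real.cos (k * θ) := by
  rw [← Complex.exp_int_mul, show (k : ℂ) * (θ * Complex.I) = ((k * θ : ℝ) : ℂ) * Complex.I by
    push_cast; ring, Complex.exp_ofReal_mul_I_re]

theorem exp_mul_I_zpow_im (θ : ℝ) (k : ℤ) :
    ((Complex.exp (θ * Complex.I)) ^ k).im = Real.sin (k * θ) := by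
  rw [← Complex.exp_int_mul, show (k : ℂ) * (θ * Complex.I) = ((k * θ : ℝ) : ℂ) * Complex.I by
    push_cast; ring, Complex.exp_ofReal_mul_I_im]

theorem cosMode_polar (k : ℤ) (r θ : ℝ) :
    cosMode k (r * Complex.exp (θ * Complex.I)) = (r : ℂ) ^ k * (Real.cos (k * θ) : ℂ) := by
  rw [cosMode, mul_zpow, ← Complex.ofReal_zpow, Complex.re_ofReal_mul, exp_mul_I_zpow_re]
  push_cast; rfl

section Circle

variable {ι : Type*} [Fintype ι] (a : ι → ℂ) (k : ι → ℤ) {r₀ : ℝ}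

theorem circleCurve_ne_zero (hr₀ : 0 < r₀) (θ : ℝ) : circleCurve r₀ θ ≠ 0 :=
  norm_ne_zero_iff.1 (by rw [norm_circleCurve hr₀]; exact hr₀.ne')

theorem modeSum_circle (θ : ℝ) : modeSum a k (circleCurve r₀ θ)
    = ∑ i, a i * ((r₀ : ℂ) ^ k i * (Real.cos (k i * θ) : ℂ)) := by
  simp only [modeSum, circleCurve, cosMode_polar]

theorem zpow_circle_mul_re (c : ℝ) (k m : ℤ) (j : ℕ) (hm : m + j = k) (θ : ℝ) :
    ((c * (circleCurve r₀ θ) ^ m * Complex.exp (θ * Complex.I) ^ j).re : ℂ)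
      = c * ((r₀ : ℂ) ^ m * (Real.cos (k * θ) : ℂ)) := by
  rw [circleCurve, mul_zpow, mul_assoc, mul_assoc, ← zpow_natCast, ← zpow_add₀
    (Complex.exp_ne_zero _), hm, ← Complex.ofReal_zpow, Complex.re_ofReal_mul,
    Complex.re_ofReal_mul, exp_mul_I_zpow_re]
  push_cast; rfl

theorem zpow_circle_mul_I_re (c : ℝ) (k m : ℤ) (j : ℕ) (hm : m + j = k) (θ : ℝ) :
    ((c * (circleCurve r₀ θ) ^ m * Complex.exp (θ * Complex.I) ^ j * Complex.I).re : ℂ)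
      = -(c * ((r₀ : ℂ) ^ m * (Real.sin (k * θ) : ℂ))) := by
  rw [circleCurve, mul_zpow, mul_assoc, mul_assoc, mul_assoc, ← mul_assoc (_ ^ m) (_ ^ j),
    ← zpow_natCast, ← zpow_add₀
    (Complex.exp_ne_zero _), hm, ← Complex.ofReal_zpow, Complex.re_ofReal_mul,
    Complex.re_ofReal_mul, Complex.mul_I_re, exp_mul_I_zpow_im]
  push_cast; ring

theorem dNormal_modeSum (hr₀ : 0 < r₀) (θ : ℝ) : dNormal (circleCurve r₀) (modeSum a k) θ
    = ∑ i, a i * (k i * ((r₀ : ℂ) ^ (k i - 1) * (Real.cos (k i * θ) : ℂ))) := by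
  rw [dNormal, unitNormal_circleCurve hr₀, fderiv_modeSum a k (circleCurve_ne_zero hr₀ θ)]
  simp only [sum_apply, smul_apply, reMul_apply, smul_eq_mul]
  refine Finset.sum_congr rfl fun i _ => ?_
  have h := zpow_circle_mul_re (r₀ := r₀) (k i) (k i) (k i - 1) 1 (by push_cast; ring) θ
  rw [pow_one] at h
  push_cast at h
  rw [h]; push_cast; rfl

theorem dTangent_modeSum (hr₀ : 0 < r₀) (θ : ℝ) : dTangent (circleCurve r₀) (modeSum a k) θ
    = -∑ i, a i * (k i * ((r₀ : ℂ) ^ (k i - 1) * (Real.sin (k i * θ) : ℂ))) := by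
  rw [dTangent, unitTangent_circleCurve hr₀, fderiv_modeSum a k (circleCurve_ne_zero hr₀ θ)]
  simp only [sum_apply, smul_apply, reMul_apply, smul_eq_mul,
    ← Finset.sum_neg_distrib]
  refine Finset.sum_congr rfl fun i _ => ?_
  have h := zpow_circle_mul_I_re (r₀ := r₀) (k i) (k i) (k i - 1) 1 (by push_cast; ring) θ
  rw [pow_one, mul_assoc, mul_comm (Complex.exp _)] at h
  push_cast at h
  rw [h]; push_cast; ring

theorem dNormalNormal_modeSum (hr₀ : 0 < r₀) (θ : ℝ) : dNormalNormal r₀ (modeSum a k) θ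
    = ∑ i, a i * (k i * (k i - 1) * ((r₀ : ℂ) ^ (k i - 2) * (Real.cos (k i * θ) : ℂ))) := by
  rw [dNormalNormal, unitNormal_circleCurve hr₀,
    fderiv_fderiv_modeSum a k (circleCurve_ne_zero hr₀ θ)]
  simp only [sum_apply, smul_apply, reMul_apply, smul_eq_mul]
  refine Finset.sum_congr rfl fun i _ => ?_
  have h := zpow_circle_mul_re (r₀ := r₀) (k i * (k i - 1)) (k i) (k i - 2) 2 (by push_cast; ring) θ
  rw [pow_two, ← mul_assoc] at h
  push_cast at h
  rw [← mul_assoc (k i : ℂ), h]; push_cast; rfl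

theorem dNormalTangent_modeSum (hr₀ : 0 < r₀) (θ : ℝ) : dNormalTangent r₀ (modeSum a k) θ
    = -∑ i, a i * (k i * (k i - 1) * ((r₀ : ℂ) ^ (k i - 2) * (Real.sin (k i * θ) : ℂ))) := by
  rw [dNormalTangent, unitNormal_circleCurve hr₀, unitTangent_circleCurve hr₀,
    fderiv_fderiv_modeSum a k (circleCurve_ne_zero hr₀ θ)]
  simp only [sum_apply, smul_apply, reMul_apply, smul_eq_mul,
    ← Finset.sum_neg_distrib]
  refine Finset.sum_congr rfl fun i _ => ?_
  have h := zpow_circle_mul_I_re (r₀ := r₀) (k i * (k i - 1)) (k i) (k i - 2) 2 (by push_cast; ring) θ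
  rw [pow_two, ← mul_assoc, mul_assoc _ _ Complex.I, mul_comm (Complex.exp _) Complex.I] at h
  push_cast at h
  rw [← mul_assoc (k i : ℂ), h]; push_cast; ring

end Circle

theorem harmonicAt_cosMode {k : ℤ} {z : ℂ} (h : z ≠ 0 ∨ 0 ≤ k) : HarmonicAt (cosMode k) z := by
  have han : AnalyticAt ℂ (fun y : ℂ => y ^ k) z := by
    rcases h with h | h
    · exact analyticAt_id.zpow h
    · exact analyticAt_id.zpow_nonneg h
  exact han.harmonicAt.comp_CLM (Complex.ofRealCLM.comp Complex.reCLM)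

theorem harmonicAt_modeSum {ι : Type*} [Fintype ι] (a : ι → ℂ) {k : ι → ℤ} {z : ℂ}
    (h : z ≠ 0 ∨ ∀ i, 0 ≤ k i) : HarmonicAt (modeSum a k) z := by
  have key : ∀ s : Finset ι, HarmonicAt (fun y => ∑ i ∈ s, a i * cosMode (k i) y) z := by
    classical
    intro s
    induction s using Finset.induction_on with
    | empty => simp
    | insert i s hi ih =>
      simp only [Finset.sum_insert hi]
      exact ((harmonicAt_cosMode (h.imp_right fun h => h i)).const_mul (a i)).add ih
  exact key Finset.univ

theorem isPiecewiseHarmonic_of_harmonicAt {r₀ : ℝ} (hr₀ : 0 < r₀) {w : Potential}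
    (hi : ∀ z, ‖z‖ ≤ r₀ → HarmonicAt w.inside z) (ho : ∀ z, r₀ ≤ ‖z‖ → HarmonicAt w.outside z) :
    IsPiecewiseHarmonic (Metric.ball 0 r₀) w where
  inside_harmonic z hz := hi z (mem_ball_zero_iff.1 hz).le
  inside_regular z hz := (hi z (by
    rw [closure_ball 0 hr₀.ne'] at hz; exact mem_closedBall_zero_iff.1 hz)).1
  outside_harmonic z hz := ho z (by
    rw [closure_ball 0 hr₀.ne', mem_compl_iff, mem_closedBall_zero_iff, not_le] at hz; exact hz.le)
  outside_regular z hz := (ho z (by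
    rw [Metric.isOpen_ball.interior_eq, mem_ball_zero_iff, not_lt] at hz; exact hz)).1

theorem ne_zero_of_le_norm {r₀ : ℝ} (hr₀ : 0 < r₀) {z : ℂ} (hz : r₀ ≤ ‖z‖) : z ≠ 0 :=
  norm_ne_zero_iff.1 (hr₀.trans_le hz).ne'

theorem isPiecewiseHarmonic_modeSum {r₀ : ℝ} (hr₀ : 0 < r₀) {ι κ : Type*} [Fintype ι] [Fintype κ]
    (a : ι → ℂ) {k : ι → ℤ} (hk : ∀ i, 0 ≤ k i) (b : κ → ℂ) (l : κ → ℤ) :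
    IsPiecewiseHarmonic (Metric.ball 0 r₀) ⟨modeSum a k, modeSum b l⟩ :=
  isPiecewiseHarmonic_of_harmonicAt hr₀ (fun _ _ => harmonicAt_modeSum a (Or.inr hk))
    fun _ hz => harmonicAt_modeSum b (Or.inl (ne_zero_of_le_norm hr₀ hz))

theorem modeSum_isBigO {ι : Type*} [Fintype ι] (a : ι → ℂ) {k : ι → ℤ} {m : ℕ}
    (hk : ∀ i, k i ≤ -m) : modeSum a k =O[cobounded ℂ] fun z => (‖z‖ ^ m)⁻¹ := by
  have h : ∀ i ∈ (Finset.univ : Finset ι), (fun z => a i * cosMode (k i) z)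
      =O[cobounded ℂ] fun z => (‖z‖ ^ m)⁻¹ := by
    refine fun i _ => (IsBigO.of_bound 1 ?_).const_mul_left (a i)
    filter_upwards [tendsto_norm_cobounded_atTop.eventually_ge_atTop 1] with z hz
    rw [one_mul, cosMode, Complex.norm_real, Real.norm_eq_abs]
    refine (Complex.abs_re_le_norm _).trans ?_
    rw [norm_zpow, Real.norm_of_nonneg (by positivity), ← zpow_natCast, ← zpow_neg]
    exact zpow_le_zpow_right₀ hz (hk i)
  exact IsBigO.fun_sum h

theorem tendsto_inv_norm_pow {m : ℕ} (hm : m ≠ 0) :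
    Tendsto (fun z : ℂ => (‖z‖ ^ m)⁻¹) (cobounded ℂ) (𝓝 0) :=
  (((tendsto_pow_atTop hm).comp tendsto_norm_cobounded_atTop)).inv_tendsto_atTop

/-! ### Multipole solutions of the transmission problem -/

noncomputable section

/-- Amplitude on the circle of the outer field with jump `α cos (k θ)` and flux
jump `β cos (k θ)`. -/
def outerAmp (e : ℂ) (r₀ : ℝ) (k : ℕ) (α β : ℂ) : ℂ := (e * α - β * r₀ / k) / (1 + e)

/-- The potential with jump `∑ αᵢ cos (kᵢ θ)` and flux jump `∑ βᵢ cos (kᵢ θ)` that vanishes at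
infinity. -/
def transmissionField {ι : Type*} [Fintype ι] (e : ℂ) (r₀ : ℝ) (k : ι → ℕ) (α β : ι → ℂ) :
    Potential where
  inside := modeSum (fun i => (outerAmp e r₀ (k i) (α i) (β i) - α i) / r₀ ^ k i) (fun i => k i)
  outside := modeSum (fun i => outerAmp e r₀ (k i) (α i) (β i) * r₀ ^ k i) (fun i => -(k i))

end

section Transmission

variable {ι : Type*} [Fintype ι] (e : ℂ) {r₀ : ℝ} (k : ι → ℕ) (α β : ι → ℂ)

theorem isPiecewiseHarmonic_transmissionField (hr₀ : 0 < r₀) :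
    IsPiecewiseHarmonic (Metric.ball 0 r₀) (transmissionField e r₀ k α β) :=
  isPiecewiseHarmonic_modeSum hr₀ _ (fun i => by positivity) _ _

theorem transmissionField_isBigO {m : ℕ} (hk : ∀ i, m ≤ k i) :
    (transmissionField e r₀ k α β).outside =O[cobounded ℂ] fun z => (‖z‖ ^ m)⁻¹ :=
  modeSum_isBigO _ fun i => by simpa using hk i

theorem transmissionField_outside_polar {r : ℝ} (θ : ℝ) :
    (transmissionField e r₀ k α β).outside (r * Complex.exp (θ * Complex.I))
      = ∑ i, outerAmp e r₀ (k i) (α i) (β i) * r₀ ^ k i * (1 / (r : ℂ) ^ k i)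
        * (Real.cos (k i * θ) : ℂ) := by
  simp only [transmissionField, modeSum, cosMode_polar]
  refine Finset.sum_congr rfl fun i _ => ?_
  rw [zpow_neg, zpow_natCast]
  push_cast
  rw [neg_mul (k i : ℂ) (θ : ℂ), Complex.cos_neg]
  ring

theorem transmissionField_jump (hr₀ : 0 < r₀) (θ : ℝ) :
    (transmissionField e r₀ k α β).outside (circleCurve r₀ θ)
      - (transmissionField e r₀ k α β).inside (circleCurve r₀ θ)
      = ∑ i, α i * (Real.cos (k i * θ) : ℂ) := by
  have hr : (r₀ : ℂ) ≠ 0 := by exact_mod_cast hr₀.ne'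
  simp only [transmissionField, modeSum_circle, ← Finset.sum_sub_distrib]
  refine Finset.sum_congr rfl fun i _ => ?_
  rw [zpow_neg, zpow_natCast]
  push_cast
  rw [neg_mul (k i : ℂ) (θ : ℂ), Complex.cos_neg]
  field_simp
  ring

theorem dNormal_transmissionField_inside (hr₀ : 0 < r₀) (θ : ℝ) :
    dNormal (circleCurve r₀) (transmissionField e r₀ k α β).inside θ
      = ∑ i, (outerAmp e r₀ (k i) (α i) (β i) - α i) * (k i / r₀ * (Real.cos (k i * θ) : ℂ)) := by
  have hr : (r₀ : ℂ) ≠ 0 := by exact_mod_cast hr₀.ne'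
  simp only [transmissionField, dNormal_modeSum _ _ hr₀]
  refine Finset.sum_congr rfl fun i _ => ?_
  rw [zpow_sub_one₀ hr, zpow_natCast]
  push_cast
  field_simp

theorem dTangent_transmissionField_inside (hr₀ : 0 < r₀) (θ : ℝ) :
    dTangent (circleCurve r₀) (transmissionField e r₀ k α β).inside θ
      = -∑ i, (outerAmp e r₀ (k i) (α i) (β i) - α i)
        * (k i / r₀ * (Real.sin (k i * θ) : ℂ)) := by
  have hr : (r₀ : ℂ) ≠ 0 := by exact_mod_cast hr₀.ne'
  simp only [transmissionField, dTangent_modeSum _ _ hr₀]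
  congr 1
  refine Finset.sum_congr rfl fun i _ => ?_
  rw [zpow_sub_one₀ hr, zpow_natCast]
  push_cast
  field_simp

theorem dNormalNormal_transmissionField_inside (hr₀ : 0 < r₀) (θ : ℝ) :
    dNormalNormal r₀ (transmissionField e r₀ k α β).inside θ
      = ∑ i, (outerAmp e r₀ (k i) (α i) (β i) - α i)
        * (k i * (k i - 1) / r₀ ^ 2 * (Real.cos (k i * θ) : ℂ)) := by
  have hr : (r₀ : ℂ) ≠ 0 := by exact_mod_cast hr₀.ne'
  simp only [transmissionField, dNormalNormal_modeSum _ _ hr₀]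
  refine Finset.sum_congr rfl fun i _ => ?_
  rw [zpow_sub₀ hr, zpow_natCast]
  push_cast
  field_simp

theorem dNormal_transmissionField_outside (hr₀ : 0 < r₀) (θ : ℝ) :
    dNormal (circleCurve r₀) (transmissionField e r₀ k α β).outside θ
      = -∑ i, outerAmp e r₀ (k i) (α i) (β i) * (k i / r₀ * (Real.cos (k i * θ) : ℂ)) := by
  have hr : (r₀ : ℂ) ≠ 0 := by exact_mod_cast hr₀.ne'
  simp only [transmissionField, dNormal_modeSum _ _ hr₀, ← Finset.sum_neg_distrib]
  refine Finset.sum_congr rfl fun i _ => ?_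
  rw [zpow_sub_one₀ hr, zpow_neg, zpow_natCast]
  push_cast
  rw [neg_mul (k i : ℂ) (θ : ℂ), Complex.cos_neg]
  field_simp

theorem dTangent_transmissionField_outside (hr₀ : 0 < r₀) (θ : ℝ) :
    dTangent (circleCurve r₀) (transmissionField e r₀ k α β).outside θ
      = -∑ i, outerAmp e r₀ (k i) (α i) (β i) * (k i / r₀ * (Real.sin (k i * θ) : ℂ)) := by
  have hr : (r₀ : ℂ) ≠ 0 := by exact_mod_cast hr₀.ne'
  simp only [transmissionField, dTangent_modeSum _ _ hr₀]
  congr 1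
  refine Finset.sum_congr rfl fun i _ => ?_
  rw [zpow_sub_one₀ hr, zpow_neg, zpow_natCast]
  push_cast
  rw [neg_mul (k i : ℂ) (θ : ℂ), Complex.sin_neg]
  field_simp

theorem dNormalNormal_transmissionField_outside (hr₀ : 0 < r₀) (θ : ℝ) :
    dNormalNormal r₀ (transmissionField e r₀ k α β).outside θ
      = ∑ i, outerAmp e r₀ (k i) (α i) (β i)
        * (k i * (k i + 1) / r₀ ^ 2 * (Real.cos (k i * θ) : ℂ)) := by
  have hr : (r₀ : ℂ) ≠ 0 := by exact_mod_cast hr₀.ne'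
  simp only [transmissionField, dNormalNormal_modeSum _ _ hr₀]
  refine Finset.sum_congr rfl fun i _ => ?_
  rw [zpow_sub₀ hr, zpow_neg, zpow_natCast]
  push_cast
  rw [neg_mul (k i : ℂ) (θ : ℂ), Complex.cos_neg]
  norm_cast
  push_cast
  field_simp
  ring

theorem transmissionField_flux (hr₀ : 0 < r₀) (he : e ≠ -1) (hk : ∀ i, k i ≠ 0) (θ : ℝ) :
    dNormal (circleCurve r₀) (transmissionField e r₀ k α β).outside θ
      - e * dNormal (circleCurve r₀) (transmissionField e r₀ k α β).inside θ
      = ∑ i, β i * (Real.cos (k i * θ) : ℂ) := by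
  have hr : (r₀ : ℂ) ≠ 0 := by exact_mod_cast hr₀.ne'
  have he' : 1 + e ≠ 0 := fun h => he (by linear_combination h)
  rw [dNormal_transmissionField_inside _ _ _ _ hr₀, dNormal_transmissionField_outside _ _ _ _ hr₀,
    Finset.mul_sum, ← Finset.sum_neg_distrib, ← Finset.sum_sub_distrib]
  refine Finset.sum_congr rfl fun i _ => ?_
  have hki : (k i : ℂ) ≠ 0 := by exact_mod_cast hk i
  rw [outerAmp]
  field_simp
  ring

end Transmission

/-! ### The leading-order fields on the disk -/

noncomputable section

/-- The slope of the (uniform) leading-order fundamental field inside the disk. -/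
def innerSlope (m : Medium) (E : ℝ) : ℂ := -2 * E / (1 + m.epsOne)

/-- The leading-order fundamental potential: uniform inside, background plus dipole outside. -/
def leadingOne (m : Medium) (E r₀ : ℝ) : Potential where
  inside := modeSum (fun _ : Fin 1 => innerSlope m E) (fun _ => 1)
  outside := modeSum ![-(E : ℂ), r₀ ^ 2 * (innerSlope m E + E)] ![1, -1]

/-- The mean of `4π P_⊥` for the leading-order field; its `cos 2θ` coefficient is the same number. -/
def leadingJump (m : Medium) (E : ℝ) : ℂ :=
  2 * Real.pi * m.chiPerp * m.epsOne ^ 2 * innerSlope m E ^ 2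

/-- The `cos 2θ` coefficient of `-4πσ` for the leading-order field. -/
def leadingFlux (m : Medium) (E r₀ : ℝ) : ℂ :=
  -(8 * Real.pi / r₀) * m.chiPar * m.epsOne * innerSlope m E ^ 2

/-- The quadrupole part of the leading-order second-harmonic potential. -/
def leadingQuadrupole (m : Medium) (E r₀ : ℝ) : Potential :=
  transmissionField m.epsTwo r₀ (fun _ : Fin 1 => 2) (fun _ => leadingJump m E)
    (fun _ => leadingFlux m E r₀)

/-- The leading-order second-harmonic potential: a quadrupole and, inside, the constant that
balances the mean of `4π P_⊥`. -/
def leadingTwo (m : Medium) (E r₀ : ℝ) : Potential where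
  inside z := (leadingQuadrupole m E r₀).inside z - leadingJump m E
  outside := (leadingQuadrupole m E r₀).outside

end

theorem cosMode_one (z : ℂ) : cosMode 1 z = z.re := by simp [cosMode]

theorem cos_sq_add_sin_sq_cast (θ : ℝ) :
    (Real.cos θ : ℂ) ^ 2 + (Real.sin θ : ℂ) ^ 2 = 1 := by
  exact_mod_cast Real.cos_sq_add_sin_sq θ

theorem cos_two_mul_cast (θ : ℝ) :
    (Real.cos (2 * θ) : ℂ) = (Real.cos θ : ℂ) ^ 2 - (Real.sin θ : ℂ) ^ 2 := by
  rw [Real.cos_two_mul']; push_cast; rfl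

theorem sin_two_mul_cast (θ : ℝ) :
    (Real.sin (2 * θ) : ℂ) = 2 * (Real.sin θ : ℂ) * (Real.cos θ : ℂ) := by
  rw [Real.sin_two_mul]; push_cast; rfl

section Leading

variable (m : Medium) (E : ℝ) {r₀ : ℝ}

theorem innerSlope_mul (h_one : m.epsOne ≠ -1) :
    innerSlope m E * (1 + m.epsOne) = -2 * E := by
  have he' : 1 + m.epsOne ≠ 0 := fun h => h_one (by linear_combination h)
  rw [innerSlope]; field_simp

theorem dNormal_leadingOne_inside (hr₀ : 0 < r₀) (θ : ℝ) :
    dNormal (circleCurve r₀) (leadingOne m E r₀).inside θ = innerSlope m E * (Real.cos θ : ℂ) := by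
  simp only [leadingOne, dNormal_modeSum _ _ hr₀]
  simp

theorem dTangent_leadingOne_inside (hr₀ : 0 < r₀) (θ : ℝ) :
    dTangent (circleCurve r₀) (leadingOne m E r₀).inside θ
      = -(innerSlope m E * (Real.sin θ : ℂ)) := by
  simp only [leadingOne, dTangent_modeSum _ _ hr₀]
  simp

theorem dNormalNormal_leadingOne_inside (hr₀ : 0 < r₀) (θ : ℝ) :
    dNormalNormal r₀ (leadingOne m E r₀).inside θ = 0 := by
  simp only [leadingOne, dNormalNormal_modeSum _ _ hr₀]
  simp

theorem dNormalTangent_leadingOne_inside (hr₀ : 0 < r₀) (θ : ℝ) :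
    dNormalTangent r₀ (leadingOne m E r₀).inside θ = 0 := by
  simp only [leadingOne, dNormalTangent_modeSum _ _ hr₀]
  simp

theorem dNormal_leadingOne_outside (h_one : m.epsOne ≠ -1) (hr₀ : 0 < r₀) (θ : ℝ) :
    dNormal (circleCurve r₀) (leadingOne m E r₀).outside θ
      = m.epsOne * (innerSlope m E * (Real.cos θ : ℂ)) := by
  have hr : (r₀ : ℂ) ≠ 0 := by exact_mod_cast hr₀.ne'
  simp only [leadingOne, dNormal_modeSum _ _ hr₀, Fin.sum_univ_two]
  simp [zpow_neg]
  field_simp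
  linear_combination -(Complex.cos θ) * innerSlope_mul m E h_one

theorem dTangent_leadingOne_outside (hr₀ : 0 < r₀) (θ : ℝ) :
    dTangent (circleCurve r₀) (leadingOne m E r₀).outside θ
      = -(innerSlope m E * (Real.sin θ : ℂ)) := by
  have hr : (r₀ : ℂ) ≠ 0 := by exact_mod_cast hr₀.ne'
  simp only [leadingOne, dTangent_modeSum _ _ hr₀, Fin.sum_univ_two]
  simp [zpow_neg]
  field_simp
  ring

theorem dNormalNormal_leadingOne_outside (h_one : m.epsOne ≠ -1) (hr₀ : 0 < r₀) (θ : ℝ) :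
    dNormalNormal r₀ (leadingOne m E r₀).outside θ
      = innerSlope m E * (1 - m.epsOne) / r₀ * (Real.cos θ : ℂ) := by
  have hr : (r₀ : ℂ) ≠ 0 := by exact_mod_cast hr₀.ne'
  simp only [leadingOne, dNormalNormal_modeSum _ _ hr₀, Fin.sum_univ_two]
  simp
  norm_num
  field_simp
  linear_combination (Complex.cos θ) * innerSlope_mul m E h_one

theorem polPar_leadingOne (hr₀ : 0 < r₀) : polPar m (circleCurve r₀) (leadingOne m E r₀)
    = fun θ => -2 * m.chiPar * m.epsOne * innerSlope m E ^ 2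
      * ((Real.cos θ : ℂ) * (Real.sin θ : ℂ)) := by
  funext θ
  rw [polPar, dNormal_leadingOne_inside _ _ hr₀, dTangent_leadingOne_inside _ _ hr₀]
  ring

theorem hasDerivAt_cos_cast (k θ : ℝ) :
    HasDerivAt (fun t : ℝ => (Real.cos (k * t) : ℂ)) (-(k * (Real.sin (k * θ) : ℂ))) θ := by
  have h := (((hasDerivAt_id θ).const_mul k).cos).ofReal_comp
  convert! h using 1
  push_cast; simp; ring

theorem hasDerivAt_sin_cast (k θ : ℝ) :
    HasDerivAt (fun t : ℝ => (Real.sin (k * t) : ℂ)) (k * (Real.cos (k * θ) : ℂ)) θ := by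
  have h := (((hasDerivAt_id θ).const_mul k).sin).ofReal_comp
  convert! h using 1
  push_cast; simp; ring

theorem deriv_polPar_leadingOne (hr₀ : 0 < r₀) (θ : ℝ) :
    deriv (polPar m (circleCurve r₀) (leadingOne m E r₀)) θ
      = -2 * m.chiPar * m.epsOne * innerSlope m E ^ 2
        * ((Real.cos θ : ℂ) ^ 2 - (Real.sin θ : ℂ) ^ 2) := by
  have h1 := hasDerivAt_cos_cast 1 θ
  have h2 := hasDerivAt_sin_cast 1 θ
  simp only [one_mul, Complex.ofReal_one] at h1 h2
  rw [polPar_leadingOne m E hr₀, ((h1.fun_mul h2).const_mul _).deriv]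
  ring

theorem leadingOne_jump_and_decay (hr₀ : 0 < r₀) :
    IsPiecewiseHarmonic (Metric.ball 0 r₀) (leadingOne m E r₀) ∧
    (∀ t, (leadingOne m E r₀).outside (circleCurve r₀ t)
      = (leadingOne m E r₀).inside (circleCurve r₀ t)) ∧
    (fun z => (leadingOne m E r₀).outside z - uniformBackground E z)
      =O[cobounded ℂ] fun z => ‖z‖⁻¹ := by
  have hr : (r₀ : ℂ) ≠ 0 := by exact_mod_cast hr₀.ne'
  refine ⟨isPiecewiseHarmonic_modeSum hr₀ _ (fun _ => by norm_num) _ _, fun t => ?_, ?_⟩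
  · simp only [leadingOne, modeSum_circle, Fin.sum_univ_two]
    simp
    field_simp
    ring
  · have h : (fun z => (leadingOne m E r₀).outside z - uniformBackground E z)
        = modeSum (fun _ : Fin 1 => (r₀ : ℂ) ^ 2 * (innerSlope m E + E)) (fun _ => -1) := by
      funext z
      simp only [leadingOne, modeSum, uniformBackground, Fin.sum_univ_two, ← cosMode_one]
      simp
    rw [h]
    simpa using modeSum_isBigO (fun _ : Fin 1 => (r₀ : ℂ) ^ 2 * (innerSlope m E + E))
      (k := fun _ => -1) (m := 1) (fun _ => by norm_num)

theorem isPiecewiseHarmonic_leadingTwo (hr₀ : 0 < r₀) :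
    IsPiecewiseHarmonic (Metric.ball 0 r₀) (leadingTwo m E r₀) :=
  have h := isPiecewiseHarmonic_transmissionField m.epsTwo (fun _ : Fin 1 => 2)
    (fun _ => leadingJump m E) (fun _ => leadingFlux m E r₀) hr₀
  ⟨fun z hz => (h.inside_harmonic z hz).sub (harmonicAt_const _),
    fun z hz => (h.inside_regular z hz).sub contDiffAt_const, h.outside_harmonic,
    h.outside_regular⟩

theorem fderiv_leadingTwo_inside : fderiv ℝ (leadingTwo m E r₀).inside
    = fderiv ℝ (leadingQuadrupole m E r₀).inside := by
  funext z
  exact fderiv_sub_const (leadingJump m E)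

/-- Boundary data of the leading-order second-harmonic potential. -/
theorem leadingTwo_data (hr₀ : 0 < r₀) (θ : ℝ) {a : ℂ}
    (ha : a = outerAmp m.epsTwo r₀ 2 (leadingJump m E) (leadingFlux m E r₀)) :
    dNormal (circleCurve r₀) (leadingTwo m E r₀).inside θ
        = (a - leadingJump m E) * (2 / r₀ * (Real.cos (2 * θ) : ℂ)) ∧
      dTangent (circleCurve r₀) (leadingTwo m E r₀).inside θ
        = -((a - leadingJump m E) * (2 / r₀ * (Real.sin (2 * θ) : ℂ))) ∧
      dNormalNormal r₀ (leadingTwo m E r₀).inside θ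
        = (a - leadingJump m E) * (2 / r₀ ^ 2 * (Real.cos (2 * θ) : ℂ)) ∧
      dNormal (circleCurve r₀) (leadingTwo m E r₀).outside θ
        = -(a * (2 / r₀ * (Real.cos (2 * θ) : ℂ))) ∧
      dTangent (circleCurve r₀) (leadingTwo m E r₀).outside θ
        = -(a * (2 / r₀ * (Real.sin (2 * θ) : ℂ))) ∧
      dNormalNormal r₀ (leadingTwo m E r₀).outside θ
        = a * (6 / r₀ ^ 2 * (Real.cos (2 * θ) : ℂ)) := by
  subst ha
  have e1 := dNormal_transmissionField_inside m.epsTwo (fun _ : Fin 1 => 2)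
    (fun _ => leadingJump m E) (fun _ => leadingFlux m E r₀) hr₀ θ
  have e2 := dTangent_transmissionField_inside m.epsTwo (fun _ : Fin 1 => 2)
    (fun _ => leadingJump m E) (fun _ => leadingFlux m E r₀) hr₀ θ
  have e3 := dNormalNormal_transmissionField_inside m.epsTwo (fun _ : Fin 1 => 2)
    (fun _ => leadingJump m E) (fun _ => leadingFlux m E r₀) hr₀ θ
  have e4 := dNormal_transmissionField_outside m.epsTwo (fun _ : Fin 1 => 2)
    (fun _ => leadingJump m E) (fun _ => leadingFlux m E r₀) hr₀ θ
  have e5 := dTangent_transmissionField_outside m.epsTwo (fun _ : Fin 1 => 2)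
    (fun _ => leadingJump m E) (fun _ => leadingFlux m E r₀) hr₀ θ
  have e6 := dNormalNormal_transmissionField_outside m.epsTwo (fun _ : Fin 1 => 2)
    (fun _ => leadingJump m E) (fun _ => leadingFlux m E r₀) hr₀ θ
  simp only [Finset.univ_unique, Finset.sum_singleton, Nat.cast_ofNat] at e1 e2 e3 e4 e5 e6
  refine ⟨?_, ?_, ?_, e4, e5, e6.trans (by ring)⟩
  · rw [dNormal, fderiv_leadingTwo_inside]; exact e1
  · rw [dTangent, fderiv_leadingTwo_inside]; exact e2
  · rw [dNormalNormal, fderiv_leadingTwo_inside]; exact e3.trans (by ring)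

theorem leadingTwo_jump (hr₀ : 0 < r₀) (t : ℝ) :
    (leadingTwo m E r₀).outside (circleCurve r₀ t) - (leadingTwo m E r₀).inside (circleCurve r₀ t)
      = 4 * Real.pi * polPerp m (circleCurve r₀) (leadingOne m E r₀) t := by
  have h := transmissionField_jump m.epsTwo (fun _ : Fin 1 => 2)
    (fun _ => leadingJump m E) (fun _ => leadingFlux m E r₀) hr₀ t
  simp only [Finset.univ_unique, Finset.sum_singleton, Nat.cast_ofNat] at h
  simp only [leadingTwo, leadingQuadrupole]
  rw [polPerp, dNormal_leadingOne_inside m E hr₀, sub_sub_eq_add_sub, add_sub_right_comm, h,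
    leadingJump, cos_two_mul_cast]
  linear_combination (-2 * Real.pi * m.chiPerp * m.epsOne ^ 2 * innerSlope m E ^ 2) *
    cos_sq_add_sin_sq_cast t

theorem leadingTwo_flux (h_two : m.epsTwo ≠ -1) (hr₀ : 0 < r₀) (t : ℝ) :
    dNormal (circleCurve r₀) (leadingTwo m E r₀).outside t
      - m.epsTwo * dNormal (circleCurve r₀) (leadingTwo m E r₀).inside t
      = -4 * Real.pi * surfaceCharge m (circleCurve r₀) (leadingOne m E r₀) t := by
  have h := transmissionField_flux m.epsTwo (fun _ : Fin 1 => 2)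
    (fun _ => leadingJump m E) (fun _ => leadingFlux m E r₀) hr₀ h_two (fun _ => two_ne_zero) t
  simp only [Finset.univ_unique, Finset.sum_singleton, Nat.cast_ofNat] at h
  have h1 : dNormal (circleCurve r₀) (leadingTwo m E r₀).inside t
      = dNormal (circleCurve r₀) (leadingQuadrupole m E r₀).inside t := by
    rw [dNormal, fderiv_leadingTwo_inside, dNormal]
  rw [h1, leadingTwo, leadingQuadrupole, h, surfaceCharge, norm_deriv_circleCurve hr₀,
    deriv_polPar_leadingOne m E hr₀, leadingFlux, cos_two_mul_cast]
  ring

/-- The explicit fields solve the leading-order system. -/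
theorem isLeadingSolution_leading (h_one : m.epsOne ≠ -1) (h_two : m.epsTwo ≠ -1) (hr₀ : 0 < r₀) :
    IsLeadingSolution m (uniformBackground E) r₀ (leadingOne m E r₀) (leadingTwo m E r₀) := by
  obtain ⟨hu, hj, hinf⟩ := leadingOne_jump_and_decay m E hr₀
  have hdec : (leadingTwo m E r₀).outside =O[cobounded ℂ] fun z => (‖z‖ ^ 2)⁻¹ := by
    rw [leadingTwo, leadingQuadrupole]
    exact transmissionField_isBigO m.epsTwo (fun _ : Fin 1 => 2) (fun _ => leadingJump m E)
      (fun _ => leadingFlux m E r₀) (fun _ => le_refl 2)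
  refine ⟨⟨hu, hj, fun t => ?_, hinf, isPiecewiseHarmonic_leadingTwo m E hr₀,
    leadingTwo_jump m E hr₀, leadingTwo_flux m E h_two hr₀,
    hdec.trans_tendsto (tendsto_inv_norm_pow (m := 2) (by norm_num))⟩, hdec⟩
  rw [dNormal_leadingOne_outside m E h_one hr₀, dNormal_leadingOne_inside m E hr₀]

end Leading

/-! ### The first-order fields on the disk -/

noncomputable section

/-- The radial derivative at the circle of the inner branch of the first-order fundamental
potential is `firstSlope · cos ((n - 1) θ)`. -/
def firstSlope (m : Medium) (E : ℝ) (n : ℕ) : ℂ :=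
  -((n - 1) * innerSlope m E * (1 - m.epsOne) / (1 + m.epsOne))

/-- The first-order fundamental potential: multipoles of orders `n - 1` and `n + 1`. -/
def firstOne (m : Medium) (E r₀ : ℝ) (n : ℕ) : Potential :=
  transmissionField m.epsOne r₀ ![n - 1, n + 1]
    ![r₀ * innerSlope m E * (1 - m.epsOne) / 2, r₀ * innerSlope m E * (1 - m.epsOne) / 2]
    ![innerSlope m E * (1 - m.epsOne) / 2 * (n - 1),
      -(innerSlope m E * (1 - m.epsOne) / 2 * (n + 1))]

/-- Outer amplitude on the circle of the leading-order second-harmonic quadrupole. -/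
def quadrupoleAmp (m : Medium) (E r₀ : ℝ) : ℂ :=
  outerAmp m.epsTwo r₀ 2 (leadingJump m E) (leadingFlux m E r₀)

/-- The coefficients of `cos ((n - 2) θ)`, `cos (n θ)`, `cos ((n + 2) θ)` in the jump of the
first-order second-harmonic potential. -/
def secondJump (m : Medium) (E r₀ : ℝ) (n : ℕ) : Fin 3 → ℂ :=
  ![2 * quadrupoleAmp m E r₀ - leadingJump m E
      + 4 * Real.pi * m.chiPerp * m.epsOne ^ 2 * innerSlope m E
        * (firstSlope m E n - n * innerSlope m E / 2),
    4 * Real.pi * m.chiPerp * m.epsOne ^ 2 * innerSlope m E * firstSlope m E n,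
    2 * quadrupoleAmp m E r₀ - leadingJump m E
      + 4 * Real.pi * m.chiPerp * m.epsOne ^ 2 * innerSlope m E * (n * innerSlope m E / 2)]

/-- The coefficients of `cos ((n - 2) θ)`, `cos (n θ)`, `cos ((n + 2) θ)` in the flux jump of the
first-order second-harmonic potential. -/
def secondFlux (m : Medium) (E r₀ : ℝ) (n : ℕ) : Fin 3 → ℂ :=
  let a := quadrupoleAmp m E r₀
  let b := a - leadingJump m E
  let q := 4 * Real.pi * m.chiPar * m.epsOne * innerSlope m E / r₀
  ![(m.epsTwo * b - 3 * a + n * (a - m.epsTwo * b)) / r₀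
      + q * (innerSlope m E - n * innerSlope m E * (n - 2)),
    -(2 * q * n * firstSlope m E n),
    (m.epsTwo * b - 3 * a - n * (a - m.epsTwo * b)) / r₀
      + q * (innerSlope m E - n * innerSlope m E * (n + 2))]

/-- The first-order second-harmonic potential: multipoles of orders `n - 2`, `n` and `n + 2`. -/
def firstTwo (m : Medium) (E r₀ : ℝ) (n : ℕ) : Potential :=
  transmissionField m.epsTwo r₀ ![n - 2, n, n + 2] (secondJump m E r₀ n) (secondFlux m E r₀ n)

end

section Trigonometry

variable (n : ℕ) (θ : ℝ)

theorem cos_add_two_cast : (Real.cos ((n + 2 : ℕ) * θ) : ℂ)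
    = Real.cos (n * θ) * (Real.cos θ ^ 2 - Real.sin θ ^ 2)
      - Real.sin (n * θ) * (2 * Real.sin θ * Real.cos θ) := by
  rw [show ((n + 2 : ℕ) : ℝ) * θ = n * θ + 2 * θ by push_cast; ring, Real.cos_add,
    Real.sin_two_mul, Real.cos_two_mul']
  push_cast; ring

theorem cos_sub_two_cast (hn : 2 ≤ n) : (Real.cos ((n - 2 : ℕ) * θ) : ℂ)
    = Real.cos (n * θ) * (Real.cos θ ^ 2 - Real.sin θ ^ 2)
      + Real.sin (n * θ) * (2 * Real.sin θ * Real.cos θ) := by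
  rw [show ((n - 2 : ℕ) : ℝ) * θ = n * θ - 2 * θ by push_cast [Nat.cast_sub hn]; ring,
    Real.cos_sub, Real.sin_two_mul, Real.cos_two_mul']
  push_cast; ring

theorem cos_add_one_cast : (Real.cos ((n + 1 : ℕ) * θ) : ℂ)
    = Real.cos (n * θ) * Real.cos θ - Real.sin (n * θ) * Real.sin θ := by
  rw [show ((n + 1 : ℕ) : ℝ) * θ = n * θ + θ by push_cast; ring, Real.cos_add]
  push_cast; ring

theorem cos_sub_one_cast (hn : 1 ≤ n) : (Real.cos ((n - 1 : ℕ) * θ) : ℂ)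
    = Real.cos (n * θ) * Real.cos θ + Real.sin (n * θ) * Real.sin θ := by
  rw [show ((n - 1 : ℕ) : ℝ) * θ = n * θ - θ by push_cast [Nat.cast_sub hn]; ring, Real.cos_sub]
  push_cast; ring

theorem sin_sub_one_cast (hn : 1 ≤ n) : (Real.sin ((n - 1 : ℕ) * θ) : ℂ)
    = Real.sin (n * θ) * Real.cos θ - Real.cos (n * θ) * Real.sin θ := by
  rw [show ((n - 1 : ℕ) : ℝ) * θ = n * θ - θ by push_cast [Nat.cast_sub hn]; ring, Real.sin_sub]
  push_cast; ring

theorem cosProfile_cast (r₀ : ℝ) : (cosProfile r₀ n θ : ℂ) = r₀ * Real.cos (n * θ) := by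
  rw [cosProfile]; push_cast; rfl

theorem hasDerivAt_cosProfile (r₀ : ℝ) :
    HasDerivAt (cosProfile r₀ n) (r₀ * -(n * Real.sin (n * θ))) θ := by
  have h := (((hasDerivAt_id θ).const_mul (n : ℝ)).cos).const_mul r₀
  convert! h using 1
  simp only [id_eq, mul_one]; ring

theorem profileDeriv_cosProfile {r₀ : ℝ} (hr₀ : 0 < r₀) :
    (profileDeriv r₀ (cosProfile r₀ n) θ : ℂ) = -(n * Real.sin (n * θ)) := by
  rw [profileDeriv, (hasDerivAt_cosProfile n θ r₀).deriv, mul_div_cancel_left₀ _ hr₀.ne']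
  push_cast; rfl

end Trigonometry

section First

variable (m : Medium) (E : ℝ) {r₀ : ℝ} {n : ℕ}

/-- The inner amplitudes of the first-order fundamental potential; the one of order `n + 1`
vanishes. -/
theorem firstOne_innerAmp (h_one : m.epsOne ≠ -1) (hr₀ : 0 < r₀) (hn : 2 ≤ n) :
    (outerAmp m.epsOne r₀ (n - 1) (r₀ * innerSlope m E * (1 - m.epsOne) / 2)
      (innerSlope m E * (1 - m.epsOne) / 2 * (n - 1)) - r₀ * innerSlope m E * (1 - m.epsOne) / 2)
        * ((n - 1 : ℕ) / r₀) = firstSlope m E n ∧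
    outerAmp m.epsOne r₀ (n + 1) (r₀ * innerSlope m E * (1 - m.epsOne) / 2)
      (-(innerSlope m E * (1 - m.epsOne) / 2 * (n + 1))) = r₀ * innerSlope m E * (1 - m.epsOne) / 2
      := by
  have hr : (r₀ : ℂ) ≠ 0 := by exact_mod_cast hr₀.ne'
  have he' : 1 + m.epsOne ≠ 0 := fun h => h_one (by linear_combination h)
  have hn1 : ((n - 1 : ℕ) : ℂ) = n - 1 := by push_cast [Nat.cast_sub (by omega : 1 ≤ n)]; rfl
  have hn2 : (n : ℂ) - 1 ≠ 0 := by
    rw [← hn1]; exact_mod_cast (by omega : n - 1 ≠ 0)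
  have hn3 : (n : ℂ) + 1 ≠ 0 := by exact_mod_cast (by omega : n + 1 ≠ 0)
  constructor
  · rw [outerAmp, firstSlope, hn1]
    field_simp
    ring
  · rw [outerAmp]
    push_cast
    field_simp
    ring

theorem dNormal_firstOne_inside (h_one : m.epsOne ≠ -1) (hr₀ : 0 < r₀) (hn : 2 ≤ n) (θ : ℝ) :
    dNormal (circleCurve r₀) (firstOne m E r₀ n).inside θ = firstSlope m E n
      * (Real.cos (n * θ) * Real.cos θ + Real.sin (n * θ) * Real.sin θ) := by
  obtain ⟨h1, h2⟩ := firstOne_innerAmp m E h_one hr₀ hn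
  rw [firstOne, dNormal_transmissionField_inside _ _ _ _ hr₀]
  simp only [Fin.sum_univ_two, Matrix.cons_val_zero, Matrix.cons_val_one]
  rw [h2, cos_sub_one_cast n θ (by omega), ← mul_assoc, h1]
  ring

theorem dTangent_firstOne_inside (h_one : m.epsOne ≠ -1) (hr₀ : 0 < r₀) (hn : 2 ≤ n) (θ : ℝ) :
    dTangent (circleCurve r₀) (firstOne m E r₀ n).inside θ = -(firstSlope m E n
      * (Real.sin (n * θ) * Real.cos θ - Real.cos (n * θ) * Real.sin θ)) := by
  obtain ⟨h1, h2⟩ := firstOne_innerAmp m E h_one hr₀ hn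
  rw [firstOne, dTangent_transmissionField_inside _ _ _ _ hr₀]
  simp only [Fin.sum_univ_two, Matrix.cons_val_zero, Matrix.cons_val_one]
  rw [h2, sin_sub_one_cast n θ (by omega), ← mul_assoc, h1]
  ring

theorem normalVariation_explicit (h_one : m.epsOne ≠ -1) (hr₀ : 0 < r₀) (hn : 2 ≤ n) (θ : ℝ) :
    normalVariation r₀ (cosProfile r₀ n) (leadingOne m E r₀) (firstOne m E r₀ n) θ
      = firstSlope m E n * (Real.cos (n * θ) * Real.cos θ + Real.sin (n * θ) * Real.sin θ)
        - n * innerSlope m E * Real.sin (n * θ) * Real.sin θ := by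
  rw [normalVariation, dNormal_firstOne_inside m E h_one hr₀ hn,
    dNormalNormal_leadingOne_inside m E hr₀, dTangent_leadingOne_inside m E hr₀,
    profileDeriv_cosProfile n θ hr₀]
  ring

theorem tangentVariation_explicit (h_one : m.epsOne ≠ -1) (hr₀ : 0 < r₀) (hn : 2 ≤ n) (θ : ℝ) :
    tangentVariation r₀ (cosProfile r₀ n) (leadingOne m E r₀) (firstOne m E r₀ n) θ
      = -(firstSlope m E n * (Real.sin (n * θ) * Real.cos θ - Real.cos (n * θ) * Real.sin θ))
        - n * innerSlope m E * Real.sin (n * θ) * Real.cos θ := by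
  rw [tangentVariation, dTangent_firstOne_inside m E h_one hr₀ hn,
    dNormalTangent_leadingOne_inside m E hr₀, dNormal_leadingOne_inside m E hr₀,
    profileDeriv_cosProfile n θ hr₀]
  ring

theorem polParOne_explicit (h_one : m.epsOne ≠ -1) (hr₀ : 0 < r₀) (hn : 2 ≤ n) :
    polParOne m r₀ (cosProfile r₀ n) (leadingOne m E r₀) (firstOne m E r₀ n)
      = fun θ => -(2 * m.chiPar * m.epsOne * innerSlope m E) * (firstSlope m E n
        * Real.sin (n * θ) + n * innerSlope m E * (Real.sin (n * θ) * Real.cos (2 * θ))) := by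
  funext θ
  rw [polParOne, normalVariation_explicit m E h_one hr₀ hn,
    tangentVariation_explicit m E h_one hr₀ hn, dNormal_leadingOne_inside m E hr₀,
    dTangent_leadingOne_inside m E hr₀, cos_two_mul_cast]
  linear_combination (-(2 * m.chiPar * m.epsOne * innerSlope m E) * firstSlope m E n
        * Real.sin (n * θ)) * cos_sq_add_sin_sq_cast θ

theorem deriv_polParOne (h_one : m.epsOne ≠ -1) (hr₀ : 0 < r₀) (hn : 2 ≤ n) (θ : ℝ) :
    deriv (polParOne m r₀ (cosProfile r₀ n) (leadingOne m E r₀) (firstOne m E r₀ n)) θ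
      = -(2 * m.chiPar * m.epsOne * innerSlope m E) * (firstSlope m E n * (n * Real.cos (n * θ))
        + n * innerSlope m E * (n * Real.cos (n * θ) * Real.cos (2 * θ)
          - Real.sin (n * θ) * (2 * Real.sin (2 * θ)))) := by
  have h1 := hasDerivAt_sin_cast n θ
  have h2 := hasDerivAt_cos_cast 2 θ
  rw [polParOne_explicit m E h_one hr₀ hn, (((h1.const_mul _).fun_add
    ((h1.fun_mul h2).const_mul _)).const_mul _).deriv]
  push_cast; ring

/-- The explicit fields solve the first-order system. -/
theorem isFirstOrderSolution_first (h_one : m.epsOne ≠ -1) (h_two : m.epsTwo ≠ -1) (hr₀ : 0 < r₀)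
    (hn : 3 ≤ n) : IsFirstOrderSolution m r₀ (cosProfile r₀ n) (leadingOne m E r₀)
      (leadingTwo m E r₀) (firstOne m E r₀ n) (firstTwo m E r₀ n) := by
  have hr : (r₀ : ℂ) ≠ 0 := by exact_mod_cast hr₀.ne'
  have hk1 : ∀ i, 1 ≤ (![n - 1, n + 1] : Fin 2 → ℕ) i := by
    intro i; fin_cases i <;> (simp; try omega)
  have hk2 : ∀ i, 1 ≤ (![n - 2, n, n + 2] : Fin 3 → ℕ) i := by
    intro i; fin_cases i <;> simp <;> omega
  constructor
  · exact isPiecewiseHarmonic_transmissionField _ _ _ _ hr₀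
  · intro θ
    rw [firstOne, transmissionField_jump _ _ _ _ hr₀, jumpShift, cosProfile_cast,
      dNormal_leadingOne_inside m E hr₀, dNormal_leadingOne_outside m E h_one hr₀]
    simp only [Fin.sum_univ_two, Matrix.cons_val_zero, Matrix.cons_val_one]
    rw [cos_add_one_cast, cos_sub_one_cast n θ (by omega)]
    ring
  · intro θ
    rw [firstOne, transmissionField_flux _ _ _ _ hr₀ h_one
      (fun i => Nat.one_le_iff_ne_zero.1 (hk1 i)), fluxShift, cosProfile_cast,
      profileDeriv_cosProfile n θ hr₀,
      dNormalNormal_leadingOne_inside m E hr₀, dNormalNormal_leadingOne_outside m E h_one hr₀,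
      dTangent_leadingOne_inside m E hr₀, dTangent_leadingOne_outside m E hr₀]
    simp only [Fin.sum_univ_two, Matrix.cons_val_zero, Matrix.cons_val_one]
    rw [cos_add_one_cast, cos_sub_one_cast n θ (by omega)]
    field_simp
    ring
  · have h := transmissionField_isBigO (r₀ := r₀) m.epsOne ![n - 1, n + 1]
      ![r₀ * innerSlope m E * (1 - m.epsOne) / 2, r₀ * innerSlope m E * (1 - m.epsOne) / 2]
      ![innerSlope m E * (1 - m.epsOne) / 2 * (n - 1),
        -(innerSlope m E * (1 - m.epsOne) / 2 * (n + 1))] hk1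
    simp only [pow_one] at h
    exact h
  · exact isPiecewiseHarmonic_transmissionField _ _ _ _ hr₀
  · intro θ
    obtain ⟨d1, -, -, d4, -, -⟩ := leadingTwo_data m E hr₀ θ (a := quadrupoleAmp m E r₀) rfl
    rw [firstTwo, transmissionField_jump _ _ _ _ hr₀, jumpShift, cosProfile_cast, d1, d4,
      polPerpOne, normalVariation_explicit m E h_one hr₀ (by omega),
      dNormal_leadingOne_inside m E hr₀, cos_two_mul_cast]
    simp only [Fin.sum_univ_three, Matrix.cons_val_zero, Matrix.cons_val_one, Matrix.cons_val,
      secondJump]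
    rw [cos_add_two_cast, cos_sub_two_cast n θ (by omega)]
    have hcs := cos_sq_add_sin_sq_cast θ
    field_simp
    linear_combination (-8 * Real.pi * m.chiPerp * m.epsOne ^ 2 * innerSlope m E
      * firstSlope m E n * Real.cos (n * θ)) * hcs
  · intro θ
    obtain ⟨-, d2, d3, -, d5, d6⟩ := leadingTwo_data m E hr₀ θ (a := quadrupoleAmp m E r₀) rfl
    rw [firstTwo, transmissionField_flux _ _ _ _ hr₀ h_two
      (fun i => Nat.one_le_iff_ne_zero.1 (hk2 i)), fluxShift, cosProfile_cast,
      profileDeriv_cosProfile n θ hr₀, d2, d3, d5, d6,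
      surfaceChargeOne, cosProfile_cast, deriv_polParOne m E h_one hr₀ (by omega),
      deriv_polPar_leadingOne m E hr₀, cos_two_mul_cast, sin_two_mul_cast]
    simp only [Fin.sum_univ_three, Matrix.cons_val_zero, Matrix.cons_val_one, Matrix.cons_val,
      secondFlux]
    rw [cos_add_two_cast, cos_sub_two_cast n θ (by omega)]
    have hcs := cos_sq_add_sin_sq_cast θ
    field_simp
    ring
  · exact (transmissionField_isBigO m.epsTwo ![n - 2, n, n + 2] _ _ hk2).trans_tendsto
      (tendsto_inv_norm_pow one_ne_zero)

/-- The outer amplitudes of the first-order second-harmonic potential are the coefficients `M_{n-2}`,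
`M_n` and `M_{n+2}`. -/
theorem firstTwo_outerAmp (h_one : m.epsOne ≠ -1) (h_two : m.epsTwo ≠ -1) (hr₀ : 0 < r₀)
    (hn : 3 ≤ n) :
    outerAmp m.epsTwo r₀ (n - 2) (secondJump m E r₀ n 0) (secondFlux m E r₀ n 0) * r₀ ^ (n - 2)
      = coeffLow m E r₀ n ∧
    outerAmp m.epsTwo r₀ n (secondJump m E r₀ n 1) (secondFlux m E r₀ n 1) * r₀ ^ n
      = coeffMid m E r₀ n ∧
    outerAmp m.epsTwo r₀ (n + 2) (secondJump m E r₀ n 2) (secondFlux m E r₀ n 2) * r₀ ^ (n + 2)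
      = coeffHigh m E r₀ n := by
  have hr : (r₀ : ℂ) ≠ 0 := by exact_mod_cast hr₀.ne'
  have he1 : 1 + m.epsOne ≠ 0 := fun h => h_one (by linear_combination h)
  have he2 : 1 + m.epsTwo ≠ 0 := fun h => h_two (by linear_combination h)
  have hn1 : ((n - 2 : ℕ) : ℂ) = n - 2 := by push_cast [Nat.cast_sub (by omega : 2 ≤ n)]; rfl
  have hn2 : (n : ℂ) - 2 ≠ 0 := by
    rw [← hn1]; exact_mod_cast (by omega : n - 2 ≠ 0)
  have hn3 : (n : ℂ) + 2 ≠ 0 := by exact_mod_cast (by omega : n + 2 ≠ 0)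
  have hn4 : (n : ℂ) ≠ 0 := by exact_mod_cast (by omega : n ≠ 0)
  refine ⟨?_, ?_, ?_⟩
  · simp only [secondJump, secondFlux, Matrix.cons_val_zero]
    rw [coeffLow]
    congr 1
    rw [outerAmp, hn1]
    simp only [firstSlope, quadrupoleAmp, outerAmp, leadingJump, leadingFlux, innerSlope]
    push_cast
    field_simp
    ring
  · simp only [secondJump, secondFlux, Matrix.cons_val_one, Matrix.cons_val_zero]
    rw [coeffMid]
    congr 1
    rw [outerAmp]
    simp only [firstSlope, innerSlope]
    field_simp
    ring
  · simp only [secondJump, secondFlux, Matrix.cons_val]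
    rw [coeffHigh]
    congr 1
    rw [outerAmp]
    simp only [quadrupoleAmp, outerAmp, leadingJump, leadingFlux, innerSlope]
    push_cast
    field_simp
    ring

end First

/-! ### Uniqueness of the leading- and first-order fields -/

theorem tendsto_inv_norm : Tendsto (fun z : ℂ => ‖z‖⁻¹) (cobounded ℂ) (𝓝 0) := by
  simpa using tendsto_inv_norm_pow one_ne_zero

section Unique

variable {m : Medium} {E r₀ : ℝ} {n : ℕ} {u₀ v₀ u₁ v₁ : Potential}

theorem eq_leadingOne (h_one : m.epsOne ≠ -1) (hr₀ : 0 < r₀)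
    (h : IsGoverningSolution m (uniformBackground E) (Metric.ball 0 r₀) (circleCurve r₀) u₀ v₀) :
    (∀ z, ‖z‖ ≤ r₀ → u₀.inside z = (leadingOne m E r₀).inside z) ∧
      ∀ z, r₀ ≤ ‖z‖ → u₀.outside z = (leadingOne m E r₀).outside z := by
  obtain ⟨hu, hj, hinf⟩ := leadingOne_jump_and_decay m E hr₀
  refine transmission_unique hr₀ h_one h.u_harmonic hu (fun t => ?_) (fun t => ?_) ?_
  · rw [h.u_jump, hj, sub_self, sub_self]
  · rw [h.u_flux, dNormal_leadingOne_outside m E h_one hr₀, dNormal_leadingOne_inside m E hr₀,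
      sub_self, sub_self]
  · have := (h.u_infinity.sub hinf).trans_tendsto tendsto_inv_norm
    simpa using this

theorem eq_leadingTwo (h_one : m.epsOne ≠ -1) (h_two : m.epsTwo ≠ -1) (hr₀ : 0 < r₀)
    (h : IsGoverningSolution m (uniformBackground E) (Metric.ball 0 r₀) (circleCurve r₀) u₀ v₀) :
    (∀ z, ‖z‖ ≤ r₀ → v₀.inside z = (leadingTwo m E r₀).inside z) ∧
      ∀ z, r₀ ≤ ‖z‖ → v₀.outside z = (leadingTwo m E r₀).outside z := by
  have hs := (isLeadingSolution_leading m E h_one h_two hr₀).governing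
  have hd := fun θ => (fderiv_inside_eq hr₀ h.u_harmonic hs.u_harmonic
    (eq_leadingOne h_one hr₀ h).1 θ).1
  have hperp : polPerp m (circleCurve r₀) u₀ = polPerp m (circleCurve r₀) (leadingOne m E r₀) := by
    funext θ; simp only [polPerp, dNormal, hd]
  have hpar : polPar m (circleCurve r₀) u₀ = polPar m (circleCurve r₀) (leadingOne m E r₀) := by
    funext θ; simp only [polPar, dNormal, dTangent, hd]
  refine transmission_unique hr₀ h_two h.v_harmonic hs.v_harmonic (fun t => ?_) (fun t => ?_) ?_
  · rw [h.v_jump, hs.v_jump, hperp]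
  · rw [h.v_flux, hs.v_flux, surfaceCharge, surfaceCharge, hpar]
  · simpa using h.v_infinity.sub hs.v_infinity

/-- A solution of the governing equations on the disk solves the leading-order system: the decay
of the second-harmonic potential is automatic. -/
theorem isLeadingSolution_of_governing (h_one : m.epsOne ≠ -1) (h_two : m.epsTwo ≠ -1)
    (hr₀ : 0 < r₀)
    (h : IsGoverningSolution m (uniformBackground E) (Metric.ball 0 r₀) (circleCurve r₀) u₀ v₀) :
    IsLeadingSolution m (uniformBackground E) r₀ u₀ v₀ := by
  refine ⟨h, (isLeadingSolution_leading m E h_one h_two hr₀).v_decay.congr' ?_ EventuallyEq.rfl⟩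
  filter_upwards [tendsto_norm_cobounded_atTop.eventually_ge_atTop r₀] with z hz
  exact ((eq_leadingTwo h_one h_two hr₀ h).2 z hz).symm

/-- Outside the disk the first-order second-harmonic potential is the explicit one.  The data of the
first-order system only contain derivatives of the leading-order fields on the circle, which are
those of the explicit fields by uniqueness in the leading-order system. -/
theorem eq_firstTwo (h_one : m.epsOne ≠ -1) (h_two : m.epsTwo ≠ -1) (hr₀ : 0 < r₀) (hn : 3 ≤ n)
    (h : IsGoverningSolution m (uniformBackground E) (Metric.ball 0 r₀) (circleCurve r₀) u₀ v₀)
    (h' : IsFirstOrderSolution m r₀ (cosProfile r₀ n) u₀ v₀ u₁ v₁) :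
    ∀ z, r₀ ≤ ‖z‖ → v₁.outside z = (firstTwo m E r₀ n).outside z := by
  have hs := (isLeadingSolution_leading m E h_one h_two hr₀).governing
  have hs' := isFirstOrderSolution_first m E h_one h_two hr₀ hn
  obtain ⟨hui, huo⟩ := eq_leadingOne h_one hr₀ h
  obtain ⟨hvi, hvo⟩ := eq_leadingTwo h_one h_two hr₀ h
  have dui := fderiv_inside_eq hr₀ h.u_harmonic hs.u_harmonic hui
  have duo := fderiv_outside_eq hr₀ h.u_harmonic hs.u_harmonic huo
  have dvi := fderiv_inside_eq hr₀ h.v_harmonic hs.v_harmonic hvi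
  have dvo := fderiv_outside_eq hr₀ h.v_harmonic hs.v_harmonic hvo
  have hu₁ := transmission_unique hr₀ h_one h'.u_harmonic hs'.u_harmonic
    (fun t => by
      rw [h'.u_jump, hs'.u_jump]
      simp only [jumpShift, dNormal, (dui _).1, (duo _).1])
    (fun t => by
      rw [h'.u_flux, hs'.u_flux]
      simp only [fluxShift, dNormalNormal, dTangent, (dui _).1, (duo _).1, (dui _).2, (duo _).2])
    (by simpa using (h'.u_infinity.sub hs'.u_infinity).trans_tendsto tendsto_inv_norm)
  have du₁ := fderiv_inside_eq hr₀ h'.u_harmonic hs'.u_harmonic hu₁.1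
  have hnv : normalVariation r₀ (cosProfile r₀ n) u₀ u₁
      = normalVariation r₀ (cosProfile r₀ n) (leadingOne m E r₀) (firstOne m E r₀ n) := by
    funext θ
    simp only [normalVariation, dNormal, dTangent, dNormalNormal, (dui _).1, (dui _).2, (du₁ _).1]
  have htv : tangentVariation r₀ (cosProfile r₀ n) u₀ u₁
      = tangentVariation r₀ (cosProfile r₀ n) (leadingOne m E r₀) (firstOne m E r₀ n) := by
    funext θ
    simp only [tangentVariation, dNormal, dTangent, dNormalTangent, (dui _).1, (dui _).2,
      (du₁ _).1]
  have hpar : polPar m (circleCurve r₀) u₀ = polPar m (circleCurve r₀) (leadingOne m E r₀) := by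
    funext θ; simp only [polPar, dNormal, dTangent, (dui _).1]
  have hpar₁ : polParOne m r₀ (cosProfile r₀ n) u₀ u₁
      = polParOne m r₀ (cosProfile r₀ n) (leadingOne m E r₀) (firstOne m E r₀ n) := by
    funext θ; simp only [polParOne, dNormal, dTangent, (dui _).1, hnv, htv]
  refine (transmission_unique hr₀ h_two h'.v_harmonic hs'.v_harmonic (fun t => ?_) (fun t => ?_)
    (by simpa using h'.v_infinity.sub hs'.v_infinity)).2
  · rw [h'.v_jump, hs'.v_jump]
    simp only [jumpShift, polPerpOne, dNormal, (dvi _).1, (dvo _).1, (dui _).1, hnv]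
  · rw [h'.v_flux, hs'.v_flux]
    simp only [fluxShift, surfaceChargeOne, dNormalNormal, dTangent, (dvi _).1, (dvo _).1,
      (dvi _).2, (dvo _).2, hpar, hpar₁]

end Unique

/-! ### Multipole radiation of the first-order second-harmonic field -/

/-- A field whose leading multipole at infinity is `A Re z ^ (-k)` decays faster than
that multipole exactly when `A = 0`. -/
theorem isBigO_succ_iff_coeff_eq_zero {w : ℂ → ℂ} {A : ℂ} {k : ℕ}
    (h : (fun z => w z - A * cosMode (-k) z) =O[cobounded ℂ] fun z => (‖z‖ ^ (k + 1))⁻¹) :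
    (w =O[cobounded ℂ] fun z => (‖z‖ ^ (k + 1))⁻¹) ↔ A = 0 := by
  constructor
  · intro hw
    have h1 : (fun z => A * cosMode (-k) z) =O[cobounded ℂ] fun z => (‖z‖ ^ (k + 1))⁻¹ := by
      simpa using hw.sub h
    have ht : Tendsto (fun r : ℝ => (r : ℂ)) atTop (cobounded ℂ) := by
      rw [← tendsto_norm_atTop_iff_cobounded]
      exact (tendsto_norm_atTop_atTop).congr fun r => (Complex.norm_real r).symm
    obtain ⟨C, hC⟩ := h1.bound
    by_contra hA
    -- on the positive real axis the multipole is exactly `A r ^ (-k)`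
    have hA' : 0 < ‖A‖ := norm_pos_iff.2 hA
    obtain ⟨r, ⟨hr1, hr2⟩, hr3⟩ := (((ht.eventually hC).and (eventually_gt_atTop 0)).and
      (eventually_gt_atTop (C / ‖A‖))).exists
    have h2 : ‖cosMode (-k) (r : ℂ)‖ = (r ^ k)⁻¹ := by
      rw [cosMode, ← Complex.ofReal_zpow, Complex.ofReal_re]
      simp [abs_of_pos hr2]
    rw [norm_mul, h2, norm_inv, norm_pow, norm_norm, Complex.norm_real,
      Real.norm_of_nonneg hr2.le, pow_succ] at hr1
    rw [div_lt_iff₀ hA'] at hr3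
    have h3 : ‖A‖ * (r ^ k)⁻¹ * (r ^ k * r) ≤ C * (r ^ k * r)⁻¹ * (r ^ k * r) :=
      mul_le_mul_of_nonneg_right hr1 (by positivity)
    have h4 : ‖A‖ * (r ^ k)⁻¹ * (r ^ k * r) = ‖A‖ * r := by field_simp
    have h5 : C * (r ^ k * r)⁻¹ * (r ^ k * r) = C := by field_simp
    rw [h4, h5] at h3
    linarith
  · rintro rfl
    simpa using h

section Radiation

variable {m : Medium} {E r₀ : ℝ} {n : ℕ}

theorem firstTwo_outside_eq (h_one : m.epsOne ≠ -1) (h_two : m.epsTwo ≠ -1) (hr₀ : 0 < r₀)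
    (hn : 3 ≤ n) (z : ℂ) :
    (firstTwo m E r₀ n).outside z = coeffLow m E r₀ n * cosMode (-(n - 2 : ℕ)) z
      + modeSum ![coeffMid m E r₀ n, coeffHigh m E r₀ n] ![-(n : ℤ), -((n + 2 : ℕ) : ℤ)] z := by
  obtain ⟨h1, h2, h3⟩ := firstTwo_outerAmp m E h_one h_two hr₀ hn
  simp only [firstTwo, transmissionField, modeSum, Fin.sum_univ_three, Fin.sum_univ_two,
    Matrix.cons_val_zero, Matrix.cons_val_one, Matrix.cons_val, h1, h2, h3]
  ring

theorem firstTwo_outside_polar (h_one : m.epsOne ≠ -1) (h_two : m.epsTwo ≠ -1) (hr₀ : 0 < r₀)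
    (hn : 3 ≤ n) (r θ : ℝ) :
    (firstTwo m E r₀ n).outside (r * Complex.exp (θ * Complex.I)) =
      coeffLow m E r₀ n * (1 / r ^ (n - 2)) * Real.cos ((n - 2) * θ)
      + coeffMid m E r₀ n * (1 / r ^ n) * Real.cos (n * θ)
      + coeffHigh m E r₀ n * (1 / r ^ (n + 2)) * Real.cos ((n + 2) * θ) := by
  obtain ⟨h1, h2, h3⟩ := firstTwo_outerAmp m E h_one h_two hr₀ hn
  have hn1 : ((n - 2 : ℕ) : ℝ) = n - 2 := by push_cast [Nat.cast_sub (by omega : 2 ≤ n)]; rfl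
  have hn2 : ((n + 2 : ℕ) : ℝ) = n + 2 := by push_cast; rfl
  rw [firstTwo, transmissionField_outside_polar]
  simp only [Fin.sum_univ_three, Matrix.cons_val_zero, Matrix.cons_val_one, Matrix.cons_val, h1,
    h2, h3, hn1, hn2]

theorem firstTwo_sub_low_isBigO (h_one : m.epsOne ≠ -1) (h_two : m.epsTwo ≠ -1) (hr₀ : 0 < r₀)
    (hn : 3 ≤ n) :
    (fun z => (firstTwo m E r₀ n).outside z - coeffLow m E r₀ n * cosMode (-(n - 2 : ℕ)) z)
      =O[cobounded ℂ] fun z => (‖z‖ ^ (n - 2 + 1))⁻¹ := by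
  simp only [firstTwo_outside_eq h_one h_two hr₀ hn, add_sub_cancel_left]
  refine modeSum_isBigO _ fun i => ?_
  fin_cases i
  · simp; omega
  · simp; omega

theorem firstTwo_isBigO : (firstTwo m E r₀ n).outside
    =O[cobounded ℂ] fun z => (‖z‖ ^ (n - 2))⁻¹ := by
  refine transmissionField_isBigO m.epsTwo ![n - 2, n, n + 2] _ _ fun i => ?_
  fin_cases i
  · simp
  · simp
  · simp; omega

end Radiation

/-! ### First-order expansions that are uniform along the boundary -/

section Expansion

variable {F G H : Type*} [NormedAddCommGroup F] [NormedSpace ℝ F] [NormedAddCommGroup G]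
  [NormedSpace ℝ G] [NormedAddCommGroup H] [NormedSpace ℝ H]

/-- `g ε θ = g₀ θ + ε g₁ θ + O(ε²)` as `ε → 0⁺`, uniformly in `θ`, with bounded coefficients. -/
structure HasUniformExpansion (g : ℝ → ℝ → F) (g₀ g₁ : ℝ → F) : Prop where
  bdd_zero : ∃ C, ∀ θ, ‖g₀ θ‖ ≤ C
  bdd_one : ∃ C, ∀ θ, ‖g₁ θ‖ ≤ C
  remainder : ∃ C, ∀ᶠ ε in 𝓝[>] (0 : ℝ), ∀ θ, ‖g ε θ - g₀ θ - ε • g₁ θ‖ ≤ C * ε ^ 2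

namespace HasUniformExpansion

variable {g g' : ℝ → ℝ → F} {g₀ g₁ g₀' g₁' : ℝ → F} {h : ℝ → ℝ → G} {h₀ h₁ : ℝ → G}

theorem congr (hg : HasUniformExpansion g g₀ g₁) (heq : ∀ᶠ ε in 𝓝[>] (0 : ℝ), ∀ θ, g' ε θ = g ε θ)
    (h0 : ∀ θ, g₀' θ = g₀ θ) (h1 : ∀ θ, g₁' θ = g₁ θ) : HasUniformExpansion g' g₀' g₁' := by
  obtain rfl : g₀' = g₀ := funext h0
  obtain rfl : g₁' = g₁ := funext h1
  obtain ⟨C, hC⟩ := hg.remainder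
  refine ⟨hg.bdd_zero, hg.bdd_one, C, ?_⟩
  filter_upwards [hC, heq] with ε h1 h2 θ
  rw [h2]; exact h1 θ

theorem of_exact (b0 : ∃ C, ∀ θ, ‖g₀ θ‖ ≤ C) (b1 : ∃ C, ∀ θ, ‖g₁ θ‖ ≤ C) :
    HasUniformExpansion (fun ε θ => g₀ θ + ε • g₁ θ) g₀ g₁ :=
  ⟨b0, b1, 0, Filter.Eventually.of_forall fun ε θ => by simp⟩

theorem bounded (hg : HasUniformExpansion g g₀ g₁) :
    ∃ C, 0 ≤ C ∧ ∀ᶠ ε in 𝓝[>] (0 : ℝ), ∀ θ, ‖g ε θ‖ ≤ C := by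
  obtain ⟨A, hA⟩ := hg.bdd_zero
  obtain ⟨B, hB⟩ := hg.bdd_one
  obtain ⟨C, hC⟩ := hg.remainder
  have hA0 : 0 ≤ A := (norm_nonneg _).trans (hA 0)
  have hB0 : 0 ≤ B := (norm_nonneg _).trans (hB 0)
  refine ⟨|C| + A + B, by positivity, ?_⟩
  filter_upwards [hC, Ioo_mem_nhdsGT (zero_lt_one (α := ℝ))] with ε h1 h2 θ
  have h3 : g ε θ = (g ε θ - g₀ θ - ε • g₁ θ) + g₀ θ + ε • g₁ θ := by abel
  have h4 : C * ε ^ 2 ≤ |C| := by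
    calc C * ε ^ 2 ≤ |C| * 1 := mul_le_mul (le_abs_self C) (by nlinarith [h2.1, h2.2])
          (sq_nonneg ε) (abs_nonneg C)
      _ = |C| := mul_one _
  have h5 : ‖ε • g₁ θ‖ ≤ B := by
    rw [norm_smul, Real.norm_of_nonneg h2.1.le]
    calc ε * ‖g₁ θ‖ ≤ 1 * B := mul_le_mul h2.2.le (hB θ) (norm_nonneg _) zero_le_one
      _ = B := one_mul _
  rw [h3]
  exact (norm_add₃_le).trans (add_le_add_three ((h1 θ).trans h4) (hA θ) h5)

theorem bilinear (B : F →L[ℝ] G →L[ℝ] H) (hg : HasUniformExpansion g g₀ g₁)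
    (hh : HasUniformExpansion h h₀ h₁) :
    HasUniformExpansion (fun ε θ => B (g ε θ) (h ε θ)) (fun θ => B (g₀ θ) (h₀ θ))
      (fun θ => B (g₀ θ) (h₁ θ) + B (g₁ θ) (h₀ θ)) := by
  obtain ⟨a0, ha0⟩ := hg.bdd_zero
  obtain ⟨a1, ha1⟩ := hg.bdd_one
  obtain ⟨b0, hb0⟩ := hh.bdd_zero
  obtain ⟨b1, hb1⟩ := hh.bdd_one
  obtain ⟨C, hC⟩ := hg.remainder
  obtain ⟨D, hD⟩ := hh.remainder
  obtain ⟨M, hM0, hM⟩ := hh.bounded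
  have p0 : 0 ≤ a0 := (norm_nonneg _).trans (ha0 0)
  have p1 : 0 ≤ a1 := (norm_nonneg _).trans (ha1 0)
  have q0 : 0 ≤ b0 := (norm_nonneg _).trans (hb0 0)
  have q1 : 0 ≤ b1 := (norm_nonneg _).trans (hb1 0)
  have hB : ∀ x y {X Y : ℝ}, ‖x‖ ≤ X → ‖y‖ ≤ Y → ‖B x y‖ ≤ ‖B‖ * X * Y := by
    intro x y X Y hx hy
    have hX : 0 ≤ X := (norm_nonneg x).trans hx
    refine (B.le_opNorm₂ x y).trans ?_
    gcongr
  refine ⟨⟨_, fun θ => hB _ _ (ha0 θ) (hb0 θ)⟩, ⟨_, fun θ => (norm_add_le _ _).trans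
    (add_le_add (hB _ _ (ha0 θ) (hb1 θ)) (hB _ _ (ha1 θ) (hb0 θ)))⟩,
    ‖B‖ * C * M + ‖B‖ * (a0 + a1) * D + ‖B‖ * a1 * b1, ?_⟩
  filter_upwards [hC, hD, hM, Ioo_mem_nhdsGT (zero_lt_one (α := ℝ))] with ε e1 e2 e3 e4 θ
  have h3 : B (g ε θ) (h ε θ) - B (g₀ θ) (h₀ θ) - ε • (B (g₀ θ) (h₁ θ) + B (g₁ θ) (h₀ θ))
      = B (g ε θ - g₀ θ - ε • g₁ θ) (h ε θ) + B (g₀ θ + ε • g₁ θ) (h ε θ - h₀ θ - ε • h₁ θ)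
        + (ε ^ 2) • B (g₁ θ) (h₁ θ) := by
    simp only [map_sub, map_add, map_smul, sub_apply, add_apply, smul_apply]
    module
  have h4 : ‖g₀ θ + ε • g₁ θ‖ ≤ a0 + a1 := by
    refine (norm_add_le _ _).trans (add_le_add (ha0 θ) ?_)
    rw [norm_smul, Real.norm_of_nonneg e4.1.le]
    calc ε * ‖g₁ θ‖ ≤ 1 * a1 := mul_le_mul e4.2.le (ha1 θ) (norm_nonneg _) zero_le_one
      _ = a1 := one_mul _
  rw [h3]
  refine (norm_add₃_le).trans ?_
  have h5 := hB _ _ (e1 θ) (e3 θ)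
  have h6 := hB _ _ h4 (e2 θ)
  have h7 : ‖(ε ^ 2) • B (g₁ θ) (h₁ θ)‖ ≤ ε ^ 2 * (‖B‖ * a1 * b1) := by
    rw [norm_smul, Real.norm_of_nonneg (sq_nonneg ε)]
    exact mul_le_mul_of_nonneg_left (hB _ _ (ha1 θ) (hb1 θ)) (sq_nonneg ε)
  calc _ ≤ _ := add_le_add_three h5 h6 h7
    _ = _ := by ring

theorem const {c : ℝ → F} (hc : ∃ C, ∀ θ, ‖c θ‖ ≤ C) :
    HasUniformExpansion (fun _ θ => c θ) c fun _ => 0 :=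
  ⟨hc, ⟨0, by simp⟩, 0, Filter.Eventually.of_forall fun ε θ => by simp⟩

theorem sub (hg : HasUniformExpansion g g₀ g₁) (hg' : HasUniformExpansion g' g₀' g₁') :
    HasUniformExpansion (fun ε θ => g ε θ - g' ε θ) (fun θ => g₀ θ - g₀' θ)
      (fun θ => g₁ θ - g₁' θ) := by
  obtain ⟨a0, ha0⟩ := hg.bdd_zero
  obtain ⟨a1, ha1⟩ := hg.bdd_one
  obtain ⟨b0, hb0⟩ := hg'.bdd_zero
  obtain ⟨b1, hb1⟩ := hg'.bdd_one
  obtain ⟨C, hC⟩ := hg.remainder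
  obtain ⟨D, hD⟩ := hg'.remainder
  refine ⟨⟨_, fun θ => (norm_sub_le _ _).trans (add_le_add (ha0 θ) (hb0 θ))⟩,
    ⟨_, fun θ => (norm_sub_le _ _).trans (add_le_add (ha1 θ) (hb1 θ))⟩, C + D, ?_⟩
  filter_upwards [hC, hD] with ε e1 e2 θ
  have h3 : g ε θ - g' ε θ - (g₀ θ - g₀' θ) - ε • (g₁ θ - g₁' θ)
      = (g ε θ - g₀ θ - ε • g₁ θ) - (g' ε θ - g₀' θ - ε • g₁' θ) := by
    rw [smul_sub]; abel
  rw [h3, add_mul]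
  exact (norm_sub_le _ _).trans (add_le_add (e1 θ) (e2 θ))

theorem const_mul {g : ℝ → ℝ → ℂ} {g₀ g₁ : ℝ → ℂ} (c : ℂ) (hg : HasUniformExpansion g g₀ g₁) :
    HasUniformExpansion (fun ε θ => c * g ε θ) (fun θ => c * g₀ θ) (fun θ => c * g₁ θ) :=
  ((const (c := fun _ => c) ⟨‖c‖, fun _ => le_rfl⟩).bilinear (ContinuousLinearMap.mul ℝ ℂ) hg).congr
    (Filter.Eventually.of_forall fun _ _ => rfl) (fun _ => rfl) fun _ => by simp

theorem mul {g h : ℝ → ℝ → ℂ} {g₀ g₁ h₀ h₁ : ℝ → ℂ} (hg : HasUniformExpansion g g₀ g₁)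
    (hh : HasUniformExpansion h h₀ h₁) :
    HasUniformExpansion (fun ε θ => g ε θ * h ε θ) (fun θ => g₀ θ * h₀ θ)
      (fun θ => g₀ θ * h₁ θ + g₁ θ * h₀ θ) :=
  hg.bilinear (ContinuousLinearMap.mul ℝ ℂ) hh

/-- Evaluation of linear maps with an expansion at vectors with an expansion. -/
theorem clm_apply {L : ℝ → ℝ → F →L[ℝ] G} {L₀ L₁ : ℝ → F →L[ℝ] G} (hL : HasUniformExpansion L L₀ L₁)
    (hg : HasUniformExpansion g g₀ g₁) :
    HasUniformExpansion (fun ε θ => L ε θ (g ε θ)) (fun θ => L₀ θ (g₀ θ))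
      (fun θ => L₀ θ (g₁ θ) + L₁ θ (g₀ θ)) :=
  hL.bilinear (ContinuousLinearMap.id ℝ (F →L[ℝ] G)) hg

theorem tendstoUniformly (hg : HasUniformExpansion g g₀ g₁) :
    TendstoUniformly g g₀ (𝓝[>] (0 : ℝ)) := by
  obtain ⟨B, hB⟩ := hg.bdd_one
  obtain ⟨C, hC⟩ := hg.remainder
  rw [Metric.tendstoUniformly_iff]
  intro e he
  have ht : Tendsto (fun ε : ℝ => C * ε ^ 2 + ε * B) (𝓝[>] 0) (𝓝 0) := by
    have : Continuous fun ε : ℝ => C * ε ^ 2 + ε * B := by fun_prop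
    simpa using (this.tendsto 0).mono_left nhdsWithin_le_nhds
  filter_upwards [hC, ht.eventually_lt_const he, self_mem_nhdsWithin] with ε e1 e2 e3 θ
  rw [dist_comm, dist_eq_norm]
  have h3 : g ε θ - g₀ θ = (g ε θ - g₀ θ - ε • g₁ θ) + ε • g₁ θ := by abel
  have h4 : ‖ε • g₁ θ‖ ≤ ε * B := by
    rw [norm_smul, Real.norm_of_nonneg (le_of_lt e3)]
    exact mul_le_mul_of_nonneg_left (hB θ) (le_of_lt e3)
  rw [h3]
  exact ((norm_add_le _ _).trans (add_le_add (e1 θ) h4)).trans_lt e2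

theorem tendstoUniformly_quotient (hg : HasUniformExpansion g g₀ g₁) :
    TendstoUniformly (fun ε θ => ε⁻¹ • (g ε θ - g₀ θ)) g₁ (𝓝[>] (0 : ℝ)) := by
  obtain ⟨C, hC⟩ := hg.remainder
  rw [Metric.tendstoUniformly_iff]
  intro e he
  have ht : Tendsto (fun ε : ℝ => C * ε) (𝓝[>] 0) (𝓝 0) := by
    have : Continuous fun ε : ℝ => C * ε := by fun_prop
    simpa using (this.tendsto 0).mono_left nhdsWithin_le_nhds
  filter_upwards [hC, ht.eventually_lt_const he, self_mem_nhdsWithin] with ε e1 e2 e3 θ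
  have e3' : (0 : ℝ) < ε := e3
  rw [dist_comm, dist_eq_norm]
  have h3 : ε⁻¹ • (g ε θ - g₀ θ) - g₁ θ = ε⁻¹ • (g ε θ - g₀ θ - ε • g₁ θ) := by
    rw [smul_sub ε⁻¹ (g ε θ - g₀ θ), smul_smul, inv_mul_cancel₀ e3'.ne', one_smul]
  rw [h3, norm_smul, norm_inv, Real.norm_of_nonneg e3'.le, inv_mul_lt_iff₀ e3']
  calc _ ≤ C * ε ^ 2 := e1 θ
    _ = ε * (C * ε) := by ring
    _ < ε * e := mul_lt_mul_of_pos_left e2 e3'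

/-- Coefficients of an expansion are determined by the expanded function. -/
theorem unique (hg : HasUniformExpansion g g₀ g₁) (hg' : HasUniformExpansion g' g₀' g₁')
    (heq : ∀ᶠ ε in 𝓝[>] (0 : ℝ), ∀ θ, g ε θ = g' ε θ) (θ : ℝ) :
    g₀ θ = g₀' θ ∧ g₁ θ = g₁' θ := by
  have h2 := hg'.congr heq (fun _ => rfl) fun _ => rfl
  have h0 : ∀ θ, g₀ θ = g₀' θ := fun θ =>
    tendsto_nhds_unique (hg.tendstoUniformly.tendsto_at θ) (h2.tendstoUniformly.tendsto_at θ)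
  refine ⟨h0 θ, tendsto_nhds_unique (hg.tendstoUniformly_quotient.tendsto_at θ) ?_⟩
  rw [h0 θ]
  exact h2.tendstoUniformly_quotient.tendsto_at θ

/-- Expansions can be differentiated in `θ` if the derivative has an expansion. -/
theorem hasDerivAt {g q : ℝ → ℝ → ℂ} {g₀ g₁ q₀ q₁ : ℝ → ℂ} (hg : HasUniformExpansion g g₀ g₁)
    (hq : HasUniformExpansion q q₀ q₁)
    (hd : ∀ᶠ ε in 𝓝[>] (0 : ℝ), ∀ θ, HasDerivAt (g ε) (q ε θ) θ) (θ : ℝ) :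
    HasDerivAt g₀ (q₀ θ) θ ∧ HasDerivAt g₁ (q₁ θ) θ := by
  have h0 : ∀ θ, HasDerivAt g₀ (q₀ θ) θ := fun θ =>
    hasDerivAt_of_tendstoUniformly hq.tendstoUniformly hd
      (fun x => hg.tendstoUniformly.tendsto_at x) θ
  refine ⟨h0 θ, hasDerivAt_of_tendstoUniformly hq.tendstoUniformly_quotient ?_
    (fun x => hg.tendstoUniformly_quotient.tendsto_at x) θ⟩
  filter_upwards [hd] with ε hε x
  exact ((hε x).sub (h0 x)).const_smul ε⁻¹

/-- Reciprocals, for a constant leading coefficient. -/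
theorem inv_const {g : ℝ → ℝ → ℝ} {g₁ : ℝ → ℝ} {a : ℝ} (ha : 0 < a)
    (hg : HasUniformExpansion g (fun _ => a) g₁) :
    HasUniformExpansion (fun ε θ => (g ε θ)⁻¹) (fun _ => a⁻¹) fun θ => -(g₁ θ) / a ^ 2 := by
  obtain ⟨B, hB⟩ := hg.bdd_one
  obtain ⟨C, hC⟩ := hg.remainder
  have hB0 : 0 ≤ B := (norm_nonneg _).trans (hB 0)
  have hlow : ∀ᶠ ε in 𝓝[>] (0 : ℝ), ∀ θ, a / 2 < g ε θ := by
    filter_upwards [Metric.tendstoUniformly_iff.1 hg.tendstoUniformly (a / 2) (by positivity)]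
      with ε hε θ
    have := hε θ
    rw [Real.dist_eq, abs_lt] at this
    linarith [this.2]
  refine ⟨⟨‖a⁻¹‖, fun _ => le_rfl⟩, ⟨B / a ^ 2, fun θ => ?_⟩,
    (a * C + B * (C + B)) / (a / 2 * a ^ 2), ?_⟩
  · rw [norm_div, norm_neg, Real.norm_of_nonneg (by positivity : 0 ≤ a ^ 2)]
    gcongr
    exact hB θ
  · filter_upwards [hC, hlow, Ioo_mem_nhdsGT (zero_lt_one (α := ℝ))] with ε e1 e2 e3 θ
    have hgpos : 0 < g ε θ := (by positivity : 0 < a / 2).trans (e2 θ)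
    have hR := e1 θ
    have hC0 : 0 ≤ C := by
      have h1 := (norm_nonneg _).trans hR
      exact nonneg_of_mul_nonneg_left h1 (by have := e3.1; positivity)
    set R := g ε θ - a - ε • g₁ θ with hRdef
    have hgR : g ε θ = a + ε * g₁ θ + R := by rw [hRdef, smul_eq_mul]; ring
    have h3 : (g ε θ)⁻¹ - a⁻¹ - ε • (-(g₁ θ) / a ^ 2)
        = (-(a * R) + ε * g₁ θ * (R + ε * g₁ θ)) / (g ε θ * a ^ 2) := by
      rw [smul_eq_mul]
      field_simp
      rw [hgR]; ring
    rw [h3, norm_div, Real.norm_of_nonneg (by positivity : 0 ≤ g ε θ * a ^ 2), div_mul_eq_mul_div]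
    have hsq : ε ^ 2 ≤ ε := by nlinarith [e3.1, e3.2]
    have h4 : ‖ε * g₁ θ‖ ≤ ε * B := by
      rw [norm_mul, Real.norm_of_nonneg e3.1.le]
      exact mul_le_mul_of_nonneg_left (hB θ) e3.1.le
    have h5 : ‖R + ε * g₁ θ‖ ≤ ε * (C + B) := by
      refine (norm_add_le _ _).trans ((add_le_add hR h4).trans ?_)
      nlinarith [mul_le_mul_of_nonneg_left hsq hC0]
    have h6 : ‖-(a * R) + ε * g₁ θ * (R + ε * g₁ θ)‖ ≤ (a * C + B * (C + B)) * ε ^ 2 := by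
      refine (norm_add_le _ _).trans ?_
      rw [norm_neg, norm_mul, norm_mul (ε * g₁ θ), Real.norm_of_nonneg ha.le]
      have h7 : ‖ε * g₁ θ‖ * ‖R + ε * g₁ θ‖ ≤ (ε * B) * (ε * (C + B)) :=
        mul_le_mul h4 h5 (norm_nonneg _) (by have := e3.1; positivity)
      have h8 : a * ‖R‖ ≤ a * (C * ε ^ 2) := mul_le_mul_of_nonneg_left hR ha.le
      calc _ ≤ _ := add_le_add h8 h7
        _ = _ := by ring
    refine div_le_div₀ (by positivity) h6 (by positivity) ?_
    exact mul_le_mul_of_nonneg_right (e2 θ).le (by positivity)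

end HasUniformExpansion

end Expansion

/-! ### The frame of the perturbed circle -/

section Frame

variable {r₀ : ℝ} {f : ℝ → ℝ}

theorem perturbedCurve_eq (ε θ : ℝ) :
    perturbedCurve r₀ f ε θ = ((r₀ + ε * f θ : ℝ) : ℂ) * Complex.exp (θ * Complex.I) := by
  rw [perturbedCurve, circleCurve]; push_cast; ring

theorem hasDerivAt_perturbedCurve (hf : Differentiable ℝ f) (ε θ : ℝ) :
    HasDerivAt (perturbedCurve r₀ f ε)
      ((((ε * deriv f θ : ℝ) : ℂ) + ((r₀ + ε * f θ : ℝ) : ℂ) * Complex.I)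
        * Complex.exp (θ * Complex.I)) θ := by
  have h1 : HasDerivAt (fun t : ℝ => ((r₀ + ε * f t : ℝ) : ℂ)) ((ε * deriv f θ : ℝ) : ℂ) θ :=
    (((hf θ).hasDerivAt.const_mul ε).const_add r₀).ofReal_comp
  have h2 := h1.fun_mul (hasDerivAt_exp_mul_I θ)
  rw [show perturbedCurve r₀ f ε = fun t : ℝ => ((r₀ + ε * f t : ℝ) : ℂ)
    * Complex.exp (t * Complex.I) from funext fun t => perturbedCurve_eq ε t]
  convert! h2 using 1
  ring

theorem norm_deriv_perturbedCurve (hf : Differentiable ℝ f) (ε θ : ℝ) :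
    ‖deriv (perturbedCurve r₀ f ε) θ‖ = √((ε * deriv f θ) ^ 2 + (r₀ + ε * f θ) ^ 2) := by
  rw [(hasDerivAt_perturbedCurve hf ε θ).deriv, norm_mul, norm_exp_mul_I, mul_one,
    Complex.norm_add_mul_I]

theorem eventually_radius_pos (hr₀ : 0 < r₀) (hfb : ∃ C, ∀ θ, ‖f θ‖ ≤ C) {δ : ℝ} (hδ : 0 < δ) :
    ∀ᶠ ε in 𝓝[>] (0 : ℝ), ∀ θ, r₀ / 2 ≤ r₀ + ε * f θ ∧ |ε * f θ| < δ := by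
  obtain ⟨C, hC⟩ := hfb
  have ht : Tendsto (fun ε : ℝ => ε * C) (𝓝[>] 0) (𝓝 0) := by
    have : Continuous fun ε : ℝ => ε * C := by fun_prop
    simpa using (this.tendsto 0).mono_left nhdsWithin_le_nhds
  filter_upwards [ht.eventually_lt_const hδ, ht.eventually_lt_const (half_pos hr₀),
    self_mem_nhdsWithin] with ε e1 e2 e3 θ
  have h1 : |ε * f θ| ≤ ε * C := by
    rw [abs_mul, abs_of_pos (show (0 : ℝ) < ε from e3)]
    exact mul_le_mul_of_nonneg_left (hC θ) (le_of_lt e3)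
  refine ⟨?_, h1.trans_lt e1⟩
  linarith [(abs_le.1 h1).1]

/-- The length element is `r₀ + ε f + O(ε²)`: the derivative of the profile only enters at second
order. -/
theorem norm_deriv_perturbedCurve_expansion (hr₀ : 0 < r₀) (hf : Differentiable ℝ f)
    (hfb : ∃ C, ∀ θ, ‖f θ‖ ≤ C) (hfd : ∃ C, ∀ θ, ‖deriv f θ‖ ≤ C) :
    HasUniformExpansion (fun ε θ => ‖deriv (perturbedCurve r₀ f ε) θ‖) (fun _ => r₀) f := by
  obtain ⟨D, hD⟩ := hfd
  refine ⟨⟨‖r₀‖, fun _ => le_rfl⟩, hfb, D ^ 2 / r₀, ?_⟩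
  filter_upwards [eventually_radius_pos hr₀ hfb zero_lt_one] with ε e1 θ
  have hA := (e1 θ).1
  rw [norm_deriv_perturbedCurve hf, smul_eq_mul, sub_sub]
  set A := r₀ + ε * f θ
  set b := ε * deriv f θ with hb
  have hApos : 0 < A := (half_pos hr₀).trans_le hA
  have hs : √(b ^ 2 + A ^ 2) ^ 2 = b ^ 2 + A ^ 2 := Real.sq_sqrt (by positivity)
  have hAs : A ≤ √(b ^ 2 + A ^ 2) := Real.le_sqrt_of_sq_le (by nlinarith)
  have hb2 : b ^ 2 ≤ D ^ 2 * ε ^ 2 := by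
    have h1 : deriv f θ ^ 2 ≤ D ^ 2 := by
      rw [← sq_abs]; exact pow_le_pow_left₀ (abs_nonneg _) (hD θ) 2
    rw [hb, mul_pow, mul_comm]
    exact mul_le_mul_of_nonneg_right h1 (sq_nonneg ε)
  rw [Real.norm_of_nonneg (sub_nonneg.2 hAs), div_mul_eq_mul_div, le_div_iff₀ hr₀]
  nlinarith

theorem unitTangent_perturbedCurve_expansion (hr₀ : 0 < r₀) (hf : Differentiable ℝ f)
    (hfb : ∃ C, ∀ θ, ‖f θ‖ ≤ C) (hfd : ∃ C, ∀ θ, ‖deriv f θ‖ ≤ C) :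
    HasUniformExpansion (fun ε θ => unitTangent (perturbedCurve r₀ f ε) θ)
      (unitTangent (circleCurve r₀))
      (fun θ => profileDeriv r₀ f θ • unitNormal (circleCurve r₀) θ) := by
  obtain ⟨C, hC⟩ := hfb
  obtain ⟨D, hD⟩ := hfd
  have h1 := (norm_deriv_perturbedCurve_expansion hr₀ hf ⟨C, hC⟩ ⟨D, hD⟩).inv_const hr₀
  have h2 : HasUniformExpansion (fun ε θ => deriv (perturbedCurve r₀ f ε) θ)
      (fun θ => r₀ * (Complex.I * Complex.exp (θ * Complex.I)))
      (fun θ => deriv f θ * Complex.exp (θ * Complex.I)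
        + f θ * (Complex.I * Complex.exp (θ * Complex.I))) := by
    refine (HasUniformExpansion.of_exact (g₀ := fun θ : ℝ => (r₀ : ℂ) * (Complex.I
      * Complex.exp (θ * Complex.I))) (g₁ := fun θ => deriv f θ * Complex.exp (θ * Complex.I)
        + f θ * (Complex.I * Complex.exp (θ * Complex.I)))
      ⟨|r₀|, fun θ => ?_⟩ ⟨D + C, fun θ => ?_⟩).congr
      (Filter.Eventually.of_forall fun ε θ => ?_) (fun _ => rfl) fun _ => rfl
    · simp
    · refine (norm_add_le _ _).trans (add_le_add ?_ ?_)
      · simpa [norm_exp_mul_I] using hD θ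
      · simpa [norm_exp_mul_I] using hC θ
    · rw [(hasDerivAt_perturbedCurve hf ε θ).deriv, Complex.real_smul]
      push_cast; ring
  have hr : (r₀ : ℂ) ≠ 0 := by exact_mod_cast hr₀.ne'
  refine (h1.bilinear (ContinuousLinearMap.lsmul ℝ ℝ) h2).congr
    (Filter.Eventually.of_forall fun ε θ => ?_) (fun θ => ?_) fun θ => ?_
  · rw [unitTangent, ContinuousLinearMap.lsmul_apply, Complex.real_smul, div_eq_inv_mul]
    push_cast; rfl
  · rw [unitTangent_circleCurve hr₀, ContinuousLinearMap.lsmul_apply, Complex.real_smul]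
    push_cast
    field_simp
  · simp only [unitNormal_circleCurve hr₀, ContinuousLinearMap.lsmul_apply, Complex.real_smul,
      profileDeriv]
    push_cast
    field_simp
    ring

theorem unitNormal_perturbedCurve_expansion (hr₀ : 0 < r₀) (hf : Differentiable ℝ f)
    (hfb : ∃ C, ∀ θ, ‖f θ‖ ≤ C) (hfd : ∃ C, ∀ θ, ‖deriv f θ‖ ≤ C) :
    HasUniformExpansion (fun ε θ => unitNormal (perturbedCurve r₀ f ε) θ)
      (unitNormal (circleCurve r₀))
      (fun θ => -(profileDeriv r₀ f θ • unitTangent (circleCurve r₀) θ)) := by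
  refine ((unitTangent_perturbedCurve_expansion hr₀ hf hfb hfd).const_mul (-Complex.I)).congr
    (Filter.Eventually.of_forall fun ε θ => rfl) (fun θ => rfl) fun θ => ?_
  simp only [unitNormal_circleCurve hr₀, unitTangent_circleCurve hr₀, Complex.real_smul]
  ring

theorem differentiableAt_unitTangent_perturbedCurve (hf : ContDiff ℝ 2 f) {ε θ : ℝ}
    (hpos : 0 < r₀ + ε * f θ) :
    DifferentiableAt ℝ (unitTangent (perturbedCurve r₀ f ε)) θ := by
  have hfd : Differentiable ℝ f := hf.differentiable (by norm_num)
  have hfd' : Differentiable ℝ (deriv f) :=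
    ((contDiff_succ_iff_deriv (n := 1)).1 hf).2.2.differentiable (by norm_num)
  have hd : deriv (perturbedCurve r₀ f ε) = fun t : ℝ => (((ε * deriv f t : ℝ) : ℂ)
      + ((r₀ + ε * f t : ℝ) : ℂ) * Complex.I) * Complex.exp (t * Complex.I) :=
    funext fun t => (hasDerivAt_perturbedCurve hfd ε t).deriv
  have h1 : DifferentiableAt ℝ (deriv (perturbedCurve r₀ f ε)) θ := by
    rw [hd]
    have a1 : DifferentiableAt ℝ (fun t : ℝ => ((ε * deriv f t : ℝ) : ℂ)) θ :=
      (((hfd' θ).hasDerivAt.const_mul ε).ofReal_comp).differentiableAt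
    have a2 : DifferentiableAt ℝ (fun t : ℝ => ((r₀ + ε * f t : ℝ) : ℂ)) θ :=
      ((((hfd θ).hasDerivAt.const_mul ε).const_add r₀).ofReal_comp).differentiableAt
    exact (a1.add (a2.mul_const _)).mul (hasDerivAt_exp_mul_I θ).differentiableAt
  have hne : deriv (perturbedCurve r₀ f ε) θ ≠ 0 := by
    rw [← norm_ne_zero_iff, norm_deriv_perturbedCurve hfd]
    positivity
  have h2 : DifferentiableAt ℝ (fun t => (‖deriv (perturbedCurve r₀ f ε) t‖ : ℂ)) θ :=
    ((h1.norm ℝ hne).hasDerivAt.ofReal_comp).differentiableAt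
  exact h1.div h2 (by exact_mod_cast norm_ne_zero_iff.2 hne)

end Frame

/-! ### Taylor expansion of fields along the moving boundary -/

section Trace

variable {F : Type*} [NormedAddCommGroup F] [NormedSpace ℝ F] {r₀ δ : ℝ}

theorem norm_radial {r₀ s : ℝ} (h : |s| ≤ r₀) (θ : ℝ) :
    ‖((r₀ + s : ℝ) : ℂ) * Complex.exp (θ * Complex.I)‖ = r₀ + s := by
  rw [norm_mul, norm_exp_mul_I, mul_one, Complex.norm_real, Real.norm_of_nonneg]
  linarith [(abs_le.1 h).1]

/-- The closed annulus around the circle of radius `r₀`; for `η = 0` it is the circle. -/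
theorem isCompact_annulus (r₀ η : ℝ) : IsCompact {z : ℂ | |‖z‖ - r₀| ≤ η} := by
  refine (isCompact_closedBall (0 : ℂ) (r₀ + η)).of_isClosed_subset
    (isClosed_le (by fun_prop) continuous_const) fun z hz => ?_
  have hz' : |‖z‖ - r₀| ≤ η := hz
  rw [mem_closedBall_zero_iff]
  linarith [(abs_le.1 hz').2]

/-- Lipschitz bound along radii, uniform in the direction by compactness of the annulus. -/
theorem exists_radial_lipschitz {h : ℂ → F} {η : ℝ} (hη : η ≤ r₀)
    (hh : ∀ z : ℂ, |‖z‖ - r₀| ≤ η → ContDiffAt ℝ 1 h z) :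
    ∃ K, 0 ≤ K ∧ ∀ s t θ : ℝ, |s| ≤ η → |t| ≤ η →
      ‖h (((r₀ + s : ℝ) : ℂ) * Complex.exp (θ * Complex.I))
        - h (((r₀ + t : ℝ) : ℂ) * Complex.exp (θ * Complex.I))‖ ≤ K * |s - t| := by
  have hc : ContinuousOn (fderiv ℝ h) {z : ℂ | |‖z‖ - r₀| ≤ η} := fun z hz =>
    ((hh z hz).fderiv_right (m := 0) (by norm_num)).continuousAt.continuousWithinAt
  obtain ⟨K, hK⟩ := (isCompact_annulus r₀ η).exists_bound_of_continuousOn hc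
  refine ⟨|K|, abs_nonneg K, fun s t θ hs ht => ?_⟩
  have hmem : ∀ x ∈ Icc (-η) η,
      |‖((r₀ + x : ℝ) : ℂ) * Complex.exp (θ * Complex.I)‖ - r₀| ≤ η := fun x hx => by
    have hx' : |x| ≤ η := abs_le.2 hx
    rw [norm_radial (hx'.trans hη)]
    simpa using hx'
  have hd : ∀ x ∈ Icc (-η) η, HasDerivWithinAt
      (fun x : ℝ => h (((r₀ + x : ℝ) : ℂ) * Complex.exp (θ * Complex.I)))
      (fderiv ℝ h (((r₀ + x : ℝ) : ℂ) * Complex.exp (θ * Complex.I)) (Complex.exp (θ * Complex.I)))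
      (Icc (-η) η) x := fun x hx => by
    have h1 : HasDerivAt (fun x : ℝ => ((r₀ + x : ℝ) : ℂ) * Complex.exp (θ * Complex.I))
        (Complex.exp (θ * Complex.I)) x := by
      simpa using (((hasDerivAt_id x).const_add r₀).ofReal_comp).mul_const
        (Complex.exp (θ * Complex.I))
    exact (((hh _ (hmem x hx)).differentiableAt (by norm_num)).hasFDerivAt.comp_hasDerivAt x
      h1).hasDerivWithinAt
  have := (convex_Icc (-η) η).norm_image_sub_le_of_norm_hasDerivWithin_le (C := |K|) hd
    (fun x hx => ?_) (abs_le.1 ht) (abs_le.1 hs)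
  · simpa using this
  · refine (ContinuousLinearMap.le_opNorm _ _).trans ?_
    rw [norm_exp_mul_I, mul_one]
    exact (hK _ (hmem x hx)).trans (le_abs_self K)

/-- Second-order Taylor estimate along radii. -/
theorem exists_radial_taylor {h : ℂ → F} {η : ℝ} (hη : η ≤ r₀)
    (hh : ∀ z : ℂ, |‖z‖ - r₀| ≤ η → ContDiffAt ℝ 2 h z) :
    ∃ K, 0 ≤ K ∧ ∀ s θ : ℝ, |s| ≤ η →
      ‖h (((r₀ + s : ℝ) : ℂ) * Complex.exp (θ * Complex.I)) - h (circleCurve r₀ θ)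
        - s • fderiv ℝ h (circleCurve r₀ θ) (Complex.exp (θ * Complex.I))‖ ≤ K * s ^ 2 := by
  obtain ⟨K, hK0, hK⟩ := exists_radial_lipschitz (h := fderiv ℝ h) hη
    fun z hz => (hh z hz).fderiv_right (by norm_num)
  refine ⟨K, hK0, fun s θ hs => ?_⟩
  set ν := Complex.exp (θ * Complex.I) with hν
  have hc0 : circleCurve r₀ θ = ((r₀ + 0 : ℝ) : ℂ) * ν := by rw [add_zero]; rfl
  have hsub : ∀ x ∈ Icc (-|s|) |s|, |x| ≤ η := fun x hx => (abs_le.2 hx).trans hs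
  have hη0 : 0 ≤ η := (abs_nonneg s).trans hs
  have hd : ∀ x ∈ Icc (-|s|) |s|, HasDerivWithinAt
      (fun x : ℝ => h (((r₀ + x : ℝ) : ℂ) * ν) - x • fderiv ℝ h (circleCurve r₀ θ) ν)
      (fderiv ℝ h (((r₀ + x : ℝ) : ℂ) * ν) ν - fderiv ℝ h (circleCurve r₀ θ) ν)
      (Icc (-|s|) |s|) x := fun x hx => by
    have h1 : HasDerivAt (fun x : ℝ => ((r₀ + x : ℝ) : ℂ) * ν) ν x := by
      simpa using (((hasDerivAt_id x).const_add r₀).ofReal_comp).mul_const ν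
    have h2 : |‖((r₀ + x : ℝ) : ℂ) * ν‖ - r₀| ≤ η := by
      rw [norm_radial ((hsub x hx).trans hη)]
      simpa using hsub x hx
    have h3 := (((hh _ h2).differentiableAt (by norm_num)).hasFDerivAt.comp_hasDerivAt x h1)
    have h4 : HasDerivAt (fun x : ℝ => x • fderiv ℝ h (circleCurve r₀ θ) ν)
        (fderiv ℝ h (circleCurve r₀ θ) ν) x := by
      simpa using (hasDerivAt_id x).smul_const (fderiv ℝ h (circleCurve r₀ θ) ν)
    exact (h3.sub h4).hasDerivWithinAt
  have := (convex_Icc (-|s|) |s|).norm_image_sub_le_of_norm_hasDerivWithin_le (C := K * |s|) hd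
    (fun x hx => ?_) (show (0 : ℝ) ∈ _ by simp) (abs_le.1 (le_refl |s|))
  · simp only [zero_smul, sub_zero, Real.norm_eq_abs, ← hc0] at this
    rw [sub_right_comm, mul_assoc, abs_mul_abs_self, ← sq] at this
    exact this
  · rw [← sub_apply]
    refine (ContinuousLinearMap.le_opNorm _ _).trans ?_
    rw [hν, norm_exp_mul_I, mul_one, ← hν, hc0]
    refine (hK x 0 θ (hsub x hx) (by simpa using hη0)).trans ?_
    rw [sub_zero]
    exact mul_le_mul_of_nonneg_left (abs_le.2 hx) hK0

/-- Expansion of the trace on the moving boundary of a family of fields with an expansion in a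
neighbourhood of the circle. -/
theorem trace_expansion (hr₀ : 0 < r₀) (hδ : 0 < δ) {f : ℝ → ℝ} (hfb : ∃ C, ∀ θ, ‖f θ‖ ≤ C)
    {W : ℝ → ℂ → F} {W₀ W₁ : ℂ → F}
    (h0 : ∀ z : ℂ, |‖z‖ - r₀| < δ → ContDiffAt ℝ 2 W₀ z)
    (h1 : ∀ z : ℂ, |‖z‖ - r₀| < δ → ContDiffAt ℝ 1 W₁ z)
    (hW : ∃ C, ∀ᶠ ε in 𝓝[>] (0 : ℝ), ∀ z : ℂ, |‖z‖ - r₀| < δ →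
      ‖W ε z - W₀ z - ε • W₁ z‖ ≤ C * ε ^ 2) :
    HasUniformExpansion (fun ε θ => W ε (perturbedCurve r₀ f ε θ))
      (fun θ => W₀ (circleCurve r₀ θ))
      (fun θ => W₁ (circleCurve r₀ θ)
        + f θ • fderiv ℝ W₀ (circleCurve r₀ θ) (unitNormal (circleCurve r₀) θ)) := by
  obtain ⟨B, hB⟩ := hfb
  obtain ⟨C, hC⟩ := hW
  set η := min (δ / 2) r₀ with hηdef
  have hη0 : 0 < η := lt_min (half_pos hδ) hr₀
  have hηδ : ∀ x : ℝ, x ≤ η → x < δ := fun x hx => by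
    linarith [min_le_left (δ / 2) r₀]
  have hηr : η ≤ r₀ := min_le_right _ _
  have hcirc : ∀ θ, |‖circleCurve r₀ θ‖ - r₀| < δ := fun θ => by
    rw [norm_circleCurve hr₀]; simpa using hδ
  have hcirc' : ∀ θ, circleCurve r₀ θ ∈ {z : ℂ | |‖z‖ - r₀| ≤ 0} := fun θ => by
    rw [mem_ofPred_eq, norm_circleCurve hr₀]; simp
  have hzero : ∀ z : ℂ, z ∈ {z : ℂ | |‖z‖ - r₀| ≤ 0} → |‖z‖ - r₀| < δ :=
    fun z hz => lt_of_le_of_lt hz hδ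
  obtain ⟨K, hK0, hK⟩ := exists_radial_taylor (h := W₀) hηr fun z hz => h0 z (hηδ _ hz)
  obtain ⟨L, hL0, hL⟩ := exists_radial_lipschitz (h := W₁) hηr fun z hz => h1 z (hηδ _ hz)
  obtain ⟨a, ha⟩ := (isCompact_annulus r₀ 0).exists_bound_of_continuousOn (f := W₀)
    fun z hz => (h0 z (hzero z hz)).continuousAt.continuousWithinAt
  obtain ⟨b, hb⟩ := (isCompact_annulus r₀ 0).exists_bound_of_continuousOn (f := W₁)
    fun z hz => (h1 z (hzero z hz)).continuousAt.continuousWithinAt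
  obtain ⟨c, hc⟩ := (isCompact_annulus r₀ 0).exists_bound_of_continuousOn (f := fderiv ℝ W₀)
    fun z hz => ((h0 z (hzero z hz)).fderiv_right (m := 1)
      (by norm_num)).continuousAt.continuousWithinAt
  have hB0 : 0 ≤ B := (norm_nonneg _).trans (hB 0)
  refine ⟨⟨a, fun θ => ha _ (hcirc' θ)⟩, ⟨b + B * c, fun θ => ?_⟩, C + K * B ^ 2 + L * B, ?_⟩
  · refine (norm_add_le _ _).trans (add_le_add (hb _ (hcirc' θ)) ?_)
    rw [norm_smul]
    refine mul_le_mul (hB θ) ((ContinuousLinearMap.le_opNorm _ _).trans ?_) (norm_nonneg _) hB0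
    rw [unitNormal_circleCurve hr₀, norm_exp_mul_I, mul_one]
    exact hc _ (hcirc' θ)
  · filter_upwards [hC, eventually_radius_pos hr₀ ⟨B, hB⟩ hη0, self_mem_nhdsWithin]
      with ε e1 e2 e3 θ
    have e3' : (0 : ℝ) < ε := e3
    have hs : |ε * f θ| ≤ η := (e2 θ).2.le
    have hz : |‖((r₀ + ε * f θ : ℝ) : ℂ) * Complex.exp (θ * Complex.I)‖ - r₀| < δ := by
      rw [norm_radial (hs.trans hηr)]
      simpa using hηδ _ hs
    have t1 := e1 _ hz
    have t2 := hK (ε * f θ) θ hs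
    have t3 := hL (ε * f θ) 0 θ hs (by simpa using hη0.le)
    have hsB : |ε * f θ| ≤ ε * B := by
      rw [abs_mul, abs_of_pos e3']
      exact mul_le_mul_of_nonneg_left (hB θ) e3'.le
    have hsq : (ε * f θ) ^ 2 ≤ (ε * B) ^ 2 := by
      rw [← sq_abs]; exact pow_le_pow_left₀ (abs_nonneg _) hsB 2
    rw [perturbedCurve_eq, unitNormal_circleCurve hr₀]
    rw [add_zero, sub_zero, show (r₀ : ℂ) * Complex.exp (θ * Complex.I) = circleCurve r₀ θ from rfl]
      at t3
    set z := ((r₀ + ε * f θ : ℝ) : ℂ) * Complex.exp (θ * Complex.I)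
    set z₀ := circleCurve r₀ θ
    set ν := Complex.exp (θ * Complex.I)
    have hsplit : W ε z - W₀ z₀ - ε • (W₁ z₀ + f θ • fderiv ℝ W₀ z₀ ν)
        = (W ε z - W₀ z - ε • W₁ z) + (W₀ z - W₀ z₀ - (ε * f θ) • fderiv ℝ W₀ z₀ ν)
          + ε • (W₁ z - W₁ z₀) := by
      rw [mul_smul]; module
    rw [hsplit]
    refine (norm_add₃_le).trans ?_
    have t4 : ‖ε • (W₁ z - W₁ z₀)‖ ≤ ε * (L * (ε * B)) := by
      rw [norm_smul, Real.norm_of_nonneg e3'.le]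
      exact mul_le_mul_of_nonneg_left (t3.trans (mul_le_mul_of_nonneg_left hsB hL0)) e3'.le
    have t5 := t2.trans (mul_le_mul_of_nonneg_left hsq hK0)
    calc _ ≤ _ := add_le_add_three t1 t5 t4
      _ = _ := by ring

end Trace

/-! ### Expansion of the governing equations on the perturbed disk -/

/-- A family of fields, harmonic in an annulus around the circle, with an expansion to first order
that is uniform in the annulus. -/
structure IsBranchExpansion (r₀ δ : ℝ) (W : ℝ → ℂ → ℂ) (W₀ W₁ : ℂ → ℂ) : Prop where
  zero_harmonic : HarmonicOnNhd W₀ {z | |‖z‖ - r₀| < δ}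
  one_harmonic : HarmonicOnNhd W₁ {z | |‖z‖ - r₀| < δ}
  harmonic : ∀ᶠ ε in 𝓝[>] (0 : ℝ), HarmonicOnNhd (W ε) {z | |‖z‖ - r₀| < δ}
  remainder : ∃ C, ∀ᶠ ε in 𝓝[>] (0 : ℝ), ∀ z : ℂ, |‖z‖ - r₀| < δ →
    ‖W ε z - W₀ z - ε • W₁ z‖ ≤ C * ε ^ 2

theorem HasFieldExpansion.branches {r₀ : ℝ} {w : ℝ → Potential} {w₀ w₁ : Potential}
    (h : HasFieldExpansion r₀ w w₀ w₁) : ∃ δ, 0 < δ ∧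
      IsBranchExpansion r₀ δ (fun ε => (w ε).inside) w₀.inside w₁.inside ∧
      IsBranchExpansion r₀ δ (fun ε => (w ε).outside) w₀.outside w₁.outside := by
  obtain ⟨δ, ε₀, C, hδ, -, hε₀, h0, h1, hrem⟩ := h
  have hsub1 : {z : ℂ | |‖z‖ - r₀| < δ} ⊆ Metric.ball 0 (r₀ + δ) := fun z hz => by
    have hz' : |‖z‖ - r₀| < δ := hz
    rw [mem_ball_zero_iff]; linarith [(abs_lt.1 hz').2]
  have hsub2 : {z : ℂ | |‖z‖ - r₀| < δ} ⊆ {z | r₀ - δ < ‖z‖} := fun z hz => by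
    have hz' : |‖z‖ - r₀| < δ := hz
    have : r₀ - δ < ‖z‖ := by linarith [(abs_lt.1 hz').1]
    exact this
  have hev := Ioo_mem_nhdsGT hε₀
  have e : ∀ a b c : ℂ, ∀ ε : ℝ, a - b - ε • c = a - (b + ε * c) := fun a b c ε => by
    rw [Complex.real_smul]; ring
  refine ⟨δ, hδ, ⟨h0.1.mono hsub1, h1.1.mono hsub1, ?_, C, ?_⟩,
    ⟨h0.2.mono hsub2, h1.2.mono hsub2, ?_, C, ?_⟩⟩
  · filter_upwards [hev] with ε hε using (hrem ε hε).1.1.mono hsub1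
  · filter_upwards [hev] with ε hε z hz
    rw [e]; exact (hrem ε hε).2.1 z (by linarith [(abs_lt.1 hz).2])
  · filter_upwards [hev] with ε hε using (hrem ε hε).1.2.mono hsub2
  · filter_upwards [hev] with ε hε z hz
    rw [e]; exact (hrem ε hε).2.2 z (by linarith [(abs_lt.1 hz).1]) (by linarith [(abs_lt.1 hz).2])

namespace IsBranchExpansion

variable {r₀ δ : ℝ} {W : ℝ → ℂ → ℂ} {W₀ W₁ : ℂ → ℂ} {f : ℝ → ℝ}

/-- The gradients have the differentiated expansion, by the gradient estimate for the remainder. -/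
theorem fderiv_remainder (h : IsBranchExpansion r₀ δ W W₀ W₁) (hδ : 0 < δ) :
    ∃ C, ∀ᶠ ε in 𝓝[>] (0 : ℝ), ∀ z : ℂ, |‖z‖ - r₀| < δ / 2 →
      ‖fderiv ℝ (W ε) z - fderiv ℝ W₀ z - ε • fderiv ℝ W₁ z‖ ≤ C * ε ^ 2 := by
  obtain ⟨C, hC⟩ := h.remainder
  -- disks of radius `δ / 2` around points of the smaller annulus stay in the larger one;
  -- `|C| + 1` makes the bound on the remainder positive
  refine ⟨4 * Real.exp 2 * (|C| + 1) / (δ / 2), ?_⟩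
  filter_upwards [hC, h.harmonic, self_mem_nhdsWithin] with ε e1 e2 e3 z hz
  have e3' : (0 : ℝ) < ε := e3
  have hball : Metric.ball z (δ / 2) ⊆ {y : ℂ | |‖y‖ - r₀| < δ} := fun y hy => by
    have h1 : |‖y‖ - ‖z‖| < δ / 2 := (abs_norm_sub_norm_le y z).trans_lt (mem_ball_iff_norm.1 hy)
    have h2 : |‖y‖ - r₀| < δ := by
      have := abs_add_le (‖y‖ - ‖z‖) (‖z‖ - r₀)
      rw [sub_add_sub_cancel] at this
      linarith
    exact h2
  have hz' := hball (Metric.mem_ball_self (half_pos hδ))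
  have hR : HarmonicOnNhd (fun y => W ε y - W₀ y - ε • W₁ y) (Metric.ball z (δ / 2)) :=
    fun y hy => ((e2 y (hball hy)).sub (h.zero_harmonic y (hball hy))).sub
      (h.one_harmonic y (hball hy)).const_smul
  have hd : ∀ {v : ℂ → ℂ}, HarmonicAt v z → DifferentiableAt ℝ v z := fun hv =>
    hv.1.differentiableAt (by norm_num)
  have hfd : fderiv ℝ (fun y => W ε y - W₀ y - ε • W₁ y) z
      = fderiv ℝ (W ε) z - fderiv ℝ W₀ z - ε • fderiv ℝ W₁ z :=
    (((hd (e2 z hz')).hasFDerivAt.fun_sub (hd (h.zero_harmonic z hz')).hasFDerivAt).fun_sub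
      ((hd (h.one_harmonic z hz')).hasFDerivAt.fun_const_smul ε)).fderiv
  have hgrad := norm_fderiv_le_of_harmonic (half_pos hδ)
    (M := (|C| + 1) * ε ^ 2) (by positivity) hR fun y hy => (e1 y (hball hy)).trans
      (mul_le_mul_of_nonneg_right (by linarith [le_abs_self C]) (sq_nonneg ε))
  rw [← hfd]
  calc _ ≤ _ := hgrad
    _ = _ := by ring

theorem trace (h : IsBranchExpansion r₀ δ W W₀ W₁) (hr₀ : 0 < r₀) (hδ : 0 < δ)
    (hfb : ∃ C, ∀ θ, ‖f θ‖ ≤ C) :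
    HasUniformExpansion (fun ε θ => W ε (perturbedCurve r₀ f ε θ))
      (fun θ => W₀ (circleCurve r₀ θ))
      (fun θ => W₁ (circleCurve r₀ θ) + f θ * dNormal (circleCurve r₀) W₀ θ) :=
  (trace_expansion hr₀ hδ hfb (fun z hz => (h.zero_harmonic z hz).1)
    (fun z hz => (h.one_harmonic z hz).1.of_le (by norm_num)) h.remainder).congr
    (Filter.Eventually.of_forall fun _ _ => rfl) (fun _ => rfl) fun θ => by
      rw [Complex.real_smul, dNormal]

theorem gradient (h : IsBranchExpansion r₀ δ W W₀ W₁) (hr₀ : 0 < r₀) (hδ : 0 < δ)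
    (hfb : ∃ C, ∀ θ, ‖f θ‖ ≤ C) :
    HasUniformExpansion (fun ε θ => fderiv ℝ (W ε) (perturbedCurve r₀ f ε θ))
      (fun θ => fderiv ℝ W₀ (circleCurve r₀ θ))
      (fun θ => fderiv ℝ W₁ (circleCurve r₀ θ) + f θ • fderiv ℝ (fderiv ℝ W₀) (circleCurve r₀ θ)
        (unitNormal (circleCurve r₀) θ)) := by
  have hsub : ∀ z : ℂ, |‖z‖ - r₀| < δ / 2 → |‖z‖ - r₀| < δ := fun z hz => by linarith
  exact trace_expansion hr₀ (half_pos hδ) hfb (W := fun ε => fderiv ℝ (W ε))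
    (fun z hz => (h.zero_harmonic z (hsub z hz)).contDiffAt_three.fderiv_right (by norm_num))
    (fun z hz => (h.one_harmonic z (hsub z hz)).1.fderiv_right (by norm_num))
    (h.fderiv_remainder hδ)

theorem normal (h : IsBranchExpansion r₀ δ W W₀ W₁) (hr₀ : 0 < r₀) (hδ : 0 < δ)
    (hf : Differentiable ℝ f) (hfb : ∃ C, ∀ θ, ‖f θ‖ ≤ C) (hfd : ∃ C, ∀ θ, ‖deriv f θ‖ ≤ C) :
    HasUniformExpansion (fun ε θ => dNormal (perturbedCurve r₀ f ε) (W ε) θ)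
      (dNormal (circleCurve r₀) W₀)
      (fun θ => dNormal (circleCurve r₀) W₁ θ + f θ * dNormalNormal r₀ W₀ θ
        - profileDeriv r₀ f θ * dTangent (circleCurve r₀) W₀ θ) :=
  ((h.gradient hr₀ hδ hfb).clm_apply
    (unitNormal_perturbedCurve_expansion hr₀ hf hfb hfd)).congr
    (Filter.Eventually.of_forall fun _ _ => rfl) (fun _ => rfl) fun θ => by
      simp only [dNormal, dNormalNormal, dTangent, map_neg, map_smul, add_apply, smul_apply]
      simp only [Complex.real_smul]
      ring

theorem tangent (h : IsBranchExpansion r₀ δ W W₀ W₁) (hr₀ : 0 < r₀) (hδ : 0 < δ)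
    (hf : Differentiable ℝ f) (hfb : ∃ C, ∀ θ, ‖f θ‖ ≤ C) (hfd : ∃ C, ∀ θ, ‖deriv f θ‖ ≤ C) :
    HasUniformExpansion (fun ε θ => dTangent (perturbedCurve r₀ f ε) (W ε) θ)
      (dTangent (circleCurve r₀) W₀)
      (fun θ => dTangent (circleCurve r₀) W₁ θ + f θ * dNormalTangent r₀ W₀ θ
        + profileDeriv r₀ f θ * dNormal (circleCurve r₀) W₀ θ) :=
  ((h.gradient hr₀ hδ hfb).clm_apply
    (unitTangent_perturbedCurve_expansion hr₀ hf hfb hfd)).congr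
    (Filter.Eventually.of_forall fun _ _ => rfl) (fun _ => rfl) fun θ => by
      simp only [dNormal, dNormalTangent, dTangent, map_smul, add_apply, smul_apply]
      simp only [Complex.real_smul]
      ring

/-- The derivatives of the fields along the moving boundary are differentiable in `θ`. -/
theorem differentiable_normal_tangent (h : IsBranchExpansion r₀ δ W W₀ W₁) (hr₀ : 0 < r₀)
    (hδ : 0 < δ) (hf : ContDiff ℝ 2 f) (hfb : ∃ C, ∀ θ, ‖f θ‖ ≤ C) :
    ∀ᶠ ε in 𝓝[>] (0 : ℝ), ∀ θ,
      DifferentiableAt ℝ (dNormal (perturbedCurve r₀ f ε) (W ε)) θ ∧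
      DifferentiableAt ℝ (dTangent (perturbedCurve r₀ f ε) (W ε)) θ := by
  filter_upwards [h.harmonic, eventually_radius_pos hr₀ hfb (lt_min hδ hr₀)] with ε e1 e2 θ
  have hs : |ε * f θ| ≤ r₀ := (e2 θ).2.le.trans (min_le_right _ _)
  have hmem : |‖perturbedCurve r₀ f ε θ‖ - r₀| < δ := by
    rw [perturbedCurve_eq, norm_radial hs]
    simpa using (e2 θ).2.trans_le (min_le_left _ _)
  have hT := differentiableAt_unitTangent_perturbedCurve hf
    ((half_pos hr₀).trans_le (e2 θ).1)
  have hγ := (hasDerivAt_perturbedCurve (r₀ := r₀)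
    (hf.differentiable (by norm_num)) ε θ).differentiableAt
  have hD : DifferentiableAt ℝ (fun t => fderiv ℝ (W ε) (perturbedCurve r₀ f ε t)) θ :=
    ((((e1 _ hmem).1.fderiv_right (m := 1) (by norm_num)).differentiableAt
      (by norm_num))).comp θ hγ
  exact ⟨hD.clm_apply (hT.const_mul _), hD.clm_apply hT⟩

end IsBranchExpansion

section Coefficients

variable {m : Medium} {H : ℂ → ℂ} {r₀ : ℝ} {f : ℝ → ℝ} {u v : ℝ → Potential}
  {u₀ v₀ u₁ v₁ : Potential}

theorem HasFieldExpansion.isPiecewiseHarmonic (hr₀ : 0 < r₀) {w : ℝ → Potential}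
    {w₀ w₁ : Potential} (h : HasFieldExpansion r₀ w w₀ w₁) :
    IsPiecewiseHarmonic (Metric.ball 0 r₀) w₀ ∧ IsPiecewiseHarmonic (Metric.ball 0 r₀) w₁ := by
  obtain ⟨δ, ε₀, C, hδ, -, -, h0, h1, -⟩ := h
  have key : ∀ {w : Potential}, HarmonicAcross r₀ δ w →
      IsPiecewiseHarmonic (Metric.ball 0 r₀) w := fun hw =>
    isPiecewiseHarmonic_of_harmonicAt hr₀
      (fun z hz => hw.1 z (mem_ball_zero_iff.2 (by linarith)))
      fun z hz => hw.2 z (show r₀ - δ < ‖z‖ by linarith)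
  exact ⟨key h0, key h1⟩

/-- The coefficients of a field expansion solve the leading- and first-order systems: all terms
of the governing equations on the perturbed disk have expansions that are uniform along the boundary,
and the coefficients of both sides agree.  The equation for the flux of the
second-harmonic potential is read as one for the `θ`-derivative of `P_∥`. -/
theorem IsFirstOrderExpansion.coefficients (hr₀ : 0 < r₀) (hf : ContDiff ℝ 2 f)
    (hfb : ∃ C, ∀ θ, ‖f θ‖ ≤ C) (hfd : ∃ C, ∀ θ, ‖deriv f θ‖ ≤ C)
    (h : IsFirstOrderExpansion m H r₀ f u v u₀ v₀ u₁ v₁) :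
    IsGoverningSolution m H (Metric.ball 0 r₀) (circleCurve r₀) u₀ v₀ ∧
      IsFirstOrderSolution m r₀ f u₀ v₀ u₁ v₁ := by
  have hf1 : Differentiable ℝ f := hf.differentiable (by norm_num)
  obtain ⟨hu₀, hu₁⟩ := h.u_expansion.isPiecewiseHarmonic hr₀
  obtain ⟨hv₀, hv₁⟩ := h.v_expansion.isPiecewiseHarmonic hr₀
  obtain ⟨δ, hδ, ui, uo⟩ := h.u_expansion.branches
  obtain ⟨δ', hδ', vi, vo⟩ := h.v_expansion.branches
  have hgov := h.governing
  have hr : (r₀ : ℂ) ≠ 0 := by exact_mod_cast hr₀.ne'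
  have hπ : (Real.pi : ℂ) ≠ 0 := by exact_mod_cast Real.pi_ne_zero
  have uiN := ui.normal hr₀ hδ hf1 hfb hfd
  have uiT := ui.tangent hr₀ hδ hf1 hfb hfd
  have uoN := uo.normal hr₀ hδ hf1 hfb hfd
  have viN := vi.normal hr₀ hδ' hf1 hfb hfd
  have voN := vo.normal hr₀ hδ' hf1 hfb hfd
  have juu := (uo.trace hr₀ hδ hfb).unique (ui.trace hr₀ hδ hfb)
    (hgov.mono fun ε hε θ => hε.u_jump θ)
  have jfu := uoN.unique (uiN.const_mul m.epsOne) (hgov.mono fun ε hε θ => hε.u_flux θ)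
  have hperp := ((((uiN.const_mul m.epsOne).mul (uiN.const_mul m.epsOne)).const_mul
    m.chiPerp).const_mul (4 * Real.pi))
  have jvv := ((vo.trace hr₀ hδ' hfb).sub (vi.trace hr₀ hδ' hfb)).unique hperp
    (hgov.mono fun ε hε θ => (hε.v_jump θ).trans (by rw [polPerp, sq]))
  have hpar : HasUniformExpansion (fun ε θ => polPar m (perturbedCurve r₀ f ε) (u ε) θ)
      (polPar m (circleCurve r₀) u₀) (polParOne m r₀ f u₀ u₁) :=
    (((uiN.const_mul m.epsOne).const_mul (2 * m.chiPar)).mul uiT).congr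
      (Filter.Eventually.of_forall fun _ _ => rfl) (fun _ => rfl) fun θ => by
        rw [polParOne, tangentVariation, normalVariation]; ring
  -- the flux condition, multiplied by the length element: an expansion of `∂P_∥/∂θ`
  have hflux := ((norm_deriv_perturbedCurve_expansion hr₀ hf1 hfb hfd).bilinear
    (ContinuousLinearMap.lsmul ℝ ℝ) (voN.sub (viN.const_mul m.epsTwo))).const_mul
      (1 / (4 * Real.pi))
  have hder := hpar.hasDerivAt hflux (by
    filter_upwards [hgov, ui.differentiable_normal_tangent hr₀ hδ hf hfb,
      eventually_radius_pos hr₀ hfb zero_lt_one] with ε e1 e2 e3 θ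
    have hd : DifferentiableAt ℝ (polPar m (perturbedCurve r₀ f ε) (u ε)) θ :=
      (((e2 θ).1.const_mul _).const_mul _).mul (e2 θ).2
    have hn : (‖deriv (perturbedCurve r₀ f ε) θ‖ : ℂ) ≠ 0 := by
      have : 0 < r₀ + ε * f θ := (half_pos hr₀).trans_le (e3 θ).1
      rw [norm_deriv_perturbedCurve hf1]
      exact_mod_cast (Real.sqrt_pos.2 (by positivity)).ne'
    have hval : deriv (polPar m (perturbedCurve r₀ f ε) (u ε)) θ
        = 1 / (4 * Real.pi) * (‖deriv (perturbedCurve r₀ f ε) θ‖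
          * (dNormal (perturbedCurve r₀ f ε) (v ε).outside θ
            - m.epsTwo * dNormal (perturbedCurve r₀ f ε) (v ε).inside θ)) := by
      rw [e1.v_flux θ, surfaceCharge]
      field_simp
    have h1 := hd.hasDerivAt
    rw [hval] at h1
    simpa only [ContinuousLinearMap.lsmul_apply, Complex.real_smul] using h1)
  have hder₀ : ∀ θ, deriv (polPar m (circleCurve r₀) u₀) θ = 1 / (4 * Real.pi) * (r₀
      * (dNormal (circleCurve r₀) v₀.outside θ - m.epsTwo * dNormal (circleCurve r₀) v₀.inside θ)) :=
    fun θ => by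
      rw [(hder θ).1.deriv, ContinuousLinearMap.lsmul_apply, Complex.real_smul]
  have hder₁ : ∀ θ, deriv (polParOne m r₀ f u₀ u₁) θ = _ := fun θ => (hder θ).2.deriv
  simp only [ContinuousLinearMap.lsmul_apply, Complex.real_smul] at hder₁
  constructor
  · refine ⟨hu₀, fun θ => (juu θ).1, fun θ => (jfu θ).1, h.u_zero_infinity, hv₀, fun θ => ?_,
      fun θ => ?_, h.v_zero_infinity⟩
    · rw [(jvv θ).1, polPerp, sq]
    · rw [surfaceCharge, norm_deriv_circleCurve hr₀, hder₀ θ]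
      field_simp
  · refine ⟨hu₁, fun θ => ?_, fun θ => ?_, h.u_one_infinity, hv₁, fun θ => ?_, fun θ => ?_,
      h.v_one_infinity⟩
    · rw [jumpShift]; linear_combination (juu θ).2
    · rw [fluxShift]; linear_combination (jfu θ).2
    · rw [jumpShift, polPerpOne, normalVariation]; linear_combination (jvv θ).2
    · rw [fluxShift, surfaceChargeOne, hder₀ θ, hder₁ θ]
      field_simp
      ring

end Coefficients

theorem contDiff_cosProfile (r₀ : ℝ) (n : ℕ) : ContDiff ℝ 2 (cosProfile r₀ n) := by
  unfold cosProfile; fun_prop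

theorem cosProfile_bounded (r₀ : ℝ) (n : ℕ) : ∃ C, ∀ θ, ‖cosProfile r₀ n θ‖ ≤ C := by
  refine ⟨|r₀| * 1, fun θ => ?_⟩
  rw [cosProfile, norm_mul]
  exact mul_le_mul_of_nonneg_left (Real.abs_cos_le_one _) (abs_nonneg _)

theorem deriv_cosProfile_bounded (r₀ : ℝ) (n : ℕ) : ∃ C, ∀ θ, ‖deriv (cosProfile r₀ n) θ‖ ≤ C := by
  refine ⟨|r₀| * (n * 1), fun θ => ?_⟩
  rw [(hasDerivAt_cosProfile n θ r₀).deriv, norm_mul, norm_neg, norm_mul, Real.norm_natCast]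
  exact mul_le_mul_of_nonneg_left (mul_le_mul_of_nonneg_left (Real.abs_sin_le_one _)
    (Nat.cast_nonneg n)) (abs_nonneg _)

/-! ### Symmetry of the perturbed circle -/

theorem eq_one_of_norm_of_re {a : ℂ} (ha : ‖a‖ = 1) (h : a.re = 1) : a = 1 := by
  have h1 : a.re ^ 2 + a.im ^ 2 = 1 := by
    rw [← one_pow 2, ← ha, ← Complex.normSq_eq_norm_sq, Complex.normSq_apply]; ring
  have h2 : a.im = 0 := by
    rw [h] at h1
    exact pow_eq_zero_iff two_ne_zero |>.1 (by linarith)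
  exact Complex.ext h h2

section Symmetry

variable {r₀ ε : ℝ} {n : ℕ}

/-- The perturbed circle in terms of unit vectors: in the direction `w` it has the
radius `r₀ (1 + ε Re wⁿ)`. -/
theorem mem_cosBoundary_iff {z : ℂ} : z ∈ cosBoundary r₀ n ε ↔
    ∃ w : ℂ, ‖w‖ = 1 ∧ z = (r₀ * (1 + ε * (w ^ n).re) : ℝ) * w := by
  have key : ∀ θ : ℝ, perturbedCurve r₀ (cosProfile r₀ n) ε θ
      = (r₀ * (1 + ε * (Complex.exp (θ * Complex.I) ^ n).re) : ℝ)
        * Complex.exp (θ * Complex.I) := fun θ => by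
    have : (Complex.exp (θ * Complex.I) ^ n).re = Real.cos (n * θ) := by
      rw [← Complex.exp_nat_mul, ← mul_assoc, ← Complex.exp_ofReal_mul_I_re]
      push_cast; rfl
    rw [this, perturbedCurve, circleCurve, cosProfile]
    push_cast; ring
  constructor
  · rintro ⟨θ, rfl⟩
    exact ⟨_, norm_exp_mul_I θ, key θ⟩
  · rintro ⟨w, hw, rfl⟩
    obtain ⟨θ, rfl⟩ := (Complex.norm_eq_one_iff w).1 hw
    exact ⟨θ, key θ⟩

theorem cosRadius_pos (hr₀ : 0 < r₀) (hε : 0 < ε) (hε1 : ε < 1) {w : ℂ} (hw : ‖w‖ = 1) :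
    0 < r₀ * (1 + ε * (w ^ n).re) := by
  have h1 : |(w ^ n).re| ≤ 1 := (Complex.abs_re_le_norm _).trans (by rw [norm_pow, hw, one_pow])
  have h2 := (abs_le.1 h1).1
  have : 0 < 1 + ε * (w ^ n).re := by nlinarith
  positivity

/-- The maximal radius `r₀ (1 + ε)` is only attained in the directions of `n`-th roots of unity. -/
theorem pow_eq_one_of_mem_cosBoundary (hr₀ : 0 < r₀) (hε : 0 < ε) (hε1 : ε < 1) {a : ℂ}
    (ha : ‖a‖ = 1) (h : ((r₀ * (1 + ε) : ℝ) : ℂ) * a ∈ cosBoundary r₀ n ε) : a ^ n = 1 := by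
  obtain ⟨w, hw, e⟩ := mem_cosBoundary_iff.1 h
  have hpos := cosRadius_pos (n := n) hr₀ hε hε1 hw
  have hpos' : 0 < r₀ * (1 + ε) := by positivity
  have hnorm : r₀ * (1 + ε) = r₀ * (1 + ε * (w ^ n).re) := by
    have := congrArg norm e
    rwa [norm_mul, norm_mul, ha, hw, Complex.norm_of_nonneg hpos'.le,
      Complex.norm_of_nonneg hpos.le, mul_one, mul_one] at this
  rw [← hnorm] at e
  have haw : a = w := mul_left_cancel₀ (by exact_mod_cast hpos'.ne') e
  subst haw
  refine eq_one_of_norm_of_re (by rw [norm_pow, ha, one_pow]) ?_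
  have h1 := mul_left_cancel₀ hr₀.ne' hnorm
  have h2 : ε * 1 = ε * (a ^ n).re := by linarith
  exact (mul_left_cancel₀ hε.ne' h2).symm

theorem tip_mem_cosBoundary : ((r₀ * (1 + ε) : ℝ) : ℂ) ∈ cosBoundary r₀ n ε :=
  mem_cosBoundary_iff.2 ⟨1, norm_one, by simp⟩

theorem mul_mem_cosBoundary {a z : ℂ} (ha : ‖a‖ = 1) (han : a ^ n = 1)
    (hz : z ∈ cosBoundary r₀ n ε) : a * z ∈ cosBoundary r₀ n ε := by
  obtain ⟨w, hw, rfl⟩ := mem_cosBoundary_iff.1 hz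
  refine mem_cosBoundary_iff.2 ⟨a * w, by rw [norm_mul, ha, hw, one_mul], ?_⟩
  rw [mul_pow, han, one_mul]; ring

theorem conj_mem_cosBoundary {z : ℂ} (hz : z ∈ cosBoundary r₀ n ε) :
    (starRingEnd ℂ) z ∈ cosBoundary r₀ n ε := by
  obtain ⟨w, hw, rfl⟩ := mem_cosBoundary_iff.1 hz
  refine mem_cosBoundary_iff.2 ⟨(starRingEnd ℂ) w, by rw [Complex.norm_conj, hw], ?_⟩
  rw [map_mul, Complex.conj_ofReal, ← map_pow, Complex.conj_re]

theorem hasInversionSymmetry_cosBoundary_iff (hr₀ : 0 < r₀) (hε : 0 < ε) (hε1 : ε < 1) :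
    HasInversionSymmetry (cosBoundary r₀ n ε) ↔ Even n := by
  constructor
  · intro h
    have h1 := h _ tip_mem_cosBoundary
    rw [← mul_neg_one] at h1
    exact (neg_one_pow_eq_one_iff_even (by norm_num : (-1 : ℂ) ≠ 1)).1
      (pow_eq_one_of_mem_cosBoundary hr₀ hε hε1 (by simp) h1)
  · intro h z hz
    rw [← neg_one_mul]
    exact mul_mem_cosBoundary (by simp) h.neg_one_pow hz

theorem rotation_image_cosBoundary_iff (hr₀ : 0 < r₀) (hε : 0 < ε) (hε1 : ε < 1) (a : Circle) :
    rotation a '' cosBoundary r₀ n ε = cosBoundary r₀ n ε ↔ a ^ n = 1 := by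
  constructor
  · intro h
    have h1 : rotation a _ ∈ cosBoundary r₀ n ε := h ▸ mem_image_of_mem _ tip_mem_cosBoundary
    rw [rotation_apply, mul_comm] at h1
    exact Circle.ext (by
      rw [Circle.coe_pow, Circle.coe_one]
      exact pow_eq_one_of_mem_cosBoundary hr₀ hε hε1 a.norm_coe h1)
  · intro h
    have hc : ∀ b : Circle, b ^ n = 1 → (b : ℂ) ^ n = 1 := fun b hb => by
      rw [← Circle.coe_pow, hb, Circle.coe_one]
    refine Subset.antisymm ?_ fun z hz => ⟨(a⁻¹ : Circle) * z, ?_, ?_⟩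
    · rintro _ ⟨z, hz, rfl⟩
      exact mul_mem_cosBoundary a.norm_coe (hc a h) hz
    · exact mul_mem_cosBoundary (a⁻¹).norm_coe (hc _ (by rw [inv_pow, h, inv_one])) hz
    · rw [rotation_apply, ← mul_assoc, ← Circle.coe_mul, mul_inv_cancel, Circle.coe_one, one_mul]

theorem conjLIE_image_cosBoundary :
    Complex.conjLIE '' cosBoundary r₀ n ε = cosBoundary r₀ n ε :=
  Subset.antisymm (by rintro _ ⟨z, hz, rfl⟩; exact conj_mem_cosBoundary hz)
    fun z hz => ⟨_, conj_mem_cosBoundary hz, Complex.conj_conj z⟩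

theorem encard_circle_pow_eq_one (hn : 0 < n) : {a : Circle | a ^ n = 1}.encard = n := by
  have hinj : Function.Injective (fun a : Circle => (a : ℂ)) := Circle.coe_injective
  have himg : (fun a : Circle => (a : ℂ)) '' {a : Circle | a ^ n = 1}
      = (Polynomial.nthRootsFinset n (1 : ℂ) : Set ℂ) := by
    ext z
    rw [Finset.mem_coe, Polynomial.mem_nthRootsFinset hn]
    constructor
    · rintro ⟨a, ha, rfl⟩
      have ha' : a ^ n = 1 := ha
      show (a : ℂ) ^ n = 1
      rw [← Circle.coe_pow, ha', Circle.coe_one]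
    · intro hz
      have h1 : ‖z‖ = 1 := Complex.norm_eq_one_of_pow_eq_one hz hn.ne'
      exact ⟨⟨z, mem_sphere_zero_iff_norm.2 h1⟩, Circle.ext hz, rfl⟩
  rw [← hinj.encard_image, himg, encard_coe_eq_coe_finsetCard,
    (Complex.isPrimitiveRoot_exp n hn.ne').card_nthRootsFinset]

/-- By the classification of the linear isometries of the plane, the symmetry group is dihedral. -/
theorem symmetryDegree_cosBoundary (hr₀ : 0 < r₀) (hε : 0 < ε) (hε1 : ε < 1) (hn : 0 < n) :
    symmetryDegree (cosBoundary r₀ n ε) = 2 * n := by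
  have hset : {g : ℂ ≃ₗᵢ[ℝ] ℂ | g '' cosBoundary r₀ n ε = cosBoundary r₀ n ε}
      = rotation '' {a : Circle | a ^ n = 1}
        ∪ (fun a => Complex.conjLIE.trans (rotation a)) '' {a : Circle | a ^ n = 1} := by
    have hrefl : ∀ a : Circle, (Complex.conjLIE.trans (rotation a)) '' cosBoundary r₀ n ε
        = rotation a '' cosBoundary r₀ n ε := fun a => by
      rw [LinearIsometryEquiv.coe_trans, image_comp, conjLIE_image_cosBoundary]
    ext g
    constructor
    · intro hg
      have hg' : g '' cosBoundary r₀ n ε = cosBoundary r₀ n ε := hg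
      obtain ⟨a, rfl | rfl⟩ := linear_isometry_complex g
      · exact Or.inl ⟨a, (rotation_image_cosBoundary_iff hr₀ hε hε1 a).1 hg', rfl⟩
      · exact Or.inr ⟨a, (rotation_image_cosBoundary_iff hr₀ hε hε1 a).1 (hrefl a ▸ hg'), rfl⟩
    · rintro (⟨a, ha, rfl⟩ | ⟨a, ha, rfl⟩)
      · exact (rotation_image_cosBoundary_iff hr₀ hε hε1 a).2 ha
      · exact (hrefl a).trans ((rotation_image_cosBoundary_iff hr₀ hε hε1 a).2 ha)
  have hinj : Function.Injective fun a : Circle => Complex.conjLIE.trans (rotation a) :=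
    fun a b hab => rotation_injective (LinearIsometryEquiv.ext fun z => by
      have := congrArg (fun g : ℂ ≃ₗᵢ[ℝ] ℂ => g ((starRingEnd ℂ) z)) hab
      simpa using this)
  have hdisj : Disjoint (rotation '' {a : Circle | a ^ n = 1})
      ((fun a => Complex.conjLIE.trans (rotation a)) '' {a : Circle | a ^ n = 1}) := by
    rw [disjoint_left]
    rintro _ ⟨a, -, rfl⟩ ⟨b, -, hab⟩
    -- a rotation and a reflection that agree at `1` differ at `I`
    have h1 := congrArg (fun g : ℂ ≃ₗᵢ[ℝ] ℂ => g 1) hab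
    have h2 := congrArg (fun g : ℂ ≃ₗᵢ[ℝ] ℂ => g Complex.I) hab
    simp only [LinearIsometryEquiv.trans_apply, Complex.conjLIE_apply, rotation_apply, map_one,
      mul_one, Complex.conj_I] at h1 h2
    rw [h1, mul_neg, neg_eq_iff_add_eq_zero, ← two_mul] at h2
    exact mul_ne_zero two_ne_zero (mul_ne_zero a.coe_ne_zero Complex.I_ne_zero) h2
  rw [symmetryDegree, hset, encard_union_eq hdisj, rotation_injective.encard_image,
    hinj.encard_image, encard_circle_pow_eq_one hn, two_mul]

end Symmetry

/-! ### Radiation and symmetry of the perturbed disk -/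

theorem IsPiecewiseHarmonic.harmonicOnNhd_outside {r₀ : ℝ} (hr₀ : 0 < r₀) {w : Potential}
    (h : IsPiecewiseHarmonic (Metric.ball 0 r₀) w) : HarmonicOnNhd w.outside {z | r₀ < ‖z‖} :=
  h.outside_harmonic.mono fun z hz => by
    rw [closure_ball _ hr₀.ne', mem_compl_iff, mem_closedBall_zero_iff, not_le]
    exact hz

theorem mainTheorem1 (m : Medium) (h_one : m.epsOne ≠ -1) (h_two : m.epsTwo ≠ -1)
    (E r₀ : ℝ) (hE : 0 < E) (hr₀ : 0 < r₀) (n : ℕ) (hn : 3 ≤ n) :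
    -- the leading-order and first-order systems are solvable
    (∃ u₀ v₀ u₁ v₁ : Potential,
      IsLeadingSolution m (uniformBackground E) r₀ u₀ v₀ ∧
      IsFirstOrderSolution m r₀ (cosProfile r₀ n) u₀ v₀ u₁ v₁) ∧
    -- the coefficients of any expansion of fields on the perturbed disks satisfy these systems
    (∀ (u v : ℝ → Potential) (u₀ v₀ u₁ v₁ : Potential),
      IsFirstOrderExpansion m (uniformBackground E) r₀ (cosProfile r₀ n) u v u₀ v₀ u₁ v₁ →
      IsLeadingSolution m (uniformBackground E) r₀ u₀ v₀ ∧
      IsFirstOrderSolution m r₀ (cosProfile r₀ n) u₀ v₀ u₁ v₁) ∧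
    -- the first-order second-harmonic correction and its radiation
    (∀ u₀ v₀ u₁ v₁ : Potential,
      IsLeadingSolution m (uniformBackground E) r₀ u₀ v₀ →
      IsFirstOrderSolution m r₀ (cosProfile r₀ n) u₀ v₀ u₁ v₁ →
      (∀ r θ : ℝ, r₀ < r →
        v₁.outside (r * Complex.exp (θ * Complex.I)) =
          coeffLow m E r₀ n * (1 / r ^ (n - 2)) * Real.cos ((n - 2) * θ)
          + coeffMid m E r₀ n * (1 / r ^ n) * Real.cos (n * θ)
          + coeffHigh m E r₀ n * (1 / r ^ (n + 2)) * Real.cos ((n + 2) * θ)) ∧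
      IsMultipoleRadiation (n - 2) v₁.outside ∧
      (IsMultipoleRadiation (n - 1) v₁.outside ↔ coeffLow m E r₀ n = 0) ∧
      (n = 3 → ∀ ε : ℝ, 0 < ε →
        IsDipoleRadiation (fun z => v₀.outside z + ε * v₁.outside z) ∧
        (IsMultipoleRadiation 2 (fun z => v₀.outside z + ε * v₁.outside z) ↔
          coeffLow m E r₀ 3 = 0))) ∧
    -- the symmetry of the perturbed boundary
    (∀ ε : ℝ, 0 < ε → ε < 1 →
      symmetryDegree (cosBoundary r₀ n ε) = 2 * n ∧
      ((¬ HasInversionSymmetry (cosBoundary r₀ n ε) ∧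
        ∀ k : ℕ, 3 ≤ k → ¬ HasInversionSymmetry (cosBoundary r₀ k ε) →
          symmetryDegree (cosBoundary r₀ n ε) ≤ symmetryDegree (cosBoundary r₀ k ε)) ↔
        n = 3)) := by
  have hasymp : ∀ u₀ v₀ u₁ v₁ : Potential,
      IsLeadingSolution m (uniformBackground E) r₀ u₀ v₀ →
      IsFirstOrderSolution m r₀ (cosProfile r₀ n) u₀ v₀ u₁ v₁ →
      v₁.outside =ᶠ[cobounded ℂ] (firstTwo m E r₀ n).outside := fun u₀ v₀ u₁ v₁ h h' => by
    filter_upwards [tendsto_norm_cobounded_atTop.eventually_ge_atTop r₀] with z hz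
      using eq_firstTwo h_one h_two hr₀ hn h.governing h' z hz
  refine ⟨⟨_, _, _, _, isLeadingSolution_leading m E h_one h_two hr₀,
    isFirstOrderSolution_first m E h_one h_two hr₀ hn⟩, fun u v u₀ v₀ u₁ v₁ h => ?_,
    fun u₀ v₀ u₁ v₁ h h' => ?_, fun ε hε hε1 => ?_⟩
  · obtain ⟨h0, h1⟩ := h.coefficients hr₀ (contDiff_cosProfile r₀ n) (cosProfile_bounded r₀ n)
      (deriv_cosProfile_bounded r₀ n)
    exact ⟨isLeadingSolution_of_governing h_one h_two hr₀ h0, h1⟩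
  · have heq := hasymp u₀ v₀ u₁ v₁ h h'
    have hharm := IsPiecewiseHarmonic.harmonicOnNhd_outside hr₀ h'.v_harmonic
    have hharm₀ := IsPiecewiseHarmonic.harmonicOnNhd_outside hr₀ h.governing.v_harmonic
    have hlow : (fun z => v₁.outside z - coeffLow m E r₀ n * cosMode (-(n - 2 : ℕ)) z)
        =O[cobounded ℂ] fun z => (‖z‖ ^ (n - 2 + 1))⁻¹ :=
      (firstTwo_sub_low_isBigO (E := E) h_one h_two hr₀ hn).congr'
        (heq.mono fun z hz => by simp only [hz]) (Eventually.of_forall fun _ => rfl)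
    have hone : v₁.outside =O[cobounded ℂ] fun z => (‖z‖ ^ (n - 2))⁻¹ :=
      firstTwo_isBigO.congr' heq.symm (Eventually.of_forall fun _ => rfl)
    refine ⟨fun r θ hr => ?_, ⟨⟨r₀, hharm⟩, hone⟩, ?_, ?_⟩
    · rw [← firstTwo_outside_polar h_one h_two hr₀ hn]
      refine eq_firstTwo h_one h_two hr₀ hn h.governing h' _ ?_
      rw [norm_mul, norm_exp_mul_I, mul_one, Complex.norm_of_nonneg (hr₀.trans hr).le]
      exact hr.le
    · have hiff := isBigO_succ_iff_coeff_eq_zero hlow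
      rw [show n - 2 + 1 = n - 1 by omega] at hiff
      exact ⟨fun hw => hiff.1 hw.2, fun hA => ⟨⟨r₀, hharm⟩, hiff.2 hA⟩⟩
    · rintro rfl ε hε
      have hsum : HarmonicOnNhd (fun z => v₀.outside z + ε * v₁.outside z) {z | r₀ < ‖z‖} :=
        fun z hz => (hharm₀ z hz).add ((hharm z hz).const_mul _)
      have hv₀ : v₀.outside =O[cobounded ℂ] fun z => (‖z‖ ^ (1 + 1))⁻¹ := h.v_decay
      -- the leading-order field is a quadrupole and does not contribute to the dipole moment
      have hsumlow : (fun z => v₀.outside z + ε * v₁.outside z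
          - ε * coeffLow m E r₀ 3 * cosMode (-(1 : ℕ)) z)
          =O[cobounded ℂ] fun z => (‖z‖ ^ (1 + 1))⁻¹ :=
        (hv₀.add (hlow.const_mul_left (ε : ℂ))).congr_left fun z => by
          simp only [Nat.reduceSub]; ring
      have hiff := isBigO_succ_iff_coeff_eq_zero hsumlow
      have hε' : (ε : ℂ) ≠ 0 := by exact_mod_cast hε.ne'
      rw [mul_eq_zero, or_iff_right hε'] at hiff
      refine ⟨⟨⟨r₀, hsum⟩, ?_⟩, fun hw => hiff.1 hw.2, fun hA => ⟨⟨r₀, hsum⟩, hiff.2 hA⟩⟩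
      have hdecay : (fun z : ℂ => (‖z‖ ^ 2)⁻¹) =O[cobounded ℂ] fun z => (‖z‖ ^ 1)⁻¹ := by
        refine IsBigO.of_bound 1 ?_
        filter_upwards [tendsto_norm_cobounded_atTop.eventually_ge_atTop 1] with z hz
        have hz0 : 0 < ‖z‖ := one_pos.trans_le hz
        rw [one_mul, Real.norm_of_nonneg (by positivity), Real.norm_of_nonneg (by positivity)]
        exact inv_anti₀ (by positivity) (pow_le_pow_right₀ hz (by norm_num))
      exact (h.v_decay.trans hdecay).add (hone.const_mul_left (ε : ℂ))
  · have hdeg : ∀ k : ℕ, 3 ≤ k → symmetryDegree (cosBoundary r₀ k ε) = 2 * k := fun k hk =>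
      symmetryDegree_cosBoundary hr₀ hε hε1 (by omega)
    have hinv : ∀ k : ℕ, HasInversionSymmetry (cosBoundary r₀ k ε) ↔ Even k := fun k =>
      hasInversionSymmetry_cosBoundary_iff hr₀ hε hε1
    have hle : ∀ k : ℕ, (2 * n : ℕ∞) ≤ 2 * k ↔ n ≤ k := fun k => by
      norm_cast; omega
    refine ⟨hdeg n hn, fun ⟨_, hmin⟩ => ?_, ?_⟩
    · have h3 := hmin 3 le_rfl (by rw [hinv]; decide)
      rw [hdeg n hn, hdeg 3 le_rfl, hle] at h3
      omega
    · rintro rfl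
      refine ⟨by rw [hinv]; decide, fun k hk _ => ?_⟩
      rw [hdeg 3 le_rfl, hdeg k hk, hle]
      exact hk
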